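/- Let $(A,\mathfrak m)$ be a Noetherian local ring with infinite residue field, and let $I\subseteq A$ be an ideal that contains a nonzerodivisor. Let $F(I)=A[It]/\mathfrak mA[It]=\bigoplus_{n\ge 0}I^n/\mathfrak m I^n$ be its fiber cone. An ideal $J\subseteq I$ is a reduction of $I$ if $I^{n+1}=JI^n$ for some $n$, and a minimal reduction if it is minimal among the reductions of $I$ with respect to inclusion; $r_J(I)$ denotes the least $n$ with $I^{n+1}=JI^n$, and the reduction number of $I$ is the least value of $r_J(I)$ over all minimal reductions $J$ of $I$. Assume that $I$ has analytic spread one, i.e. $\dim F(I)=1$, and reduction number $2$. Write $\mu$ for the minimal number of generators, $\lambda$ for length, and $(L:I)=\{x\in A : xI\subseteq L\}$. A Noetherian ring is called Cohen–Macaulay, Gorenstein or Buchsbaum if all its localizations at maximal ideals are; a Noetherian local ring is Gorenstein if it has finite injective dimension over itself, and a Noetherian local ring $(R,\mathfrak n)$ is Buchsbaum if every system of parameters $x_1,\dots,x_d$ of $R$ satisfies $\mathfrak n\,((x_1,\dots,x_{i-1}):x_i)\subseteq (x_1,\dots,x_{i-1})$ for $1\le i\le d$. Then: 1. For every minimal reduction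 $J=(a)$ of $I$, the length $\alpha=\lambda\big((aI\cap\mathfrak mI^2)/a\mathfrak mI\big)$ is finite, the integers $\mu(I)-1-\alpha$ and $\mu(I^2)-\mu(I)+\alpha$ are nonnegative, and there is an isomorphism of graded $F(J)$-modules $$F(I)\cong F(J)\oplus F(J)(-1)^{\mu(I)-1-\alpha}\oplus F(J)(-2)^{\mu(I^2)-\mu(I)+\alpha}\oplus \big(F(J)/JF(J)\big)(-1)^{\alpha},$$ where $JF(J)$ is the ideal of $F(J)$ generated by $F(J)_1=J/\mathfrak mJ$. 2. $F(I)$ is a Buchsbaum ring. 3. The following conditions are equivalent: (a) $F(I)$ is a Cohen–Macaulay ring; (b) $aI\cap\mathfrak mI^2=a\mathfrak mI$ for every minimal reduction $(a)$ of $I$; (b') $aI\cap\mathfrak mI^2=a\mathfrak mI$ for some minimal reduction $(a)$ of $I$; (c) $\mu(I^2)-\mu(I)=\lambda\big(I^2/(\mathfrak mI^2+aI)\big)$ for every minimal reduction $(a)$ of $I$; (c') $\mu(I^2)-\mu(I)=\lambda\big(I^2/(\mathfrak mI^2+aI)\big)$ for some minimal reduction $(a)$ of $I$. 4. The following conditions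 are equivalent: (a) $F(I)$ is a Gorenstein ring; (b) for every minimal reduction $(a)$ of $I$ one has $\mu(I^2)-\mu(I)=\lambda\big(I^2/(\mathfrak mI^2+aI)\big)=1$ and $I\cap\big((aI+\mathfrak mI^2):I\big)=(a)+\mathfrak mI$; (b') for some minimal reduction $(a)$ of $I$ one has $\mu(I^2)-\mu(I)=\lambda\big(I^2/(\mathfrak mI^2+aI)\big)=1$ and $I\cap\big((aI+\mathfrak mI^2):I\big)=(a)+\mathfrak mI$. -/

import Mathlib

open IsLocalRing

/-! ### Cohen-Macaulay, Gorenstein and Buchsbaum rings -/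

/-- A Noetherian local ring is Cohen-Macaulay if its maximal ideal contains a regular sequence
whose length is the Krull dimension of the ring. -/
def IsCohenMacaulayLocal (R : Type*) [CommRing R] [IsLocalRing R] : Prop :=
  IsNoetherianRing R ∧ ∃ xs : List R, (∀ x ∈ xs, x ∈ maximalIdeal R) ∧
    RingTheory.Sequence.IsRegular R xs ∧ (xs.length : WithBot ℕ∞) = ringKrullDim R

/-- A Noetherian local ring is Gorenstein if it has finite injective dimension as a module over
itself. -/
def IsGorensteinLocal (R : Type*) [CommRing R] [IsLocalRing R] : Prop :=
  IsNoetherianRing R ∧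
    ∃ n : ℕ, CategoryTheory.HasInjectiveDimensionLE (ModuleCat.of R R) n

/-- `x₁, …, x_d` is a system of parameters of a local ring `R`: elements of the maximal ideal,
`d = dim R`, and the ideal `(x₁, …, x_d)` is primary to the maximal ideal. -/
def IsSystemOfParameters {R : Type*} [CommRing R] [IsLocalRing R] (xs : List R) : Prop :=
  (∀ x ∈ xs, x ∈ maximalIdeal R) ∧ (xs.length : WithBot ℕ∞) = ringKrullDim R ∧
    (Ideal.ofList xs).radical = maximalIdeal R

/-- `x₁, …, x_d` is a weak sequence in a local ring `(R, 𝔪)`: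
`𝔪 ((x₁, …, xᵢ₋₁) : xᵢ) ⊆ (x₁, …, xᵢ₋₁)` for `i = 1, …, d`. -/
def IsWeakSequence {R : Type*} [CommRing R] [IsLocalRing R] (xs : List R) : Prop :=
  ∀ (i : ℕ) (hi : i < xs.length) (y : R), xs[i] * y ∈ Ideal.ofList (xs.take i) →
    ∀ z ∈ maximalIdeal R, z * y ∈ Ideal.ofList (xs.take i)

/-- A Noetherian local ring is Buchsbaum if every system of parameters is a weak sequence. -/
def IsBuchsbaumLocal (R : Type*) [CommRing R] [IsLocalRing R] : Prop :=
  IsNoetherianRing R ∧ ∀ xs : List R, IsSystemOfParameters xs → IsWeakSequence xs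

/-- A Noetherian ring is Cohen-Macaulay if all its localizations at maximal ideals are. -/
def IsCohenMacaulay (R : Type*) [CommRing R] : Prop :=
  IsNoetherianRing R ∧ ∀ (P : Ideal R) [P.IsMaximal],
    IsCohenMacaulayLocal (Localization.AtPrime P)

/-- A Noetherian ring is Gorenstein if all its localizations at maximal ideals are. -/
def IsGorenstein (R : Type*) [CommRing R] : Prop :=
  IsNoetherianRing R ∧ ∀ (P : Ideal R) [P.IsMaximal],
    IsGorensteinLocal (Localization.AtPrime P)

/-- A Noetherian ring is Buchsbaum if all its localizations at maximal ideals are. (For a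
standard graded algebra over a field this contains the Buchsbaum property of the localization
at the irrelevant ideal.) -/
def IsBuchsbaum (R : Type*) [CommRing R] : Prop :=
  IsNoetherianRing R ∧ ∀ (P : Ideal R) [P.IsMaximal],
    IsBuchsbaumLocal (Localization.AtPrime P)

/-! ### Reductions -/

/-- `J ⊆ I` is a reduction of `I` if `I ^ (n + 1) = J I ^ n` for some `n`. -/
def IsReduction {A : Type*} [CommRing A] (J I : Ideal A) : Prop :=
  J ≤ I ∧ ∃ n : ℕ, I ^ (n + 1) = J * I ^ n

/-- A reduction of `I` that is minimal, with respect to inclusion, among the reductions of `I`. -/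
def IsMinimalReduction {A : Type*} [CommRing A] (J I : Ideal A) : Prop :=
  IsReduction J I ∧ ∀ K : Ideal A, IsReduction K I → K ≤ J → K = J

/-- The reduction number `r_J(I)` of `I` with respect to a reduction `J`: the least `r` with
`I ^ (r + 1) = J I ^ r`. -/
noncomputable def reductionNumberWith {A : Type*} [CommRing A] (J I : Ideal A) : ℕ :=
  sInf {r : ℕ | I ^ (r + 1) = J * I ^ r}

/-- The reduction number of `I`: the least `r_J(I)`, over all minimal reductions `J` of `I`. -/
noncomputable def reductionNumber {A : Type*} [CommRing A] (I : Ideal A) : ℕ :=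
  sInf {r : ℕ | ∃ J : Ideal A, IsMinimalReduction J I ∧ reductionNumberWith J I = r}

/-- The length `λ(N / L)` for ideals `L ⊆ N`. -/
noncomputable def lengthQuot {A : Type*} [CommRing A] (N L : Ideal A) : ℕ∞ :=
  Module.length A (N ⧸ L.submoduleOf N)

/-! ### The fiber cone -/

section FiberCone

variable {A : Type*} [CommRing A]

/-- For `J ⊆ I` one has `A[Jt] ⊆ A[It]`. -/
theorem reesAlgebra_le {J I : Ideal A} (h : J ≤ I) : reesAlgebra J ≤ reesAlgebra I :=
  fun _ hf i => Ideal.pow_right_mono h i (hf i)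

variable [IsLocalRing A]

/-- The fiber cone `F(I) = A[It] / 𝔪 A[It] = ⨁ Iⁿ / 𝔪 Iⁿ` of an ideal `I` of a local ring
`(A, 𝔪)`. -/
def FiberCone (I : Ideal A) : Type _ :=
  reesAlgebra I ⧸ (maximalIdeal A).map (algebraMap A (reesAlgebra I))

noncomputable instance (I : Ideal A) : CommRing (FiberCone I) :=
  inferInstanceAs
    (CommRing (reesAlgebra I ⧸ (maximalIdeal A).map (algebraMap A (reesAlgebra I))))

noncomputable instance (I : Ideal A) : Algebra A (FiberCone I) :=
  inferInstanceAs
    (Algebra A (reesAlgebra I ⧸ (maximalIdeal A).map (algebraMap A (reesAlgebra I))))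

/-- The projection `A[It] → F(I)`. -/
noncomputable def fiberMk (I : Ideal A) : reesAlgebra I →ₐ[A] FiberCone I :=
  Ideal.Quotient.mkₐ A ((maximalIdeal A).map (algebraMap A (reesAlgebra I)))

/-- The component `F(I)ₙ = Iⁿ / 𝔪 Iⁿ` of degree `n`: the classes of the elements `c tⁿ` of
`A[It]`, `c ∈ Iⁿ`. -/
noncomputable def fiberPiece (I : Ideal A) (n : ℕ) : Submodule A (FiberCone I) :=
  ((LinearMap.range (Polynomial.monomial n : A →ₗ[A] Polynomial A)).comap
    (reesAlgebra I).val.toLinearMap).map (fiberMk I).toLinearMap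

/-- The homomorphism `F(J) → F(I)` induced by the inclusion `A[Jt] ⊆ A[It]`, for `J ⊆ I`. -/
noncomputable def fiberMap {J I : Ideal A} (h : J ≤ I) : FiberCone J →ₐ[A] FiberCone I :=
  Ideal.quotientMapₐ _ (Subalgebra.inclusion (reesAlgebra_le h)) (by
    rw [Ideal.map_le_iff_le_comap]
    intro x hx
    exact Ideal.mem_map_of_mem (algebraMap A (reesAlgebra I)) hx)

/-- The ideal `J F(J)` of `F(J)`, generated by the classes of the elements of `J` in
`F(J)₁ = J / 𝔪 J`. -/
noncomputable def initialIdeal (J : Ideal A) : Ideal (FiberCone J) :=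
  Ideal.span (fiberPiece J 1 : Set (FiberCone J))

/-- The component of degree `n` of `F(J) / J F(J)`. -/
noncomputable def residuePiece (J : Ideal A) (n : ℕ) :
    Submodule A (FiberCone J ⧸ initialIdeal J) :=
  (fiberPiece J n).map (Ideal.Quotient.mkₐ A (initialIdeal J)).toLinearMap

/-- The grading of the shifted module `M(-d)`: `M(-d)ₙ = Mₙ₋d`, which is zero for `n < d`. -/
def shiftPiece {M : Type*} [AddCommGroup M] [Module A M] (𝒢 : ℕ → Submodule A M) (d n : ℕ) :
    Submodule A M :=
  if d ≤ n then 𝒢 (n - d) else ⊥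

/-- There is an isomorphism of graded `F(J)`-modules
`F(I) ≅ F(J) ⊕ F(J)(-1) ^ p ⊕ F(J)(-2) ^ q ⊕ (F(J) / J F(J))(-1) ^ s`,
where `F(J)` acts on `F(I)` through `F(J) → F(I)`: an additive bijection `e` that respects the
action of `F(J)` and maps the component of degree `n` onto the component of degree `n`. -/
def HasFiberDecomposition {J I : Ideal A} (h : J ≤ I) (p q s : ℕ) : Prop :=
  ∃ e : FiberCone I ≃ₗ[A] FiberCone J × (Fin p → FiberCone J) × (Fin q → FiberCone J) ×
      (Fin s → FiberCone J ⧸ initialIdeal J),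
    (∀ (c : FiberCone J) (x : FiberCone I), e (fiberMap h c * x) = c • e x) ∧
    ∀ n : ℕ, (fiberPiece I n).map e.toLinearMap =
      (fiberPiece J n).prod
        ((Submodule.pi Set.univ fun _ : Fin p => shiftPiece (fiberPiece J) 1 n).prod
          ((Submodule.pi Set.univ fun _ : Fin q => shiftPiece (fiberPiece J) 2 n).prod
            (Submodule.pi Set.univ fun _ : Fin s => shiftPiece (residuePiece J) 1 n)))

end FiberCone

section InjectiveDimension

universe u

open CategoryTheory Abelian
open scoped Pointwise

variable {R : Type u} [CommRing R]

/-- A version of Baer's criterion for injective dimension. -/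
theorem hasInjectiveDimensionLE_of_ext_quotient (n : ℕ) (X : ModuleCat.{u} R)
    (h : ∀ (I : Ideal R) (x : Ext (ModuleCat.of R (R ⧸ I)) X (n + 1)), x = 0) :
    HasInjectiveDimensionLE X n := by
  induction n generalizing X with
  | zero =>
    simp only [HasInjectiveDimensionLE, zero_add, ← injective_iff_hasInjectiveDimensionLT_one]
    change CategoryTheory.Injective (ModuleCat.of R X)
    rw [← Module.injective_iff_injective_object]
    refine Module.Baer.injective fun I f ↦ ?_
    have hS := LinearMap.shortExact_shortComplexKer (Submodule.mkQ_surjective I)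
    let f' : LinearMap.ker I.mkQ →ₗ[R] X := f ∘ₗ (LinearEquiv.ofEq _ _ I.ker_mkQ).toLinearMap
    obtain ⟨x, hx⟩ := Ext.contravariant_sequence_exact₁ hS X
      (Ext.mk₀ (ModuleCat.ofHom f')) (n₁ := 1) rfl (h I _)
    obtain ⟨g, rfl⟩ := (Ext.mk₀_bijective _ _).2 x
    rw [Ext.mk₀_comp_mk₀] at hx
    have hg := (Ext.mk₀_bijective _ _).1 hx
    refine ⟨g.hom, fun y hy ↦ ?_⟩
    have := congrArg (fun φ ↦ φ.hom (⟨y, by simpa using hy⟩ : LinearMap.ker I.mkQ)) hg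
    exact this
  | succ n ih =>
    obtain ⟨E, _, f, _⟩ := EnoughInjectives.presentation X
    let S := ShortComplex.mk f (Limits.cokernel.π f) (Limits.cokernel.condition f)
    have hS : S.ShortExact := { exact := ShortComplex.exact_cokernel f }
    refine (hS.hasInjectiveDimensionLT_X₃_iff n inferInstance).mp (ih _ fun I x ↦ ?_)
    obtain ⟨y, rfl⟩ := Ext.covariant_sequence_exact₃ _ hS x rfl (h I _)
    rw [Ext.eq_zero_of_injective y, Ext.zero_comp]

theorem ext_eq_zero_of_residue [IsLocalRing R] [IsNoetherianRing R] (N : ModuleCat.{u} R)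
    [Module.Finite R N] (n : ℕ) [HasInjectiveDimensionLE N n]
    (hk : ∀ x : Ext (ModuleCat.of R (R ⧸ maximalIdeal R)) N n, x = 0)
    (M : Type u) [AddCommGroup M] [Module R M] [hM : Module.Finite R M]
    (x : Ext (ModuleCat.of R M) N n) : x = 0 := by
  induction hM using IsNoetherianRing.induction_on_isQuotientEquivQuotientPrime R with
  | subsingleton M =>
    have : Limits.IsZero (ModuleCat.of R M) := ModuleCat.isZero_of_subsingleton _
    rw [← Ext.mk₀_id_comp x, this.eq_of_src (𝟙 _) 0, Ext.mk₀_zero, Ext.zero_comp]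
  | quotient M p e =>
    suffices H : ∀ y : Ext (ModuleCat.of R (R ⧸ p.1)) N n, y = 0 by
      have := H ((Ext.mk₀ e.toModuleIso.inv).comp x (zero_add n))
      rw [← Ext.mk₀_id_comp x, ← e.toModuleIso.hom_inv_id, ← Ext.mk₀_comp_mk₀_assoc, this,
        Ext.comp_zero]
    by_cases hp : p.1 = maximalIdeal R
    · rw [hp]; exact hk
    obtain ⟨t, htm, htp⟩ : ∃ t ∈ maximalIdeal R, t ∉ p.1 := by
      by_contra! hcon
      exact hp (le_antisymm (le_maximalIdeal p.2.ne_top) hcon)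
    have hreg : IsSMulRegular (R ⧸ p.1) t := by
      intro a b hab
      obtain ⟨a, rfl⟩ := Ideal.Quotient.mk_surjective a
      obtain ⟨b, rfl⟩ := Ideal.Quotient.mk_surjective b
      replace hab : t • Ideal.Quotient.mk p.1 a = t • Ideal.Quotient.mk p.1 b := hab
      rw [Algebra.smul_def, Algebra.smul_def] at hab
      have : IsDomain (R ⧸ p.1) := inferInstance
      refine mul_left_cancel₀ ?_ hab
      simpa [Ideal.Quotient.eq_zero_iff_mem] using htp
    have hS := IsSMulRegular.smulShortComplex_shortExact
      (M := ModuleCat.of R (R ⧸ p.1)) hreg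
    have hsurj : ∀ y : Ext (ModuleCat.of R (R ⧸ p.1)) N n, ∃ z, t • z = y := by
      intro y
      obtain ⟨z, hz⟩ := Ext.contravariant_sequence_exact₁ hS N y (add_comm 1 n)
        (Ext.eq_zero_of_hasInjectiveDimensionLT _ (n + 1) le_rfl)
      have key (z : Ext (ModuleCat.of R (R ⧸ p.1)) N n) :
          (Ext.mk₀ (t • 𝟙 (ModuleCat.of R (R ⧸ p.1)))).comp z (zero_add n) = t • z := by
        rw [Ext.mk₀_smul, Ext.smul_comp, Ext.mk₀_id_comp]
      exact ⟨z, (key z).symm.trans hz⟩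
    have htop : (⊤ : Submodule R (Ext (ModuleCat.of R (R ⧸ p.1)) N n)) = ⊥ := by
      refine Submodule.eq_bot_of_le_smul_of_le_jacobson_bot (maximalIdeal R) _
        Module.Finite.fg_top (fun y _ ↦ ?_) (maximalIdeal_le_jacobson ⊥)
      obtain ⟨z, rfl⟩ := hsurj y
      exact Submodule.smul_mem_smul htm trivial
    intro y
    exact (Submodule.mem_bot R).mp (htop ▸ (trivial : y ∈ (⊤ : Submodule R _)))
  | exact M₁ M₂ M₃ f g hf hg hfg h₁ h₃ =>
    have hS := ModuleCat.shortComplex_shortExact (ModuleCat.shortComplexOfCompEqZero f g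
      hfg.linearMap_comp_eq_zero) hfg hf hg
    obtain ⟨y, rfl⟩ := Ext.contravariant_sequence_exact₂ hS N x (h₁ _)
    rw [h₃ y, Ext.comp_zero]

theorem HasInjectiveDimensionLE.pred_of_socle [IsLocalRing R] [IsNoetherianRing R]
    (N : ModuleCat.{u} R) [Module.Finite R N] (n : ℕ) [HasInjectiveDimensionLE N (n + 1)]
    {M : Type u} [AddCommGroup M] [Module R M]
    (hM : ∀ x : Ext (ModuleCat.of R M) N (n + 1), x = 0) {w : M} (hw : w ≠ 0)
    (hmw : ∀ z ∈ maximalIdeal R, z • w = 0) : HasInjectiveDimensionLE N n := by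
  refine hasInjectiveDimensionLE_of_ext_quotient n N fun I x ↦
    ext_eq_zero_of_residue N (n + 1) (fun y ↦ ?_) _ x
  let f : R ⧸ maximalIdeal R →ₗ[R] M :=
    Submodule.liftQ (maximalIdeal R) (LinearMap.toSpanSingleton R M w) fun z hz ↦ by
      simpa using hmw z hz
  have hf : Function.Injective f := by
    rw [injective_iff_map_eq_zero]
    intro a ha
    obtain ⟨a, rfl⟩ := Submodule.mkQ_surjective _ a
    by_contra hne
    have hu : IsUnit a := by
      by_contra hu
      exact hne ((Submodule.Quotient.mk_eq_zero _).mpr hu)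
    have : a • w = 0 := ha
    exact hw (hu.smul_eq_zero.mp this)
  have hS := ModuleCat.shortComplex_shortExact (ModuleCat.shortComplexOfCompEqZero f
    (LinearMap.range f).mkQ f.exact_map_mkQ_range.linearMap_comp_eq_zero)
    f.exact_map_mkQ_range hf (Submodule.mkQ_surjective _)
  obtain ⟨z, rfl⟩ := Ext.contravariant_sequence_exact₁ hS N y (add_comm 1 (n + 1))
    (Ext.eq_zero_of_hasInjectiveDimensionLT _ (n + 1 + 1) le_rfl)
  rw [hM z, Ext.comp_zero]

/-- A Noetherian local ring of depth zero and finite injective dimension is self-injective. -/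
theorem injective_self_of_hasInjectiveDimensionLE [IsLocalRing R] [IsNoetherianRing R] {n : ℕ}
    (hn : HasInjectiveDimensionLE (ModuleCat.of R R) n) {w : R} (hw : w ≠ 0)
    (hmw : ∀ z ∈ maximalIdeal R, z * w = 0) : Module.Injective R R := by
  induction n with
  | zero =>
    simp only [HasInjectiveDimensionLE, zero_add, ← injective_iff_hasInjectiveDimensionLT_one]
      at hn
    exact (Module.injective_iff_injective_object R R).mpr hn
  | succ n ih =>
    exact ih (HasInjectiveDimensionLE.pred_of_socle _ n (fun x ↦ Ext.eq_zero_of_projective x)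
      hw hmw)

theorem isNilpotent_of_injective_self [IsLocalRing R] [IsNoetherianRing R]
    (hR : Module.Injective R R) {t : R} (ht : t ∈ maximalIdeal R) : IsNilpotent t := by
  obtain ⟨n, hn⟩ := monotone_stabilizes_iff_noetherian.mpr (inferInstance : IsNoetherianRing R)
    ⟨fun n ↦ LinearMap.ker (LinearMap.toSpanSingleton R R (t ^ n)), fun i j hij x hx ↦ by
      obtain ⟨d, rfl⟩ := Nat.exists_eq_add_of_le hij
      simp only [LinearMap.mem_ker, LinearMap.toSpanSingleton_apply, smul_eq_mul] at hx ⊢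
      rw [pow_add, ← mul_assoc, hx, zero_mul]⟩
  have hker : LinearMap.ker (LinearMap.toSpanSingleton R R (t ^ (n + 1))) ≤
      LinearMap.ker (LinearMap.toSpanSingleton R R (t ^ n)) := (hn (n + 1) (by simp)).ge
  let f : LinearMap.range (LinearMap.toSpanSingleton R R (t ^ (n + 1))) →ₗ[R] R :=
    (Submodule.liftQ _ (LinearMap.toSpanSingleton R R (t ^ n)) hker) ∘ₗ
      (LinearMap.quotKerEquivRange _).symm.toLinearMap
  obtain ⟨g, hg⟩ := Module.Baer.of_injective hR _ f
  have h1 : t ^ (n + 1) ∈ LinearMap.range (LinearMap.toSpanSingleton R R (t ^ (n + 1))) :=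
    ⟨1, by simp⟩
  have h2 : g (t ^ (n + 1)) = t ^ n := by
    rw [hg _ h1]
    have : (⟨t ^ (n + 1), h1⟩ : LinearMap.range (LinearMap.toSpanSingleton R R (t ^ (n + 1)))) =
        LinearMap.quotKerEquivRange (LinearMap.toSpanSingleton R R (t ^ (n + 1)))
          (Submodule.Quotient.mk 1) := by
      ext
      exact (one_mul _).symm
    simp only [f, LinearMap.comp_apply, LinearEquiv.coe_coe]
    rw [this, LinearEquiv.symm_apply_apply]
    erw [Submodule.liftQ_apply]
    simp
  have h3 : g (t ^ (n + 1)) = t ^ (n + 1) * g 1 := by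
    rw [← smul_eq_mul, ← map_smul, smul_eq_mul, mul_one]
  refine ⟨n, ?_⟩
  have hu : IsUnit (1 - t * g 1) := by
    by_contra hu
    have h4 : (1 - t * g 1) ∈ maximalIdeal R := hu
    have := (maximalIdeal R).add_mem h4 (Ideal.mul_mem_right (g 1) _ ht)
    rw [sub_add_cancel] at this
    exact (Ideal.ne_top_iff_one _).mp (maximalIdeal.isMaximal R).ne_top this
  have h5 : t ^ n * (1 - t * g 1) = 0 := by
    linear_combination h3 - h2
  exact (hu.mul_left_eq_zero).mp h5

theorem hasInjectiveDimensionLE_one_of_isSMulRegular [IsLocalRing R] [IsNoetherianRing R] {n : ℕ}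
    (hn : HasInjectiveDimensionLE (ModuleCat.of R R) n) {t : R} (ht : IsSMulRegular R t)
    {w : R} (hw : w ∉ t • (⊤ : Submodule R R))
    (hmw : ∀ z ∈ maximalIdeal R, z * w ∈ t • (⊤ : Submodule R R)) :
    HasInjectiveDimensionLE (ModuleCat.of R R) 1 := by
  induction n with
  | zero => exact hasInjectiveDimensionLT_of_ge _ 1 2 (by norm_num)
  | succ n ih =>
    rcases n with _ | n
    · exact hn
    refine ih (HasInjectiveDimensionLE.pred_of_socle _ (n + 1)
      (M := R ⧸ t • (⊤ : Submodule R R)) (fun x ↦ ?_)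
      (w := Submodule.Quotient.mk w) (fun h ↦ hw ((Submodule.Quotient.mk_eq_zero _).mp h))
      fun z hz ↦ (Submodule.Quotient.mk_eq_zero _).mpr (hmw z hz))
    have : Projective ((ModuleCat.of R R).smulShortComplex t).X₁ :=
      inferInstanceAs (Projective (ModuleCat.of R R))
    have : Projective ((ModuleCat.of R R).smulShortComplex t).X₂ :=
      inferInstanceAs (Projective (ModuleCat.of R R))
    obtain ⟨y, rfl⟩ := Ext.contravariant_sequence_exact₃ (IsSMulRegular.smulShortComplex_shortExact
      (M := ModuleCat.of R R) ht) (ModuleCat.of R R) x (Ext.eq_zero_of_projective _)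
      (add_comm 1 (n + 1))
    rw [(Ext.eq_zero_of_projective y : y = 0)]
    exact Ext.comp_zero ..

/-- Modulo a regular element, the socle of a Noetherian local ring of injective dimension at most
one is principal. -/
theorem exists_sub_mul_mem_of_hasInjectiveDimensionLE_one [IsLocalRing R]
    (hn : HasInjectiveDimensionLE (ModuleCat.of R R) 1) {t : R} (ht : IsSMulRegular R t)
    (htm : t ∈ maximalIdeal R) {w y : R} (hw : w ∉ t • (⊤ : Submodule R R))
    (hmw : ∀ z ∈ maximalIdeal R, z * w ∈ t • (⊤ : Submodule R R))
    (hmy : ∀ z ∈ maximalIdeal R, z * y ∈ t • (⊤ : Submodule R R)) :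
    ∃ c : R, y - c * w ∈ t • (⊤ : Submodule R R) := by
  let φ (v : R) (hv : ∀ z ∈ maximalIdeal R, z * v ∈ t • (⊤ : Submodule R R)) :
      R ⧸ maximalIdeal R →ₗ[R] R ⧸ t • (⊤ : Submodule R R) :=
    Submodule.liftQ (maximalIdeal R)
      (LinearMap.toSpanSingleton R _ (Submodule.Quotient.mk v)) fun z hz ↦ by
        rw [LinearMap.mem_ker, LinearMap.toSpanSingleton_apply]
        exact (Submodule.Quotient.mk_eq_zero _).mpr (hv z hz)
  have hφ (v : R) hv (a : R) : φ v hv (Submodule.Quotient.mk a) = Submodule.Quotient.mk (a * v) :=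
    rfl
  have hinj : Function.Injective (φ w hmw) := by
    rw [injective_iff_map_eq_zero]
    intro a ha
    obtain ⟨a, rfl⟩ := Submodule.mkQ_surjective _ a
    by_contra hne
    have hu : IsUnit a := by
      by_contra hu
      exact hne ((Submodule.Quotient.mk_eq_zero _).mpr hu)
    have h1 : a * w ∈ t • (⊤ : Submodule R R) :=
      (Submodule.Quotient.mk_eq_zero _).mp ((hφ w hmw a).symm.trans ha)
    have h2 := Submodule.smul_mem _ (↑hu.unit⁻¹ : R) h1
    rw [smul_eq_mul, ← mul_assoc, IsUnit.val_inv_mul, one_mul] at h2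
    exact hw h2
  have hT := IsSMulRegular.smulShortComplex_shortExact (M := ModuleCat.of R R) ht
  have hS := ModuleCat.shortComplex_shortExact (ModuleCat.shortComplexOfCompEqZero (φ w hmw)
    (LinearMap.range (φ w hmw)).mkQ (φ w hmw).exact_map_mkQ_range.linearMap_comp_eq_zero)
    (φ w hmw).exact_map_mkQ_range hinj (Submodule.mkQ_surjective _)
  obtain ⟨η, hη⟩ := Ext.contravariant_sequence_exact₁ hS (ModuleCat.of R R)
    ((Ext.mk₀ (ModuleCat.ofHom (φ y hmy))).comp hT.extClass (zero_add 1)) (n₁ := 2) rfl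
    (Ext.eq_zero_of_hasInjectiveDimensionLT _ 2 le_rfl)
  have hη0 : η.comp (Ext.mk₀ ((ModuleCat.of R R).smulShortComplex t).f) (add_zero 1) = 0 := by
    change η.comp (Ext.mk₀ (t • 𝟙 (ModuleCat.of R R))) (add_zero 1) = 0
    rw [Ext.mk₀_smul, Ext.comp_smul, Ext.comp_mk₀_id, ← Ext.mk₀_id_comp η, ← Ext.smul_comp,
      ← Ext.mk₀_smul]
    have : t • 𝟙 (ModuleCat.of R (R ⧸ t • (⊤ : Submodule R R))) = 0 := by
      refine ModuleCat.hom_ext (LinearMap.ext fun a ↦ ?_)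
      obtain ⟨a, rfl⟩ := Submodule.mkQ_surjective _ a
      exact (Submodule.Quotient.mk_eq_zero _).mpr (Submodule.smul_mem_pointwise_smul _ _ _ trivial)
    erw [this]
    rw [Ext.mk₀_zero, Ext.zero_comp]
  obtain ⟨ψ, hψ⟩ : ∃ ψ : ModuleCat.of R (R ⧸ t • (⊤ : Submodule R R)) ⟶
      ModuleCat.of R (R ⧸ t • (⊤ : Submodule R R)),
      (Ext.mk₀ ψ).comp hT.extClass (zero_add 1) = η := by
    obtain ⟨ψ, hψ⟩ := Ext.covariant_sequence_exact₁ _ hT η hη0 (zero_add 1)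
    obtain ⟨ψ, rfl⟩ := (Ext.mk₀_bijective _ _).2 ψ
    exact ⟨ψ, hψ⟩
  let δ : ModuleCat.of R (R ⧸ maximalIdeal R) ⟶ ModuleCat.of R (R ⧸ t • (⊤ : Submodule R R)) :=
    ModuleCat.ofHom (φ y hmy) - ModuleCat.ofHom (φ w hmw) ≫ ψ
  have hδ : (Ext.mk₀ δ).comp hT.extClass (zero_add 1) = 0 := by
    have h1 : Ext.mk₀ δ = Ext.mk₀ (ModuleCat.ofHom (φ y hmy)) -
        Ext.mk₀ (ModuleCat.ofHom (φ w hmw) ≫ ψ) := map_sub Ext.addEquiv₀.symm _ _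
    let ε : Ext (ModuleCat.of R (R ⧸ t • (⊤ : Submodule R R))) (ModuleCat.of R R) 1 := hT.extClass
    have h2 : (Ext.mk₀ (ModuleCat.ofHom (φ w hmw) ≫ ψ)).comp ε (zero_add 1) =
        (Ext.mk₀ (ModuleCat.ofHom (φ y hmy))).comp ε (zero_add 1) := by
      rw [← Ext.mk₀_comp_mk₀_assoc]
      exact (congrArg (fun x ↦ (Ext.mk₀ (ModuleCat.ofHom (φ w hmw))).comp x (zero_add 1)) hψ).trans
        hη
    change (Ext.mk₀ δ).comp ε (zero_add 1) = 0
    rw [h1, sub_eq_add_neg, Ext.add_comp, Ext.neg_comp, h2, add_neg_cancel]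
  obtain ⟨g, hg⟩ := Ext.covariant_sequence_exact₃ _ hT (Ext.mk₀ δ) (zero_add 1) hδ
  obtain ⟨g, rfl⟩ := (Ext.mk₀_bijective _ _).2 g
  have hg0 : g = 0 := by
    refine ModuleCat.hom_ext (LinearMap.ext fun a ↦ ?_)
    apply ht
    change t • g.hom a = t • (0 : R)
    obtain ⟨a, rfl⟩ := Submodule.mkQ_surjective _ a
    rw [smul_zero, ← map_smul]
    have : t • (maximalIdeal R).mkQ a = 0 :=
      (Submodule.Quotient.mk_eq_zero _).mpr (Ideal.mul_mem_right a _ htm)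
    erw [this]
    exact map_zero _
  rw [hg0, Ext.mk₀_zero, Ext.zero_comp] at hg
  have hδ0 : δ = 0 := (Ext.mk₀_bijective _ _).1 (hg.symm.trans (Ext.mk₀_zero _ _).symm)
  have hfin : (Submodule.Quotient.mk (1 * y) : R ⧸ t • (⊤ : Submodule R R)) =
      ψ.hom (Submodule.Quotient.mk (1 * w)) := by
    have h1 : ModuleCat.ofHom (φ y hmy) = ModuleCat.ofHom (φ w hmw) ≫ ψ := sub_eq_zero.mp hδ0
    exact congrArg (fun f ↦ f.hom (Submodule.Quotient.mk 1 : R ⧸ maximalIdeal R)) h1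
  obtain ⟨c, hc⟩ := Submodule.mkQ_surjective (t • (⊤ : Submodule R R))
    (ψ.hom (Submodule.Quotient.mk 1 : R ⧸ t • (⊤ : Submodule R R)))
  refine ⟨c, ?_⟩
  rw [one_mul, one_mul] at hfin
  have h1 : ψ.hom (Submodule.Quotient.mk w : R ⧸ t • (⊤ : Submodule R R)) =
      w • ψ.hom (Submodule.Quotient.mk 1 : R ⧸ t • (⊤ : Submodule R R)) := by
    rw [← map_smul, ← Submodule.Quotient.mk_smul, smul_eq_mul, mul_one]
  rw [h1, ← hc] at hfin
  rw [mul_comm c w]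
  exact (Submodule.Quotient.eq _).mp hfin

end InjectiveDimension

section Coinduced

universe u

/-- A divisible module over a principal ideal domain is injective. -/
theorem Module.injective_of_divisible {S : Type u} [CommRing S] [IsDomain S]
    [IsPrincipalIdealRing S] (N : Type u) [AddCommGroup N] [Module S N]
    (h : ∀ s : S, s ≠ 0 → ∀ n : N, ∃ m : N, s • m = n) : Module.Injective S N := by
  refine Module.Baer.injective fun I f ↦ ?_
  obtain ⟨g, rfl⟩ := (IsPrincipalIdealRing.principal I).principal
  have hgI : g ∈ Submodule.span S {g} := Submodule.mem_span_singleton_self g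
  by_cases hg : g = 0
  · refine ⟨0, fun x hx ↦ ?_⟩
    have hx0 : x = 0 := by simpa [hg] using hx
    subst hx0
    exact (map_zero f).symm
  obtain ⟨m, hm⟩ := h g hg (f ⟨g, hgI⟩)
  refine ⟨LinearMap.toSpanSingleton S N m, fun x hx ↦ ?_⟩
  obtain ⟨c, rfl⟩ := Submodule.mem_span_singleton.mp hx
  rw [LinearMap.toSpanSingleton_apply, smul_assoc, hm, ← map_smul]
  rfl

/-- The coinduced module `Hom_S(F, N)` of an `S`-algebra `F`. -/
def Coinduced (S F N : Type*) [CommRing S] [CommRing F] [Algebra S F] [AddCommGroup N]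
    [Module S N] : Type _ := F →ₗ[S] N

namespace Coinduced

variable {S F N N' : Type*} [CommRing S] [CommRing F] [Algebra S F] [AddCommGroup N]
  [Module S N] [AddCommGroup N'] [Module S N']

instance : AddCommGroup (Coinduced S F N) := inferInstanceAs (AddCommGroup (F →ₗ[S] N))

instance : FunLike (Coinduced S F N) F N := inferInstanceAs (FunLike (F →ₗ[S] N) F N)

@[ext]
theorem ext {f g : Coinduced S F N} (h : ∀ x, f x = g x) : f = g := LinearMap.ext h

instance : SMul F (Coinduced S F N) :=
  ⟨fun x f ↦ LinearMap.comp (f : F →ₗ[S] N) (LinearMap.mulLeft S x)⟩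

@[simp] theorem smul_apply (x y : F) (f : Coinduced S F N) : (x • f) y = f (x * y) := rfl

@[simp] theorem add_apply (y : F) (f g : Coinduced S F N) : (f + g) y = f y + g y := rfl

@[simp] theorem zero_apply (y : F) : (0 : Coinduced S F N) y = 0 := rfl

@[simp] theorem map_add' (x y : F) (f : Coinduced S F N) : f (x + y) = f x + f y :=
  LinearMap.map_add (f : F →ₗ[S] N) x y

@[simp] theorem map_zero' (f : Coinduced S F N) : f 0 = 0 :=
  LinearMap.map_zero (f : F →ₗ[S] N)

instance : Module F (Coinduced S F N) where
  one_smul f := ext fun x ↦ by simp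
  mul_smul x y f := ext fun z ↦ by simp [mul_left_comm, mul_assoc]
  smul_zero x := ext fun z ↦ by simp
  smul_add x f g := ext fun z ↦ by simp
  add_smul x y f := ext fun z ↦ by simp [add_mul]
  zero_smul f := ext fun z ↦ by simp

/-- Functoriality of the coinduced module. -/
def map (g : N →ₗ[S] N') : Coinduced S F N →ₗ[F] Coinduced S F N' where
  toFun f := g ∘ₗ (f : F →ₗ[S] N)
  map_add' _ _ := LinearMap.ext fun _ ↦ LinearMap.map_add g _ _
  map_smul' _ _ := rfl

theorem map_injective {g : N →ₗ[S] N'} (hg : Function.Injective g) :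
    Function.Injective (map (F := F) g) :=
  fun _ _ h ↦ ext fun x ↦ hg (DFunLike.congr_fun h x)

theorem map_surjective [Module.Projective S F] {g : N →ₗ[S] N'} (hg : Function.Surjective g) :
    Function.Surjective (map (F := F) g) :=
  fun f ↦ Module.projective_lifting_property g (f : F →ₗ[S] N') hg

theorem map_exact {N'' : Type*} [AddCommGroup N''] [Module S N''] {g : N →ₗ[S] N'}
    {g' : N' →ₗ[S] N''} (hg : Function.Injective g) (h : Function.Exact g g') :
    Function.Exact (map (F := F) g) (map (F := F) g') := by
  intro f
  constructor
  · intro hf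
    have hr : ∀ x, (f : F →ₗ[S] N') x ∈ LinearMap.range g := fun x ↦
      (h _).mp (DFunLike.congr_fun hf x)
    refine ⟨(LinearEquiv.ofInjective g hg).symm.toLinearMap ∘ₗ
      LinearMap.codRestrict (LinearMap.range g) (f : F →ₗ[S] N') hr, ext fun x ↦ ?_⟩
    exact congrArg Subtype.val ((LinearEquiv.ofInjective g hg).apply_symm_apply
      (LinearMap.codRestrict (LinearMap.range g) (f : F →ₗ[S] N') hr x))
  · rintro ⟨f', rfl⟩
    exact ext fun x ↦ (h _).mpr ⟨_, rfl⟩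

end Coinduced

theorem Coinduced.injective {S F N : Type u} [CommRing S] [CommRing F] [Algebra S F]
    [AddCommGroup N] [Module S N] [hN : Module.Injective S N] :
    Module.Injective F (Coinduced S F N) := by
  refine Module.Baer.injective fun I f ↦ ?_
  let f₁ : I.restrictScalars S →ₗ[S] N :=
    { toFun x := f x 1
      map_add' x y := by
        rw [show f (x + y) = f x + f y from map_add f (x : I) (y : I)]; rfl
      map_smul' s x := by
        have h1 : f (s • x) = algebraMap S F s • f x := by
          refine Eq.trans ?_ (map_smul f (algebraMap S F s) x)
          exact congrArg f (Subtype.ext (Algebra.smul_def s (x : F)))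
        rw [h1, Coinduced.smul_apply, ← Algebra.smul_def]
        exact LinearMap.map_smul (f x : F →ₗ[S] N) s 1 }
  obtain ⟨h, hh⟩ := hN.out (I.restrictScalars S).subtype (Submodule.subtype_injective _) f₁
  refine ⟨LinearMap.toSpanSingleton F (Coinduced S F N) h, fun x hx ↦ Coinduced.ext fun y ↦ ?_⟩
  have h1 : h (x * y) = f ⟨x * y, I.mul_mem_right y hx⟩ 1 :=
    hh ⟨x * y, I.mul_mem_right y hx⟩
  have h2 : (⟨x * y, I.mul_mem_right y hx⟩ : I) = y • ⟨x, hx⟩ := Subtype.ext (mul_comm x y)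
  change h (x * y) = _
  rw [h1, h2, map_smul, Coinduced.smul_apply, mul_one]

open CategoryTheory in
/-- A finite projective algebra over a principal ideal domain that is isomorphic to its dual has
injective dimension at most one. -/
theorem hasInjectiveDimensionLE_one_of_bijective_trace {S F : Type u} [CommRing S] [IsDomain S]
    [IsPrincipalIdealRing S] [CommRing F] [Algebra S F] [Module.Projective S F]
    (θ : F →ₗ[S] S)
    (hθ : Function.Bijective fun x : F ↦ θ ∘ₗ LinearMap.mulLeft S x) :
    HasInjectiveDimensionLE (ModuleCat.of F F) 1 := by
  let Q := FractionRing S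
  let g : S →ₗ[S] Q := Algebra.linearMap S Q
  have hg : Function.Injective g := IsFractionRing.injective S Q
  have hdivQ : ∀ s : S, s ≠ 0 → ∀ n : Q, ∃ m : Q, s • m = n := fun s hs n ↦ by
    have hs' : algebraMap S Q s ≠ 0 := by simpa using hs
    exact ⟨n / algebraMap S Q s, by rw [Algebra.smul_def, mul_div_cancel₀ _ hs']⟩
  have : Module.Injective S Q := Module.injective_of_divisible Q hdivQ
  have : Module.Injective S (Q ⧸ LinearMap.range g) :=
    Module.injective_of_divisible _ fun s hs n ↦ by
      obtain ⟨n, rfl⟩ := Submodule.mkQ_surjective _ n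
      obtain ⟨m, rfl⟩ := hdivQ s hs n
      exact ⟨Submodule.mkQ _ m, (map_smul _ _ _).symm⟩
  have hexact := Coinduced.map_exact (F := F) hg g.exact_map_mkQ_range
  have hS := ModuleCat.shortComplex_shortExact (ModuleCat.shortComplexOfCompEqZero _ _
    hexact.linearMap_comp_eq_zero) hexact (Coinduced.map_injective hg)
    (Coinduced.map_surjective (Submodule.mkQ_surjective _))
  have h2 : Injective (ModuleCat.of F (Coinduced S F Q)) :=
    (Module.injective_iff_injective_object F _).mp Coinduced.injective
  have h3 : Injective (ModuleCat.of F (Coinduced S F (Q ⧸ LinearMap.range g))) :=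
    (Module.injective_iff_injective_object F _).mp Coinduced.injective
  have h1 : HasInjectiveDimensionLE (ModuleCat.of F (Coinduced S F S)) 1 :=
    (hS.hasInjectiveDimensionLT_X₃_iff 0 h2).mp
      (injective_iff_hasInjectiveDimensionLT_one.mp h3)
  let e : F ≃ₗ[F] Coinduced S F S := LinearEquiv.ofBijective
    (LinearMap.toSpanSingleton F (Coinduced S F S) θ) hθ
  exact (ModuleCat.hasInjectiveDimensionLE_iff_of_linearEquiv
    (M := ModuleCat.of F F) (N := ModuleCat.of F (Coinduced S F S)) e 1).mpr h1

open CategoryTheory in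
/-- Finite injective dimension over itself passes to the localizations of a Noetherian ring. -/
theorem isGorenstein_of_hasInjectiveDimensionLE {F : Type u} [CommRing F] [IsNoetherianRing F]
    (n : ℕ) [HasInjectiveDimensionLE (ModuleCat.of F F) n] : IsGorenstein F := by
  refine ⟨inferInstance, fun P _ ↦
    ⟨IsLocalization.isNoetherianRing P.primeCompl _ inferInstance, n, ?_⟩⟩
  have h1 := ModuleCat.localizedModule_hasInjectiveDimensionLE n P.primeCompl (ModuleCat.of F F)
  let f : (ModuleCat.of F F : Type u) →ₗ[F] Localization P.primeCompl :=
    Algebra.linearMap F (Localization P.primeCompl)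
  have hf : IsLocalizedModule P.primeCompl f :=
    inferInstanceAs (IsLocalizedModule P.primeCompl
      (Algebra.linearMap F (Localization P.primeCompl)))
  let e : (ModuleCat.of F F).localizedModule P.primeCompl ≃ₗ[Localization P.primeCompl]
      Localization P.primeCompl :=
    LinearEquiv.extendScalarsOfIsLocalization P.primeCompl (Localization P.primeCompl)
      (@IsLocalizedModule.linearEquiv _ _ P.primeCompl _ _ _ _ _ _ _ _ _
        ((ModuleCat.of F F).localizedModuleMkLinearMap P.primeCompl) f
        (ModuleCat.localizedModule_isLocalizedModule _ _) hf)
  exact (ModuleCat.hasInjectiveDimensionLE_iff_of_linearEquiv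
    (N := ModuleCat.of (Localization P.primeCompl) (Localization P.primeCompl)) e n).mp h1

end Coinduced

section Frame

open Polynomial

theorem Module.Basis.eq_zero_of_sum_coe {ι k U : Type*} [Fintype ι] [Field k] [AddCommGroup U]
    [Module k U] {N : Submodule k U} (b : Module.Basis ι k N) (u : ι → k)
    (h : ∑ i, u i • (b i : U) = 0) : u = 0 := by
  have h1 : ∑ i, u i • b i = 0 := Subtype.ext (by simpa using h)
  exact funext (Fintype.linearIndependent_iff.mp b.linearIndependent u h1)

theorem Module.Basis.exists_eq_sum_coe {ι k U : Type*} [Fintype ι] [Field k] [AddCommGroup U]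
    [Module k U] {N : Submodule k U} (b : Module.Basis ι k N) {x : U} (hx : x ∈ N) :
    ∃ u : ι → k, x = ∑ i, u i • (b i : U) := by
  refine ⟨b.repr ⟨x, hx⟩, ?_⟩
  have := congrArg (N.subtype) (b.sum_repr ⟨x, hx⟩)
  rw [map_sum] at this
  exact this.symm

/-- Adapted bases for a linear map and a vector outside of its kernel. -/
theorem LinearMap.exists_adapted_bases {k V W : Type*} [Field k] [AddCommGroup V] [Module k V]
    [AddCommGroup W] [Module k W] [Module.Finite k V] [Module.Finite k W] (f : V →ₗ[k] W)
    {t : V} (ht : f t ≠ 0) :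
    ∃ (p q : ℕ) (c : Fin p → V) (w : Fin (Module.finrank k (LinearMap.ker f)) → V)
      (d : Fin q → W),
      1 + p + Module.finrank k (LinearMap.ker f) = Module.finrank k V ∧
      1 + p + q = Module.finrank k W ∧ (∀ l, f (w l) = 0) ∧
      (∀ v, ∃ (α : k) (u : Fin p → k) (y : Fin (Module.finrank k (LinearMap.ker f)) → k),
        v = α • t + ∑ i, u i • c i + ∑ l, y l • w l) ∧
      (∀ (α : k) (u : Fin p → k) (y : Fin (Module.finrank k (LinearMap.ker f)) → k),
        α • t + ∑ i, u i • c i + ∑ l, y l • w l = 0 → α = 0 ∧ u = 0 ∧ y = 0) ∧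
      (∀ x, ∃ (α : k) (u : Fin p → k) (y : Fin q → k),
        x = α • f t + ∑ i, u i • f (c i) + ∑ j, y j • d j) ∧
      (∀ (α : k) (u : Fin p → k) (y : Fin q → k),
        α • f t + ∑ i, u i • f (c i) + ∑ j, y j • d j = 0 → α = 0 ∧ u = 0 ∧ y = 0) := by
  have ht0 : t ≠ 0 := fun h ↦ ht (by rw [h, map_zero])
  have hdisj : Disjoint (Submodule.span k {t}) (LinearMap.ker f) := by
    rw [Submodule.disjoint_def]
    intro x hx hx'
    obtain ⟨α, rfl⟩ := Submodule.mem_span_singleton.mp hx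
    rw [LinearMap.mem_ker, map_smul, smul_eq_zero] at hx'
    rw [hx'.resolve_right ht, zero_smul]
  obtain ⟨C, hC⟩ := Submodule.exists_isCompl (Submodule.span k {t} ⊔ LinearMap.ker f)
  obtain ⟨D, hD⟩ := Submodule.exists_isCompl (LinearMap.range f)
  let bC := Module.finBasis k C
  let bK := Module.finBasis k (LinearMap.ker f)
  let bD := Module.finBasis k D
  have hspan : ∀ v, ∃ (α : k) (u : Fin (Module.finrank k C) → k)
      (y : Fin (Module.finrank k (LinearMap.ker f)) → k),
      v = α • t + ∑ i, u i • (bC i : V) + ∑ l, y l • (bK l : V) := by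
    intro v
    have hv : v ∈ (Submodule.span k {t} ⊔ LinearMap.ker f) ⊔ C := by
      rw [hC.sup_eq_top]; trivial
    obtain ⟨x, hx, z, hz, rfl⟩ := Submodule.mem_sup.mp hv
    obtain ⟨x', hx', w, hw, rfl⟩ := Submodule.mem_sup.mp hx
    obtain ⟨α, rfl⟩ := Submodule.mem_span_singleton.mp hx'
    obtain ⟨u, rfl⟩ := bC.exists_eq_sum_coe hz
    obtain ⟨y, rfl⟩ := bK.exists_eq_sum_coe hw
    exact ⟨α, u, y, add_right_comm _ _ _⟩
  have hind : ∀ (α : k) (u : Fin (Module.finrank k C) → k)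
      (y : Fin (Module.finrank k (LinearMap.ker f)) → k),
      α • t + ∑ i, u i • (bC i : V) + ∑ l, y l • (bK l : V) = 0 → α = 0 ∧ u = 0 ∧ y = 0 := by
    intro α u y h
    have h1 : ∑ i, u i • (bC i : V) ∈ C := C.sum_mem fun i _ ↦ C.smul_mem _ (bC i).2
    have h2 : ∑ l, y l • (bK l : V) ∈ LinearMap.ker f :=
      Submodule.sum_mem _ fun i _ ↦ Submodule.smul_mem _ _ (bK i).2
    have h3 : α • t ∈ Submodule.span k {t} :=
      Submodule.smul_mem _ _ (Submodule.mem_span_singleton_self t)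
    have h4 : α • t + ∑ l, y l • (bK l : V) = 0 ∧ ∑ i, u i • (bC i : V) = 0 := by
      have h5 : ∑ i, u i • (bC i : V) = 0 := by
        refine (Submodule.disjoint_def.mp hC.disjoint) _ ?_ h1
        have : ∑ i, u i • (bC i : V) = -(α • t + ∑ l, y l • (bK l : V)) := by
          rw [eq_neg_iff_add_eq_zero, ← h, ← add_assoc, add_comm (∑ i, u i • (bC i : V))]
        rw [this]
        exact Submodule.neg_mem _ (Submodule.add_mem_sup h3 h2)
      refine ⟨?_, h5⟩
      rw [h5, add_zero] at h
      exact h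
    have h5 : ∑ l, y l • (bK l : V) = 0 := by
      refine (Submodule.disjoint_def.mp hdisj) _ ?_ h2
      rw [eq_neg_of_add_eq_zero_right h4.1]
      exact Submodule.neg_mem _ h3
    refine ⟨?_, bC.eq_zero_of_sum_coe u h4.2, bK.eq_zero_of_sum_coe y h5⟩
    have h6 := h4.1
    rw [h5, add_zero, smul_eq_zero] at h6
    exact h6.resolve_right ht0
  have hK : ∀ l, f (bK l : V) = 0 := fun l ↦ (bK l).2
  have hfin1 : 1 + Module.finrank k C + Module.finrank k (LinearMap.ker f) =
      Module.finrank k V := by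
    have h1 := Submodule.finrank_add_eq_of_isCompl hC
    have h2 := Submodule.finrank_sup_add_finrank_inf_eq (Submodule.span k {t}) (LinearMap.ker f)
    rw [hdisj.eq_bot, finrank_bot, finrank_span_singleton ht0] at h2
    omega
  refine ⟨Module.finrank k C, Module.finrank k D, fun i ↦ bC i, fun l ↦ bK l, fun j ↦ bD j,
    hfin1, ?_, hK, hspan, hind, ?_, ?_⟩
  · have h1 := Submodule.finrank_add_eq_of_isCompl hD
    have h2 := LinearMap.finrank_range_add_finrank_ker f
    omega
  · intro x
    have hx : x ∈ LinearMap.range f ⊔ D := by rw [hD.sup_eq_top]; trivial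
    obtain ⟨x, ⟨v, rfl⟩, z, hz, rfl⟩ := Submodule.mem_sup.mp hx
    obtain ⟨α, u, y, rfl⟩ := hspan v
    obtain ⟨v, rfl⟩ := bD.exists_eq_sum_coe hz
    exact ⟨α, u, v, by simp [hK]⟩
  · intro α u y h
    have h1 : ∑ j, y j • (bD j : W) ∈ D := D.sum_mem fun i _ ↦ D.smul_mem _ (bD i).2
    have h2 : α • f t + ∑ i, u i • f (bC i) = f (α • t + ∑ i, u i • (bC i : V)) := by simp
    have h3 : ∑ j, y j • (bD j : W) = 0 := by
      refine (Submodule.disjoint_def.mp hD.disjoint) _ ?_ h1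
      rw [eq_neg_of_add_eq_zero_right h, h2]
      exact Submodule.neg_mem _ ⟨_, rfl⟩
    rw [h3, add_zero, h2] at h
    obtain ⟨z, hz⟩ := bK.exists_eq_sum_coe (x := α • t + ∑ i, u i • (bC i : V)) h
    obtain ⟨h5, h6, -⟩ := hind α u (-z) (by rw [hz]; simp)
    exact ⟨h5, h6, bD.eq_zero_of_sum_coe y h3⟩

variable {k F : Type*} [Field k] [CommRing F] [Algebra k F]

/-- A graded `k`-algebra which is a finite module over `k[t]`, `t` of degree one, such that
multiplication by `t` is bijective in degrees at least two. -/
structure IsFiberLike (𝒜 : ℕ → Submodule k F) (t : F) : Prop where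
  mem : t ∈ 𝒜 1
  exists_eq_algebraMap : ∀ x ∈ 𝒜 0, ∃ c : k, x = algebraMap k F c
  pow_ne_zero : ∀ n : ℕ, t ^ n ≠ 0
  exists_eq_mul : ∀ n : ℕ, 2 ≤ n → ∀ x ∈ 𝒜 (n + 1), ∃ y ∈ 𝒜 n, x = t * y
  eq_zero_of_mul : ∀ n : ℕ, 2 ≤ n → ∀ x ∈ 𝒜 n, t * x = 0 → x = 0
  finite_one : Module.Finite k (𝒜 1)
  finite_two : Module.Finite k (𝒜 2)

/-- The elements of degree one that are annihilated by `t`. -/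
def torsionOne (𝒜 : ℕ → Submodule k F) (t : F) : Submodule k F :=
  𝒜 1 ⊓ LinearMap.ker (LinearMap.mulLeft k t)

theorem mem_torsionOne {𝒜 : ℕ → Submodule k F} {t x : F} :
    x ∈ torsionOne 𝒜 t ↔ x ∈ 𝒜 1 ∧ t * x = 0 := Iff.rfl

/-- Adapted bases of the components of degrees one and two. -/
structure FiberFrame (𝒜 : ℕ → Submodule k F) (t : F) (p q s : ℕ) where
  c : Fin p → F
  d : Fin q → F
  w : Fin s → F
  c_mem : ∀ i, c i ∈ 𝒜 1
  d_mem : ∀ j, d j ∈ 𝒜 2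
  w_mem : ∀ l, w l ∈ torsionOne 𝒜 t
  span_one : ∀ x ∈ 𝒜 1, ∃ (α : k) (u : Fin p → k) (y : Fin s → k),
    x = α • t + ∑ i, u i • c i + ∑ l, y l • w l
  indep_one : ∀ (α : k) (u : Fin p → k) (y : Fin s → k),
    α • t + ∑ i, u i • c i + ∑ l, y l • w l = 0 → α = 0 ∧ u = 0 ∧ y = 0
  span_two : ∀ x ∈ 𝒜 2, ∃ (α : k) (u : Fin p → k) (y : Fin q → k),
    x = α • (t * t) + ∑ i, u i • (t * c i) + ∑ j, y j • d j
  indep_two : ∀ (α : k) (u : Fin p → k) (y : Fin q → k),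
    α • (t * t) + ∑ i, u i • (t * c i) + ∑ j, y j • d j = 0 → α = 0 ∧ u = 0 ∧ y = 0

/-- Multiplication by `t`, from the component of degree one to that of degree two. -/
noncomputable def IsFiberLike.mulOne {𝒜 : ℕ → Submodule k F} [GradedAlgebra 𝒜] {t : F}
    (H : IsFiberLike 𝒜 t) : 𝒜 1 →ₗ[k] 𝒜 2 :=
  LinearMap.codRestrict (𝒜 2) (LinearMap.mulLeft k t ∘ₗ (𝒜 1).subtype)
    fun x ↦ SetLike.mul_mem_graded H.mem x.2

theorem IsFiberLike.coe_mulOne {𝒜 : ℕ → Submodule k F} [GradedAlgebra 𝒜] {t : F}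
    (H : IsFiberLike 𝒜 t) (x : 𝒜 1) : (H.mulOne x : F) = t * x := rfl

theorem IsFiberLike.finrank_ker_mulOne {𝒜 : ℕ → Submodule k F} [GradedAlgebra 𝒜] {t : F}
    (H : IsFiberLike 𝒜 t) :
    Module.finrank k (LinearMap.ker H.mulOne) = Module.finrank k (torsionOne 𝒜 t) := by
  have hker : LinearMap.ker H.mulOne = (torsionOne 𝒜 t).comap (𝒜 1).subtype := by
    ext x
    simp only [LinearMap.mem_ker, Submodule.mem_comap, mem_torsionOne, Submodule.subtype_apply,
      SetLike.coe_mem, true_and, ← H.coe_mulOne]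
    exact ⟨fun h ↦ congrArg Subtype.val h, fun h ↦ Subtype.ext h⟩
  rw [hker]
  exact (Submodule.comapSubtypeEquivOfLe inf_le_left).finrank_eq

theorem IsFiberLike.exists_frame {𝒜 : ℕ → Submodule k F} [GradedAlgebra 𝒜] {t : F}
    (H : IsFiberLike 𝒜 t) :
    ∃ p q : ℕ, 1 + p + Module.finrank k (torsionOne 𝒜 t) = Module.finrank k (𝒜 1) ∧
      1 + p + q = Module.finrank k (𝒜 2) ∧
      Nonempty (FiberFrame 𝒜 t p q (Module.finrank k (torsionOne 𝒜 t))) := by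
  have := H.finite_one
  have := H.finite_two
  have ht : H.mulOne ⟨t, H.mem⟩ ≠ 0 := fun h ↦ H.pow_ne_zero 2 (by
    rw [pow_two]; exact congrArg Subtype.val h)
  obtain ⟨p, q, c, w, d, h1, h2, hw, h3, h4, h5, h6⟩ := H.mulOne.exists_adapted_bases ht
  rw [← H.finrank_ker_mulOne]
  refine ⟨p, q, h1, h2, ⟨⟨fun i ↦ c i, fun j ↦ d j, fun l ↦ w l, fun i ↦ (c i).2,
    fun j ↦ (d j).2, fun l ↦ ⟨(w l).2, congrArg Subtype.val (hw l)⟩, fun x hx ↦ ?_,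
    fun α u y h ↦ ?_, fun x hx ↦ ?_, fun α u y h ↦ ?_⟩⟩⟩
  · obtain ⟨α, u, y, h⟩ := h3 ⟨x, hx⟩
    exact ⟨α, u, y, by simpa using congrArg Subtype.val h⟩
  · exact h4 α u y (Subtype.ext (by simpa using h))
  · obtain ⟨α, u, y, h⟩ := h5 ⟨x, hx⟩
    exact ⟨α, u, y, by simpa [H.coe_mulOne] using congrArg Subtype.val h⟩
  · exact h6 α u y (Subtype.ext (by simpa [H.coe_mulOne] using h))

theorem proj_aeval_mul {𝒜 : ℕ → Submodule k F} [GradedAlgebra 𝒜] {t x : F} {m : ℕ}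
    (ht : t ∈ 𝒜 1) (hx : x ∈ 𝒜 m) (f : k[X]) (n : ℕ) :
    GradedAlgebra.proj 𝒜 (n + m) (aeval t f * x) = f.coeff n • (t ^ n * x) := by
  induction f using Polynomial.induction_on' with
  | add f g hf hg => rw [map_add, add_mul, map_add, hf, hg, coeff_add, add_smul]
  | monomial l a =>
    have h1 : t ^ l * x ∈ 𝒜 (l + m) := by
      have := SetLike.pow_mem_graded l ht
      rw [smul_eq_mul, mul_one] at this
      exact SetLike.mul_mem_graded this hx
    rw [aeval_monomial, mul_assoc, ← Algebra.smul_def, map_smul, coeff_monomial,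
      GradedAlgebra.proj_apply]
    split_ifs with h
    · subst h
      rw [DirectSum.decompose_of_mem_same _ h1]
    · rw [DirectSum.decompose_of_mem_ne _ h1 (by omega), smul_zero, zero_smul]

theorem proj_aeval_mul_of_lt {𝒜 : ℕ → Submodule k F} [GradedAlgebra 𝒜] {t x : F} {m n : ℕ}
    (ht : t ∈ 𝒜 1) (hx : x ∈ 𝒜 m) (f : k[X]) (hn : n < m) :
    GradedAlgebra.proj 𝒜 n (aeval t f * x) = 0 := by
  induction f using Polynomial.induction_on' with
  | add f g hf hg => rw [map_add, add_mul, map_add, hf, hg, add_zero]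
  | monomial l a =>
    have h1 : t ^ l * x ∈ 𝒜 (l + m) := by
      have := SetLike.pow_mem_graded l ht
      rw [smul_eq_mul, mul_one] at this
      exact SetLike.mul_mem_graded this hx
    rw [aeval_monomial, mul_assoc, ← Algebra.smul_def, map_smul, GradedAlgebra.proj_apply,
      DirectSum.decompose_of_mem_ne _ h1 (by omega), smul_zero]

theorem IsFiberLike.eq_zero_of_pow_mul {𝒜 : ℕ → Submodule k F} [GradedAlgebra 𝒜] {t : F}
    (H : IsFiberLike 𝒜 t) {x : F} (hx : x ∈ 𝒜 2) (n : ℕ) (h : t ^ n * x = 0) : x = 0 := by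
  induction n with
  | zero => simpa using h
  | succ n ih =>
    have h1 : t ^ n * x ∈ 𝒜 (n + 2) := by
      have := SetLike.pow_mem_graded n H.mem
      rw [smul_eq_mul, mul_one] at this
      exact SetLike.mul_mem_graded this hx
    exact ih (H.eq_zero_of_mul (n + 2) (by omega) _ h1 (by rw [← mul_assoc, ← pow_succ', h]))

namespace FiberFrame

variable {𝒜 : ℕ → Submodule k F} {t : F} {p q s : ℕ}
  {S : Type*} [CommRing S] [Algebra S F] {τ : S}

theorem smul_w (B : FiberFrame 𝒜 t p q s) (hτ : algebraMap S F τ = t) (l : Fin s) :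
    τ • B.w l = 0 := by
  rw [Algebra.smul_def, hτ]; exact (B.w_mem l).2

/-- The homomorphism of `S`-modules defined by a frame. -/
noncomputable def hom (B : FiberFrame 𝒜 t p q s) (hτ : algebraMap S F τ = t) :
    S × (Fin p → S) × (Fin q → S) × (Fin s → S ⧸ Ideal.span {τ}) →ₗ[S] F :=
  (Algebra.linearMap S F).coprod ((Fintype.linearCombination S B.c).coprod
    ((Fintype.linearCombination S B.d).coprod
      (LinearMap.lsum S (fun _ ↦ S ⧸ Ideal.span {τ}) S fun l ↦
        Submodule.liftQ (Ideal.span {τ}) (LinearMap.toSpanSingleton S F (B.w l)) (by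
          rw [Ideal.span, Submodule.span_le, Set.singleton_subset_iff]
          exact B.smul_w hτ l))))

theorem hom_apply (B : FiberFrame 𝒜 t p q s) (hτ : algebraMap S F τ = t) (c : S) (u : Fin p → S)
    (v : Fin q → S) (z : Fin s → S) :
    B.hom hτ (c, u, v, fun l ↦ Ideal.Quotient.mk _ (z l)) =
      c • 1 + (∑ i, u i • B.c i + (∑ j, v j • B.d j + ∑ l, z l • B.w l)) := by
  simp only [hom, LinearMap.coprod_apply, Fintype.linearCombination_apply,
    LinearMap.lsum_apply, LinearMap.coe_sum, Finset.sum_apply, LinearMap.comp_apply,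
    Algebra.linearMap_apply, LinearMap.proj_apply]
  rw [Algebra.smul_def c (1 : F), mul_one]
  rfl

end FiberFrame

end Frame

section FrameEquiv

open Polynomial

namespace FiberFrame

variable {k F : Type*} [Field k] [CommRing F] [Algebra k F] {𝒜 : ℕ → Submodule k F}
  {t : F} {p q s : ℕ}
  {S : Type*} [CommRing S] [Algebra k S] [Algebra S F] [IsScalarTower k S F] {ρ : k[X] ≃ₐ[k] S}

theorem _root_.smul_eq_aeval_mul (hτ : algebraMap S F (ρ X) = t) (f : k[X]) (x : F) :
    ρ f • x = aeval t f * x := by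
  have h : ((Algebra.ofId S F).restrictScalars k).comp ρ.toAlgHom = aeval t := by
    refine Polynomial.algHom_ext ?_
    rw [aeval_X]
    exact hτ
  rw [Algebra.smul_def, ← h]
  rfl

theorem hom_apply_smul_pow (B : FiberFrame 𝒜 t p q s)
    (hτ : algebraMap S F (ρ X) = t) (n : ℕ) (a : k) (u : Fin p → k) (v : Fin q → k)
    (z : Fin s → k) :
    B.hom hτ (a • ρ X ^ n, fun i ↦ u i • ρ X ^ (n - 1), fun i ↦ v i • ρ X ^ (n - 2),
      fun i ↦ Ideal.Quotient.mk _ (z i • ρ X ^ (n - 1))) =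
    a • t ^ n + (∑ i, u i • (t ^ (n - 1) * B.c i) + (∑ i, v i • (t ^ (n - 2) * B.d i) +
      ∑ i, z i • (t ^ (n - 1) * B.w i))) := by
  rw [B.hom_apply hτ]
  have (m : ℕ) (x : F) (b : k) : (b • ρ X ^ m) • x = b • (t ^ m * x) := by
    rw [smul_assoc, Algebra.smul_def (ρ X ^ m), map_pow, hτ]
  simp only [this, mul_one]

theorem exists_eq_of_mem (H : IsFiberLike 𝒜 t) (B : FiberFrame 𝒜 t p q s) {n : ℕ} {x : F}
    (hx : x ∈ 𝒜 (n + 2)) : ∃ (α : k) (u : Fin p → k) (y : Fin q → k),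
      x = t ^ n * (α • (t * t) + ∑ i, u i • (t * B.c i) + ∑ j, y j • B.d j) := by
  induction n generalizing x with
  | zero =>
    obtain ⟨α, u, y, rfl⟩ := B.span_two x hx
    exact ⟨α, u, y, by rw [pow_zero, one_mul]⟩
  | succ n ih =>
    obtain ⟨y, hy, rfl⟩ := H.exists_eq_mul (n + 2) (by omega) x hx
    obtain ⟨α, u, y, rfl⟩ := ih hy
    exact ⟨α, u, y, by rw [← mul_assoc, pow_succ']⟩

/-- The component of degree `n` of `S ⊕ S(-1)^p ⊕ S(-2)^q ⊕ (S/τ)(-1)^s`, `S = k[τ]`. -/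
def IsHomogeneous (k : Type*) [Field k] {S : Type*} [CommRing S] [Algebra k S] (τ : S)
    {p q s : ℕ} (n : ℕ)
    (x : S × (Fin p → S) × (Fin q → S) × (Fin s → S ⧸ Ideal.span {τ})) : Prop :=
  (∃ a : k, x.1 = a • τ ^ n) ∧
  (∀ i, ∃ a : k, x.2.1 i = a • τ ^ (n - 1) ∧ (n < 1 → a = 0)) ∧
  (∀ i, ∃ a : k, x.2.2.1 i = a • τ ^ (n - 2) ∧ (n < 2 → a = 0)) ∧
  (∀ i, ∃ a : k, x.2.2.2 i = Ideal.Quotient.mk _ (a • τ ^ (n - 1)) ∧ (n < 1 → a = 0))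

theorem exists_hom_eq (H : IsFiberLike 𝒜 t) (B : FiberFrame 𝒜 t p q s)
    (hτ : algebraMap S F (ρ X) = t) {n : ℕ} {x : F} (hx : x ∈ 𝒜 n) :
    ∃ y, IsHomogeneous k (ρ X) n y ∧ B.hom hτ y = x := by
  rcases n with _ | _ | n
  · obtain ⟨a, rfl⟩ := H.exists_eq_algebraMap x hx
    refine ⟨_, ⟨⟨a, rfl⟩, fun i ↦ ⟨0, rfl, fun _ ↦ rfl⟩, fun i ↦ ⟨0, rfl, fun _ ↦ rfl⟩,
      fun i ↦ ⟨0, rfl, fun _ ↦ rfl⟩⟩, (B.hom_apply_smul_pow hτ 0 a _ _ _).trans ?_⟩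
    simp [Algebra.smul_def]
  · obtain ⟨a, u, y, rfl⟩ := B.span_one x hx
    refine ⟨_, ⟨⟨a, rfl⟩, fun i ↦ ⟨u i, rfl, by omega⟩, fun i ↦ ⟨0, rfl, fun _ ↦ rfl⟩,
      fun i ↦ ⟨y i, rfl, by omega⟩⟩, (B.hom_apply_smul_pow hτ 1 a u _ y).trans ?_⟩
    simp [add_assoc]
  · obtain ⟨a, u, y, rfl⟩ := B.exists_eq_of_mem H hx
    refine ⟨_, ⟨⟨a, rfl⟩, fun i ↦ ⟨u i, rfl, by omega⟩, fun i ↦ ⟨y i, rfl, by omega⟩,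
      fun i ↦ ⟨0, rfl, by omega⟩⟩, (B.hom_apply_smul_pow hτ (n + 2) a u y _).trans ?_⟩
    simp only [zero_smul, Finset.sum_const_zero, add_zero, mul_add, Finset.mul_sum,
      mul_smul_comm, add_assoc]
    rw [show n + 1 + 1 - 1 = n + 1 from rfl, show n + (1 + 1) - 2 = n from rfl]
    simp only [pow_succ t (n + 1), pow_succ t n, mul_assoc]

variable [GradedAlgebra 𝒜]

theorem hom_injective (H : IsFiberLike 𝒜 t) (B : FiberFrame 𝒜 t p q s)
    (hτ : algebraMap S F (ρ X) = t) : Function.Injective (B.hom hτ) := by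
  rw [injective_iff_map_eq_zero]
  rintro ⟨c, u, v, z⟩ h
  obtain ⟨c, rfl⟩ := ρ.surjective c
  obtain ⟨u, rfl⟩ := (ρ.surjective.comp_left (α := Fin p)) u
  obtain ⟨v, rfl⟩ := (ρ.surjective.comp_left (α := Fin q)) v
  obtain ⟨z, rfl⟩ := (Ideal.Quotient.mk_surjective.comp_left (α := Fin s)) z
  obtain ⟨z, rfl⟩ := (ρ.surjective.comp_left (α := Fin s)) z
  have h' := B.hom_apply hτ (ρ c) (ρ ∘ u) (ρ ∘ v) (ρ ∘ z)
  replace h' := h'.symm.trans h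
  simp only [Function.comp_apply, smul_eq_aeval_mul hτ] at h'
  have hone : (1 : F) ∈ 𝒜 0 := SetLike.one_mem_graded 𝒜
  have hproj (n : ℕ) := congrArg (GradedAlgebra.proj 𝒜 n) h'
  simp only [map_add, map_sum, map_zero] at hproj
  have hw (l : Fin s) (n : ℕ) : t ^ (n + 1) * B.w l = 0 := by
    rw [pow_succ, mul_assoc, (mem_torsionOne.mp (B.w_mem l)).2, mul_zero]
  have h0 : c.coeff 0 = 0 := by
    have h1 := hproj 0
    rw [Finset.sum_eq_zero fun i _ ↦ proj_aeval_mul_of_lt H.mem (B.c_mem i) _ one_pos,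
      Finset.sum_eq_zero fun i _ ↦ proj_aeval_mul_of_lt H.mem (B.d_mem i) _ two_pos,
      Finset.sum_eq_zero fun i _ ↦ proj_aeval_mul_of_lt H.mem (B.w_mem i).1 _ one_pos,
      show 0 = 0 + 0 from rfl, proj_aeval_mul H.mem hone] at h1
    have : Nontrivial F := ⟨1, 0, fun h ↦ H.pow_ne_zero 0 (by rw [pow_zero, h])⟩
    simpa using h1
  have h1 : c.coeff 1 = 0 ∧ (fun i ↦ (u i).coeff 0) = 0 ∧ (fun l ↦ (z l).coeff 0) = 0 := by
    have h1 := hproj 1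
    rw [Finset.sum_congr rfl fun i _ ↦ (by
        simpa using proj_aeval_mul H.mem (B.c_mem i) (u i) 0 :
          GradedAlgebra.proj 𝒜 1 (aeval t (u i) * B.c i) = (u i).coeff 0 • B.c i),
      Finset.sum_eq_zero fun i _ ↦ proj_aeval_mul_of_lt H.mem (B.d_mem i) _ one_lt_two,
      Finset.sum_congr rfl fun i _ ↦ (by
        simpa using proj_aeval_mul H.mem (B.w_mem i).1 (z i) 0 :
          GradedAlgebra.proj 𝒜 1 (aeval t (z i) * B.w i) = (z i).coeff 0 • B.w i),
      (by simpa using proj_aeval_mul H.mem hone c 1 :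
        GradedAlgebra.proj 𝒜 1 (aeval t c * 1) = c.coeff 1 • t), zero_add] at h1
    exact B.indep_one _ _ _ ((add_assoc _ _ _).trans h1)
  have h2 (n : ℕ) : c.coeff (n + 2) = 0 ∧ (fun i ↦ (u i).coeff (n + 1)) = 0 ∧
      (fun j ↦ (v j).coeff n) = 0 := by
    have h1 := hproj (n + 2)
    rw [Finset.sum_congr rfl fun i _ ↦ (by
        rw [show n + 2 = (n + 1) + 1 from rfl, proj_aeval_mul H.mem (B.c_mem i)]
        rw [pow_succ, mul_assoc, mul_smul_comm] :
          GradedAlgebra.proj 𝒜 (n + 2) (aeval t (u i) * B.c i) =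
            t ^ n * (u i).coeff (n + 1) • (t * B.c i)),
      Finset.sum_congr rfl fun i _ ↦ (by
        rw [proj_aeval_mul H.mem (B.d_mem i), mul_smul_comm] :
          GradedAlgebra.proj 𝒜 (n + 2) (aeval t (v i) * B.d i) =
            t ^ n * (v i).coeff n • (B.d i)),
      Finset.sum_congr rfl fun i _ ↦ (by
        rw [show n + 2 = (n + 1) + 1 from rfl, proj_aeval_mul H.mem (B.w_mem i).1, hw,
          smul_zero] : GradedAlgebra.proj 𝒜 (n + 2) (aeval t (z i) * B.w i) = 0),
      Finset.sum_const_zero,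
      (by
        rw [show n + 2 = (n + 2) + 0 from rfl, proj_aeval_mul H.mem hone, add_zero, pow_add,
          mul_one, mul_smul_comm, pow_two] : GradedAlgebra.proj 𝒜 (n + 2) (aeval t c * 1) =
          t ^ n * c.coeff (n + 2) • (t * t)), add_zero, ← Finset.mul_sum, ← Finset.mul_sum,
      ← mul_add, ← mul_add] at h1
    have h3 := H.eq_zero_of_pow_mul ?_ n h1
    · exact B.indep_two _ _ _ ((add_assoc _ _ _).trans h3)
    · exact add_mem (Submodule.smul_mem _ _ (SetLike.mul_mem_graded H.mem H.mem))
        (add_mem (sum_mem fun i _ ↦ Submodule.smul_mem _ _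
          (SetLike.mul_mem_graded H.mem (B.c_mem i)))
        (sum_mem fun i _ ↦ Submodule.smul_mem _ _ (B.d_mem i)))
  have hc : c = 0 := by
    ext n
    rcases n with _ | _ | n
    exacts [h0, h1.1, (h2 n).1]
  have hu (i) : u i = 0 := by
    ext n
    rcases n with _ | n
    exacts [congrFun h1.2.1 i, congrFun (h2 n).2.1 i]
  have hv (i) : v i = 0 := by
    ext n
    exact congrFun (h2 n).2.2 i
  have hz (l) : Ideal.Quotient.mk (Ideal.span {ρ X}) (ρ (z l)) = 0 := by
    rw [Ideal.Quotient.eq_zero_iff_mem, Ideal.mem_span_singleton]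
    exact map_dvd ρ (X_dvd_iff.mpr (congrFun h1.2.2 l))
  refine Prod.ext ?_ (Prod.ext ?_ (Prod.ext ?_ ?_))
  · simp [hc]
  · funext i; simp [hu]
  · funext i; simp [hv]
  · funext i; simpa using hz i

theorem hom_mem (H : IsFiberLike 𝒜 t) (B : FiberFrame 𝒜 t p q s)
    (hτ : algebraMap S F (ρ X) = t) {n : ℕ}
    {x : S × (Fin p → S) × (Fin q → S) × (Fin s → S ⧸ Ideal.span {ρ X})}
    (hx : IsHomogeneous k (ρ X) n x) : B.hom hτ x ∈ 𝒜 n := by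
  obtain ⟨c, u, v, z⟩ := x
  obtain ⟨⟨a, ha⟩, hu, hv, hz⟩ := hx
  dsimp only at ha hu hv hz
  choose u' hu hu' using hu
  choose v' hv hv' using hv
  choose z' hz hz' using hz
  obtain rfl := ha
  obtain rfl := funext hu
  obtain rfl := funext hv
  obtain rfl := funext hz
  rw [B.hom_apply_smul_pow hτ]
  have hpow (m : ℕ) : t ^ m ∈ 𝒜 m := by
    simpa using SetLike.pow_mem_graded m H.mem
  have hmul {m d : ℕ} {b : k} (hb : n < d → b = 0) (hm : m = n - d) {x : F} (hx : x ∈ 𝒜 d) :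
      b • (t ^ m * x) ∈ 𝒜 n := by
    by_cases h : n < d
    · rw [hb h, zero_smul]; exact zero_mem _
    · refine Submodule.smul_mem _ _ ?_
      have := SetLike.mul_mem_graded (hpow m) hx
      rwa [hm, Nat.sub_add_cancel (not_lt.mp h), ← hm] at this
  exact add_mem (Submodule.smul_mem _ _ (hpow n)) (add_mem
    (sum_mem fun i _ ↦ hmul (hu' i) rfl (B.c_mem i)) (add_mem
    (sum_mem fun i _ ↦ hmul (hv' i) rfl (B.d_mem i))
    (sum_mem fun i _ ↦ hmul (hz' i) rfl (B.w_mem i).1)))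

theorem hom_bijective (H : IsFiberLike 𝒜 t) (B : FiberFrame 𝒜 t p q s)
    (hτ : algebraMap S F (ρ X) = t) : Function.Bijective (B.hom hτ) := by
  refine ⟨B.hom_injective H hτ, fun x ↦ ?_⟩
  classical
  change x ∈ LinearMap.range (B.hom hτ)
  rw [← DirectSum.sum_support_decompose 𝒜 x]
  refine Submodule.sum_mem (LinearMap.range (B.hom hτ)) fun n _ ↦ ?_
  obtain ⟨y, -, hy⟩ := B.exists_hom_eq H hτ (SetLike.coe_mem (DirectSum.decompose 𝒜 x n))
  exact ⟨y, hy⟩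

/-- The isomorphism of graded modules defined by a frame. -/
noncomputable def equiv (H : IsFiberLike 𝒜 t) (B : FiberFrame 𝒜 t p q s)
    (hτ : algebraMap S F (ρ X) = t) :
    F ≃ₗ[S] S × (Fin p → S) × (Fin q → S) × (Fin s → S ⧸ Ideal.span {ρ X}) :=
  (LinearEquiv.ofBijective (B.hom hτ) (B.hom_bijective H hτ)).symm

theorem hom_equiv (H : IsFiberLike 𝒜 t) (B : FiberFrame 𝒜 t p q s)
    (hτ : algebraMap S F (ρ X) = t) (x : F) : B.hom hτ (B.equiv H hτ x) = x :=
  (LinearEquiv.ofBijective (B.hom hτ) (B.hom_bijective H hτ)).apply_symm_apply x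

theorem equiv_hom (H : IsFiberLike 𝒜 t) (B : FiberFrame 𝒜 t p q s)
    (hτ : algebraMap S F (ρ X) = t) (x) : B.equiv H hτ (B.hom hτ x) = x :=
  (LinearEquiv.ofBijective (B.hom hτ) (B.hom_bijective H hτ)).symm_apply_apply x

theorem mem_iff_isHomogeneous (H : IsFiberLike 𝒜 t) (B : FiberFrame 𝒜 t p q s)
    (hτ : algebraMap S F (ρ X) = t) {n : ℕ} {x : F} :
    x ∈ 𝒜 n ↔ IsHomogeneous k (ρ X) n (B.equiv H hτ x) := by
  constructor
  · intro hx
    obtain ⟨y, hy, rfl⟩ := B.exists_hom_eq H hτ hx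
    rwa [B.equiv_hom]
  · intro hx
    rw [← B.hom_equiv H hτ x]
    exact B.hom_mem H hτ hx

end FiberFrame

end FrameEquiv

section FiberLikeRing

open Polynomial

theorem IsLocalRing.isNilpotent_of_ringKrullDim_eq_zero {R : Type*} [CommRing R] [IsLocalRing R]
    (h : ringKrullDim R = 0) {x : R} (hx : x ∈ maximalIdeal R) : IsNilpotent x := by
  have : Ring.KrullDimLE 0 R := Ring.krullDimLE_iff.mpr (by simp [h])
  rw [nilpotent_iff_mem_prime]
  intro J hJ
  have hJ' : J.IsMaximal := Ring.krullDimLE_zero_iff.mp this J hJ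
  rwa [eq_maximalIdeal hJ']

theorem isCohenMacaulayLocal_of_isSMulRegular {R : Type*} [CommRing R] [IsLocalRing R]
    [IsNoetherianRing R] (hdim : ringKrullDim R ≤ 1) {x : R} (hx : x ∈ maximalIdeal R)
    (hreg : IsSMulRegular R x) : IsCohenMacaulayLocal R := by
  refine ⟨inferInstance, [x], by simpa using hx, ?_, ?_⟩
  · rw [IsLocalRing.isRegular_iff_isWeaklyRegular_of_subset_maximalIdeal (by simpa using hx),
      RingTheory.Sequence.isWeaklyRegular_singleton_iff]
    exact hreg
  · refine le_antisymm ?_ hdim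
    have hx' : x ∈ nonZeroDivisors R := by
      rw [mem_nonZeroDivisors_iff_right]
      intro y hy
      refine hreg ?_
      change x • y = x • 0
      rw [smul_zero, smul_eq_mul, mul_comm, hy]
    have h1 := ringKrullDim_quotient_succ_le_of_nonZeroDivisor hx'
    have : Nontrivial (R ⧸ Ideal.span {x}) := by
      rw [Ideal.Quotient.nontrivial_iff]
      intro h
      rw [Ideal.span_singleton_eq_top] at h
      exact hx h
    have h2 : 0 ≤ ringKrullDim (R ⧸ Ideal.span {x}) := ringKrullDim_nonneg_of_nontrivial
    refine le_trans ?_ h1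
    calc (([x] : List R).length : WithBot ℕ∞) = 0 + 1 := by simp
      _ ≤ _ := by gcongr

variable {k F : Type*} [Field k] [CommRing F] [Algebra k F] {𝒜 : ℕ → Submodule k F} {t : F}

theorem torsionOne_aeval_mul {x : F} (hx : x ∈ torsionOne 𝒜 t) (f : k[X]) :
    aeval t f * x = f.coeff 0 • x := by
  induction f using Polynomial.induction_on' with
  | add f g hf hg => rw [map_add, add_mul, hf, hg, coeff_add, add_smul]
  | monomial l a =>
    rw [aeval_monomial, mul_assoc, ← Algebra.smul_def, coeff_monomial]
    rcases l with _ | l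
    · simp
    · rw [pow_succ, mul_assoc, (mem_torsionOne.mp hx).2]
      simp

theorem IsFiberLike.nontrivial (H : IsFiberLike 𝒜 t) : Nontrivial F :=
  ⟨1, 0, fun h ↦ H.pow_ne_zero 0 (by rw [pow_zero, h])⟩

variable [GradedAlgebra 𝒜]

/-- The ideal of elements of positive degree. -/
noncomputable abbrev irrelevantIdeal (𝒜 : ℕ → Submodule k F) [GradedAlgebra 𝒜] : Ideal F :=
  (HomogeneousIdeal.irrelevant 𝒜).toIdeal

namespace IsFiberLike

theorem mem_torsionOne_of_aeval_mul (H : IsFiberLike 𝒜 t) {f : k[X]} (hf : f ≠ 0) {y : F}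
    (h : aeval t f * y = 0) : y ∈ torsionOne 𝒜 t := by
  obtain ⟨p, q, -, -, ⟨B⟩⟩ := H.exists_frame
  let _ : Algebra k[X] F := (aeval t).toRingHom.toAlgebra
  have halg (g : k[X]) : algebraMap k[X] F g = aeval t g := rfl
  have : IsScalarTower k k[X] F := IsScalarTower.of_algebraMap_eq fun a ↦ by
    rw [halg]; simp
  have hτ : algebraMap k[X] F ((AlgEquiv.refl : k[X] ≃ₐ[k] k[X]) X) = t := by
    rw [halg]; simp
  have he := B.hom_equiv H hτ y
  have h1 : f • B.equiv H hτ y = 0 := by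
    rw [← map_smul, Algebra.smul_def, halg, h, map_zero]
  generalize B.equiv H hτ y = e at he h1
  obtain ⟨c, u, v, z⟩ := e
  obtain ⟨z, rfl⟩ := (Ideal.Quotient.mk_surjective.comp_left (α := Fin _)) z
  have hc : c = 0 := (smul_eq_zero.mp (congrArg Prod.fst h1)).resolve_left hf
  have hu : u = 0 := (smul_eq_zero.mp (congrArg (·.2.1) h1)).resolve_left hf
  have hv : v = 0 := (smul_eq_zero.mp (congrArg (·.2.2.1) h1)).resolve_left hf
  have h2 := B.hom_apply hτ c u v z
  replace h2 := he.symm.trans h2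
  rw [h2, hc, hu, hv]
  simp only [zero_smul, Pi.zero_apply, Finset.sum_const_zero, zero_add]
  refine Submodule.sum_mem _ fun l _ ↦ ?_
  rw [Algebra.smul_def, halg, torsionOne_aeval_mul (B.w_mem l)]
  exact Submodule.smul_mem _ _ (B.w_mem l)

theorem mul_torsionOne (H : IsFiberLike 𝒜 t) {x y : F} (hx : x ∈ irrelevantIdeal 𝒜)
    (hy : y ∈ torsionOne 𝒜 t) : x * y = 0 := by
  classical
  rw [← DirectSum.sum_support_decompose 𝒜 x, Finset.sum_mul]
  refine Finset.sum_eq_zero fun n _ ↦ ?_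
  rcases n with _ | n
  · have h0 : ((DirectSum.decompose 𝒜 x 0 : 𝒜 0) : F) = 0 := hx
    rw [h0, zero_mul]
  · have h1 : (DirectSum.decompose 𝒜 x (n + 1) : F) * y ∈ 𝒜 (n + 1 + 1) :=
      SetLike.mul_mem_graded (SetLike.coe_mem _) hy.1
    refine H.eq_zero_of_mul _ (by omega) _ h1 ?_
    rw [mul_left_comm, (mem_torsionOne.mp hy).2, mul_zero]

theorem mem_irrelevantIdeal (H : IsFiberLike 𝒜 t) : t ∈ irrelevantIdeal 𝒜 :=
  HomogeneousIdeal.mem_irrelevant_of_mem 𝒜 one_pos H.mem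

theorem exists_coe_decompose_zero (H : IsFiberLike 𝒜 t) {m : F} (hm : m ∉ irrelevantIdeal 𝒜) :
    ∃ c : k, c ≠ 0 ∧ (DirectSum.decompose 𝒜 m 0 : F) = algebraMap k F c := by
  obtain ⟨c, hc⟩ := H.exists_eq_algebraMap _ (SetLike.coe_mem (DirectSum.decompose 𝒜 m 0))
  refine ⟨c, ?_, hc⟩
  rintro rfl
  rw [map_zero] at hc
  exact hm hc

theorem isMaximal_irrelevantIdeal (H : IsFiberLike 𝒜 t) : (irrelevantIdeal 𝒜).IsMaximal := by
  have := H.nontrivial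
  rw [Ideal.isMaximal_iff]
  constructor
  · intro h
    have h1 : ((DirectSum.decompose 𝒜 (1 : F) 0 : 𝒜 0) : F) = 0 := h
    rw [DirectSum.decompose_of_mem_same _ SetLike.GradedOne.one_mem] at h1
    exact one_ne_zero h1
  · intro J x hJ hx hxJ
    obtain ⟨c, hc, h⟩ := H.exists_coe_decompose_zero hx
    have h1 : x - algebraMap k F c ∈ irrelevantIdeal 𝒜 := by
      change ((DirectSum.decompose 𝒜 (x - algebraMap k F c) 0 : 𝒜 0) : F) = 0
      rw [DirectSum.decompose_sub, DirectSum.sub_apply, Submodule.coe_sub, h,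
        DirectSum.decompose_of_mem_same _ (SetLike.algebraMap_mem_graded 𝒜 c), sub_self]
    have h2 : algebraMap k F c ∈ J := by
      simpa using J.sub_mem hxJ (hJ h1)
    have h3 := J.mul_mem_left (algebraMap k F c⁻¹) h2
    rwa [← map_mul, inv_mul_cancel₀ hc, map_one] at h3

theorem eq_zero_of_notMem_mul (H : IsFiberLike 𝒜 t) {m x : F} {n : ℕ}
    (hm : m ∉ irrelevantIdeal 𝒜) (hx : x ∈ 𝒜 n) (h : m * x = 0) : x = 0 := by
  obtain ⟨c, hc, h0⟩ := H.exists_coe_decompose_zero hm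
  have h1 := DirectSum.coe_decompose_mul_of_right_mem 𝒜 n hx (a := m)
  rw [h, if_pos le_rfl, Nat.sub_self, h0, DirectSum.decompose_zero, DirectSum.zero_apply,
    ZeroMemClass.coe_zero, ← Algebra.smul_def] at h1
  exact (smul_eq_zero.mp h1.symm).resolve_left hc

theorem exists_finite (H : IsFiberLike 𝒜 t) :
    (aeval (R := k) t).toRingHom.Finite := by
  obtain ⟨p, q, -, -, ⟨B⟩⟩ := H.exists_frame
  let _ : Algebra k[X] F := (aeval t).toRingHom.toAlgebra
  have halg (g : k[X]) : algebraMap k[X] F g = aeval t g := rfl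
  have : IsScalarTower k k[X] F := IsScalarTower.of_algebraMap_eq fun a ↦ by
    rw [halg]; simp
  have hτ : algebraMap k[X] F ((AlgEquiv.refl : k[X] ≃ₐ[k] k[X]) X) = t := by
    rw [halg]; simp
  exact Module.Finite.equiv (B.equiv H hτ).symm

theorem isNoetherianRing (H : IsFiberLike 𝒜 t) : IsNoetherianRing F := by
  let _ : Algebra k[X] F := (aeval t).toRingHom.toAlgebra
  have : Module.Finite k[X] F := H.exists_finite
  exact IsNoetherianRing.of_finite k[X] F

theorem exists_aeval_mem (H : IsFiberLike 𝒜 t) (P : Ideal F) [P.IsMaximal] :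
    ∃ f : k[X], f ≠ 0 ∧ aeval t f ∈ P := by
  let _ : Algebra k[X] F := (aeval t).toRingHom.toAlgebra
  have : Module.Finite k[X] F := H.exists_finite
  have hmax : (P.comap (algebraMap k[X] F)).IsMaximal :=
    Ideal.isMaximal_comap_of_isIntegral_of_isMaximal P
  by_contra! hcon
  have hbot : P.comap (algebraMap k[X] F) = ⊥ := by
    rw [eq_bot_iff]
    intro f hf
    by_contra hne
    exact hcon f hne hf
  rw [hbot] at hmax
  exact Polynomial.not_isField k (Ring.isField_iff_maximal_bot.mpr hmax)

theorem mul_eq_zero_of_localization (H : IsFiberLike 𝒜 t) (P : Ideal F) [P.IsMaximal]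
    {f : k[X]} (hf : f ≠ 0) {y z : Localization.AtPrime P}
    (hy : algebraMap F (Localization.AtPrime P) (aeval t f) * y = 0)
    (hz : z ∈ maximalIdeal (Localization.AtPrime P)) : z * y = 0 := by
  obtain ⟨⟨y₀, s⟩, hs⟩ := IsLocalization.surj P.primeCompl y
  obtain ⟨⟨z₀, s'⟩, hs'⟩ := IsLocalization.surj P.primeCompl z
  dsimp only at hs hs'
  have hz₀ : z₀ ∈ P := by
    rw [← IsLocalization.AtPrime.to_map_mem_maximal_iff (Localization.AtPrime P) P, ← hs']
    exact Ideal.mul_mem_right _ _ hz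
  have h1 : algebraMap F (Localization.AtPrime P) (aeval t f * y₀) = 0 := by
    rw [map_mul, ← hs, ← mul_assoc, hy, zero_mul]
  rw [IsLocalization.map_eq_zero_iff P.primeCompl] at h1
  obtain ⟨m, hm⟩ := h1
  have hK : (m : F) * y₀ ∈ torsionOne 𝒜 t :=
    H.mem_torsionOne_of_aeval_mul hf (by rw [← hm]; ring)
  have h2 : algebraMap F (Localization.AtPrime P) (z₀ * y₀) = 0 := by
    rw [IsLocalization.map_eq_zero_iff P.primeCompl]
    by_cases hP : irrelevantIdeal 𝒜 ≤ P
    · have hPM := H.isMaximal_irrelevantIdeal.eq_of_le (Ideal.IsMaximal.ne_top ‹_›) hP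
      refine ⟨m, ?_⟩
      rw [← H.mul_torsionOne (hPM ▸ hz₀) hK]
      ring
    · obtain ⟨b, hb, hbP⟩ := SetLike.not_le_iff_exists.mp hP
      refine ⟨⟨b, hbP⟩ * m, ?_⟩
      have h3 := H.mul_torsionOne hb hK
      change b * m * (z₀ * y₀) = 0
      rw [show b * m * (z₀ * y₀) = z₀ * (b * (m * y₀)) by ring, h3, mul_zero]
  have hu := (IsLocalization.map_units (Localization.AtPrime P) s).mul
    (IsLocalization.map_units (Localization.AtPrime P) s')
  rw [← hu.mul_left_eq_zero, ← h2, map_mul, ← hs, ← hs']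
  ring

theorem isBuchsbaum (H : IsFiberLike 𝒜 t) (hdim : ringKrullDim F ≤ 1) : IsBuchsbaum F := by
  have := H.isNoetherianRing
  refine ⟨this, fun P _ ↦ ⟨IsLocalization.isNoetherianRing P.primeCompl _ this, ?_⟩⟩
  rintro xs ⟨-, hlen, hrad⟩ i hi y hy z hz
  have hle : (xs.length : WithBot ℕ∞) ≤ 1 := by
    rw [hlen, IsLocalization.AtPrime.ringKrullDim_eq_height P]
    exact Ideal.height_le_ringKrullDim_of_isPrime.trans hdim
  replace hle : xs.length ≤ 1 := by exact_mod_cast hle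
  obtain ⟨x, rfl⟩ := List.length_eq_one_iff.mp (show xs.length = 1 by omega)
  obtain rfl : i = 0 := by simpa using hi
  simp only [List.take_zero, Ideal.ofList_nil, Ideal.mem_bot, List.getElem_cons_zero] at hy ⊢
  obtain ⟨f, hf, hfP⟩ := H.exists_aeval_mem P
  have h1 : algebraMap F (Localization.AtPrime P) (aeval t f) ∈
      (Ideal.ofList [x]).radical := by
    rw [hrad, IsLocalization.AtPrime.to_map_mem_maximal_iff _ P]
    exact hfP
  obtain ⟨n, hn⟩ := h1
  rw [Ideal.ofList_singleton, Ideal.mem_span_singleton] at hn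
  obtain ⟨u, hu⟩ := hn
  refine H.mul_eq_zero_of_localization P (_root_.pow_ne_zero n hf) ?_ hz
  rw [map_pow, map_pow, hu, mul_right_comm, hy, zero_mul]

theorem isSMulRegular_localization (H : IsFiberLike 𝒜 t) (hK : torsionOne 𝒜 t = ⊥)
    (P : Ideal F) [P.IsPrime] {f : k[X]} (hf : f ≠ 0) :
    IsSMulRegular (Localization.AtPrime P)
      (algebraMap F (Localization.AtPrime P) (aeval t f)) := by
  rw [isSMulRegular_iff_right_eq_zero_of_smul]
  intro y hy
  obtain ⟨⟨y₀, s⟩, hs⟩ := IsLocalization.surj P.primeCompl y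
  dsimp only at hs
  have h1 : algebraMap F (Localization.AtPrime P) (aeval t f * y₀) = 0 := by
    rw [map_mul, ← hs, ← mul_assoc]
    exact mul_eq_zero_of_left hy _
  rw [IsLocalization.map_eq_zero_iff P.primeCompl] at h1
  obtain ⟨m, hm⟩ := h1
  have h2 : (m : F) * y₀ ∈ torsionOne 𝒜 t :=
    H.mem_torsionOne_of_aeval_mul hf (by rw [← hm]; ring)
  rw [hK, Submodule.mem_bot] at h2
  have h3 : algebraMap F (Localization.AtPrime P) y₀ = 0 :=
    (IsLocalization.map_eq_zero_iff P.primeCompl _ _).mpr ⟨m, h2⟩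
  rw [h3] at hs
  exact (IsLocalization.map_units _ s).mul_left_eq_zero.mp hs

theorem isCohenMacaulay (H : IsFiberLike 𝒜 t) (hdim : ringKrullDim F ≤ 1)
    (hK : torsionOne 𝒜 t = ⊥) : IsCohenMacaulay F := by
  have := H.isNoetherianRing
  refine ⟨this, fun P _ ↦ ?_⟩
  have : IsNoetherianRing (Localization.AtPrime P) :=
    IsLocalization.isNoetherianRing P.primeCompl _ this
  obtain ⟨f, hf, hfP⟩ := H.exists_aeval_mem P
  refine isCohenMacaulayLocal_of_isSMulRegular
    (x := algebraMap F (Localization.AtPrime P) (aeval t f)) ?_ ?_ ?_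
  · rw [IsLocalization.AtPrime.ringKrullDim_eq_height P]
    exact Ideal.height_le_ringKrullDim_of_isPrime.trans hdim
  · rwa [IsLocalization.AtPrime.to_map_mem_maximal_iff _ P]
  · exact H.isSMulRegular_localization hK P hf

theorem not_isNilpotent_localization (H : IsFiberLike 𝒜 t) [(irrelevantIdeal 𝒜).IsPrime] :
    ¬ IsNilpotent (algebraMap F (Localization.AtPrime (irrelevantIdeal 𝒜)) t) := by
  rintro ⟨n, hn⟩
  rw [← map_pow, IsLocalization.map_eq_zero_iff (irrelevantIdeal 𝒜).primeCompl] at hn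
  obtain ⟨m, hm⟩ := hn
  have h1 : t ^ n ∈ 𝒜 n := by simpa using SetLike.pow_mem_graded n H.mem
  exact H.pow_ne_zero n (H.eq_zero_of_notMem_mul m.2 h1 hm)

theorem torsionOne_eq_bot_of_isCohenMacaulay (H : IsFiberLike 𝒜 t) (hCM : IsCohenMacaulay F) :
    torsionOne 𝒜 t = ⊥ := by
  have := H.isMaximal_irrelevantIdeal
  obtain ⟨-, xs, hxs, hreg, hlen⟩ := hCM.2 (irrelevantIdeal 𝒜)
  rcases xs with _ | ⟨x, xs⟩
  · refine absurd (IsLocalRing.isNilpotent_of_ringKrullDim_eq_zero hlen.symm ?_)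
      H.not_isNilpotent_localization
    rw [IsLocalization.AtPrime.to_map_mem_maximal_iff _ (irrelevantIdeal 𝒜)]
    exact H.mem_irrelevantIdeal
  · rw [eq_bot_iff]
    intro y hy
    have hx := hxs x List.mem_cons_self
    have hxreg := ((RingTheory.Sequence.isRegular_cons_iff _ _ _).mp hreg).1
    rw [isSMulRegular_iff_right_eq_zero_of_smul] at hxreg
    obtain ⟨⟨x₀, s⟩, hs⟩ := IsLocalization.surj (irrelevantIdeal 𝒜).primeCompl x
    dsimp only at hs
    have hx₀ : x₀ ∈ irrelevantIdeal 𝒜 := by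
      rw [← IsLocalization.AtPrime.to_map_mem_maximal_iff
        (Localization.AtPrime (irrelevantIdeal 𝒜)) (irrelevantIdeal 𝒜), ← hs]
      exact Ideal.mul_mem_right _ _ hx
    have h1 : algebraMap F (Localization.AtPrime (irrelevantIdeal 𝒜)) y = 0 := by
      refine hxreg _ ?_
      rw [smul_eq_mul, ← (IsLocalization.map_units _ s).mul_left_eq_zero, mul_right_comm, hs,
        ← map_mul, H.mul_torsionOne hx₀ hy, map_zero]
    rw [IsLocalization.map_eq_zero_iff (irrelevantIdeal 𝒜).primeCompl] at h1
    obtain ⟨m, hm⟩ := h1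
    exact H.eq_zero_of_notMem_mul m.2 hy.1 hm

end IsFiberLike

end FiberLikeRing

section FiberLikeGorenstein

open Polynomial
open scoped Pointwise

universe u

variable {k F : Type u} [Field k] [CommRing F] [Algebra k F] {𝒜 : ℕ → Submodule k F}
  [GradedAlgebra 𝒜] {t : F}

namespace IsFiberLike

theorem torsionOne_eq_bot_of_isGorenstein (H : IsFiberLike 𝒜 t) (hG : IsGorenstein F) :
    torsionOne 𝒜 t = ⊥ := by
  have hmax := H.isMaximal_irrelevantIdeal
  obtain ⟨hN, n, hn⟩ := hG.2 (irrelevantIdeal 𝒜)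
  rw [eq_bot_iff]
  intro y hy
  by_contra hy0
  have hw : algebraMap F (Localization.AtPrime (irrelevantIdeal 𝒜)) y ≠ 0 := by
    intro h1
    rw [IsLocalization.map_eq_zero_iff (irrelevantIdeal 𝒜).primeCompl] at h1
    obtain ⟨m, hm⟩ := h1
    exact hy0 (H.eq_zero_of_notMem_mul m.2 hy.1 hm)
  refine H.not_isNilpotent_localization (isNilpotent_of_injective_self
    (injective_self_of_hasInjectiveDimensionLE hn hw fun z hz ↦
      H.mul_eq_zero_of_localization _ (X_ne_zero (R := k)) ?_ hz) ?_)
  · rw [aeval_X, ← map_mul, (mem_torsionOne.mp hy).2, map_zero]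
  · rw [IsLocalization.AtPrime.to_map_mem_maximal_iff _ (irrelevantIdeal 𝒜)]
    exact H.mem_irrelevantIdeal

theorem decompose_mul_self (H : IsFiberLike 𝒜 t) (x : F) (n : ℕ) :
    (DirectSum.decompose 𝒜 (t * x) (n + 1) : F) = t * DirectSum.decompose 𝒜 x n := by
  rw [DirectSum.coe_decompose_mul_of_left_mem 𝒜 (n + 1) H.mem, if_pos (by omega),
    Nat.add_sub_cancel]

theorem exists_eq_mul_of_notMem_mul (H : IsFiberLike 𝒜 t) {m x y : F} {n : ℕ}
    (hm : m ∉ irrelevantIdeal 𝒜) (hx : x ∈ 𝒜 (n + 1)) (h : m * x = t * y) :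
    ∃ z ∈ 𝒜 n, x = t * z := by
  obtain ⟨c, hc, h0⟩ := H.exists_coe_decompose_zero hm
  have h1 := DirectSum.coe_decompose_mul_of_right_mem 𝒜 (n + 1) hx (a := m)
  rw [h, if_pos le_rfl, Nat.sub_self, h0, H.decompose_mul_self, ← Algebra.smul_def] at h1
  refine ⟨c⁻¹ • (DirectSum.decompose 𝒜 y n : F), Submodule.smul_mem _ _ (SetLike.coe_mem _), ?_⟩
  rw [mul_smul_comm, h1, smul_smul, inv_mul_cancel₀ hc, one_smul]

theorem mem_smul_top_localization {P : Ideal F} [P.IsPrime] {x : F} :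
    algebraMap F (Localization.AtPrime P) x ∈
      algebraMap F (Localization.AtPrime P) t • (⊤ : Submodule (Localization.AtPrime P) _) ↔
    ∃ m ∉ P, ∃ y, m * x = t * y := by
  rw [Submodule.mem_smul_pointwise_iff_exists]
  constructor
  · rintro ⟨b, -, hb⟩
    obtain ⟨⟨y, s⟩, hs⟩ := IsLocalization.surj P.primeCompl b
    dsimp only at hs
    have h1 : algebraMap F (Localization.AtPrime P) (s * x) =
        algebraMap F (Localization.AtPrime P) (t * y) := by
      rw [map_mul, map_mul, ← hb, ← hs, smul_eq_mul]; ring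
    rw [IsLocalization.eq_iff_exists P.primeCompl] at h1
    obtain ⟨m, hm⟩ := h1
    exact ⟨m * s, (m * s).2, m * y, by rw [mul_assoc, hm]; ring⟩
  · rintro ⟨m, hm, y, h⟩
    have hu := IsLocalization.map_units (Localization.AtPrime P) (⟨m, hm⟩ : P.primeCompl)
    refine ⟨algebraMap F _ y * ↑hu.unit⁻¹, trivial, ?_⟩
    rw [smul_eq_mul, ← mul_assoc, ← map_mul, ← h, map_mul, mul_right_comm]
    rw [IsUnit.mul_val_inv, one_mul]

/-- In a Gorenstein ring the socle modulo `t` is principal. -/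
theorem exists_mul_eq_of_isGorenstein (H : IsFiberLike 𝒜 t) (hG : IsGorenstein F) {d y : F}
    {m : ℕ} (hd : d ∈ 𝒜 (m + 1)) (hdt : ∀ x ∈ 𝒜 m, d ≠ t * x)
    (hmd : ∀ z ∈ irrelevantIdeal 𝒜, ∃ x, z * d = t * x)
    (hmy : ∀ z ∈ irrelevantIdeal 𝒜, ∃ x, z * y = t * x) :
    ∃ f x : F, y = f * d + t * x := by
  have hmax := H.isMaximal_irrelevantIdeal
  have hK := H.torsionOne_eq_bot_of_isGorenstein hG
  obtain ⟨hN, l, hl⟩ := hG.2 (irrelevantIdeal 𝒜)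
  let R := Localization.AtPrime (irrelevantIdeal 𝒜)
  have hreg : IsSMulRegular R (algebraMap F R t) := by
    have := H.isSMulRegular_localization hK (irrelevantIdeal 𝒜) (X_ne_zero (R := k))
    rwa [aeval_X] at this
  have htm : algebraMap F R t ∈ maximalIdeal R := by
    rw [IsLocalization.AtPrime.to_map_mem_maximal_iff R (irrelevantIdeal 𝒜)]
    exact H.mem_irrelevantIdeal
  have hkill {x : F} (hx : ∀ z ∈ irrelevantIdeal 𝒜, ∃ x', z * x = t * x') :
      ∀ z ∈ maximalIdeal R, z * algebraMap F R x ∈ algebraMap F R t • (⊤ : Submodule R R) := by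
    intro z hz
    obtain ⟨⟨z₀, s⟩, hs⟩ := IsLocalization.surj (irrelevantIdeal 𝒜).primeCompl z
    dsimp only at hs
    have hz₀ : z₀ ∈ irrelevantIdeal 𝒜 := by
      rw [← IsLocalization.AtPrime.to_map_mem_maximal_iff R (irrelevantIdeal 𝒜), ← hs]
      exact Ideal.mul_mem_right _ _ hz
    obtain ⟨x', hx'⟩ := hx z₀ hz₀
    have hu := IsLocalization.map_units R s
    have h1 : algebraMap F R (z₀ * x) ∈ algebraMap F R t • (⊤ : Submodule R R) :=
      mem_smul_top_localization.mpr
        ⟨1, (Ideal.ne_top_iff_one _).mp hmax.ne_top, x', by rw [one_mul, hx']⟩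
    have h2 := Submodule.smul_mem _ (↑hu.unit⁻¹ : R) h1
    rw [map_mul, ← hs, smul_eq_mul, mul_right_comm z, ← mul_assoc,
      mul_comm (↑hu.unit⁻¹ : R), mul_assoc (z * _), IsUnit.val_inv_mul, mul_one] at h2
    exact h2
  have hw : algebraMap F R d ∉ algebraMap F R t • (⊤ : Submodule R R) := by
    rw [mem_smul_top_localization]
    rintro ⟨b, hb, x, hx⟩
    obtain ⟨z, hz, h⟩ := H.exists_eq_mul_of_notMem_mul hb hd hx
    exact hdt z hz h
  obtain ⟨c, hc⟩ := exists_sub_mul_mem_of_hasInjectiveDimensionLE_one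
    (hasInjectiveDimensionLE_one_of_isSMulRegular hl hreg hw (hkill hmd)) hreg htm hw
    (hkill hmd) (hkill hmy)
  obtain ⟨⟨f, s⟩, hs⟩ := IsLocalization.surj (irrelevantIdeal 𝒜).primeCompl c
  dsimp only at hs
  have h1 : algebraMap F R (s * y - f * d) ∈ algebraMap F R t • (⊤ : Submodule R R) := by
    have := Submodule.smul_mem _ (algebraMap F R s) hc
    rw [smul_eq_mul, mul_sub, ← mul_assoc, mul_comm _ c, hs, ← map_mul, ← map_mul, ← map_sub]
      at this
    exact this
  obtain ⟨b, hb, x, hx⟩ := mem_smul_top_localization.mp h1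
  have hbs : b * s ∉ irrelevantIdeal 𝒜 := hmax.isPrime.mul_notMem hb s.2
  obtain ⟨e, he, h0⟩ := H.exists_coe_decompose_zero hbs
  have h2 : (b * s - algebraMap k F e) ∈ irrelevantIdeal 𝒜 := by
    change ((DirectSum.decompose 𝒜 (b * s - algebraMap k F e) 0 : 𝒜 0) : F) = 0
    rw [DirectSum.decompose_sub, DirectSum.sub_apply, Submodule.coe_sub, h0,
      DirectSum.decompose_of_mem_same _ (SetLike.algebraMap_mem_graded 𝒜 e), sub_self]
  obtain ⟨x', hx'⟩ := hmy _ h2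
  refine ⟨algebraMap k F e⁻¹ * (b * f), algebraMap k F e⁻¹ * (x - x'), ?_⟩
  have h3 : algebraMap k F e⁻¹ * algebraMap k F e = 1 := by
    rw [← map_mul, inv_mul_cancel₀ he, map_one]
  linear_combination (-y) * h3 + algebraMap k F e⁻¹ * hx - algebraMap k F e⁻¹ * hx'

theorem exists_mul_eq_of_two (H : IsFiberLike 𝒜 t) {y z : F} (hy : y ∈ 𝒜 2)
    (hz : z ∈ irrelevantIdeal 𝒜) : ∃ x, z * y = t * x := by
  classical
  change t ∣ z * y
  rw [← DirectSum.sum_support_decompose 𝒜 z, Finset.sum_mul]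
  refine Finset.dvd_sum fun n _ ↦ ?_
  rcases n with _ | n
  · have h0 : ((DirectSum.decompose 𝒜 z 0 : 𝒜 0) : F) = 0 := hz
    rw [h0, zero_mul]
    exact dvd_zero _
  · have h1 : (DirectSum.decompose 𝒜 z (n + 1) : F) * y ∈ 𝒜 (n + 1 + 2) :=
      SetLike.mul_mem_graded (SetLike.coe_mem _) hy
    obtain ⟨x, -, hx⟩ := H.exists_eq_mul (n + 2) (by omega) _
      (by rwa [show n + 1 + 2 = n + 2 + 1 by omega] at h1)
    exact ⟨x, hx⟩

theorem exists_mul_eq_of_one (H : IsFiberLike 𝒜 t) {y z : F} (hy : y ∈ 𝒜 1)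
    (hyt : ∀ x ∈ 𝒜 1, ∃ x' ∈ 𝒜 1, y * x = t * x')
    (hz : z ∈ irrelevantIdeal 𝒜) : ∃ x, z * y = t * x := by
  classical
  change t ∣ z * y
  rw [← DirectSum.sum_support_decompose 𝒜 z, Finset.sum_mul]
  refine Finset.dvd_sum fun n _ ↦ ?_
  rcases n with _ | _ | n
  · have h0 : ((DirectSum.decompose 𝒜 z 0 : 𝒜 0) : F) = 0 := hz
    rw [h0, zero_mul]
    exact dvd_zero _
  · obtain ⟨x, -, hx⟩ := hyt _ (SetLike.coe_mem (DirectSum.decompose 𝒜 z 1))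
    exact ⟨x, by rw [← hx, mul_comm]⟩
  · have h1 : (DirectSum.decompose 𝒜 z (n + 1 + 1) : F) * y ∈ 𝒜 (n + 1 + 1 + 1) :=
      SetLike.mul_mem_graded (SetLike.coe_mem _) hy
    obtain ⟨x, -, hx⟩ := H.exists_eq_mul (n + 2) (by omega) _ h1
    exact ⟨x, hx⟩

theorem exists_eq_smul_add_of_isGorenstein (H : IsFiberLike 𝒜 t) (hG : IsGorenstein F) {d y : F}
    (hd : d ∈ 𝒜 2) (hdt : ∀ x ∈ 𝒜 1, d ≠ t * x) (hy : y ∈ 𝒜 2) :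
    ∃ (a : k) (x : F), x ∈ 𝒜 1 ∧ y = a • d + t * x := by
  obtain ⟨f, x, h⟩ := H.exists_mul_eq_of_isGorenstein hG hd hdt
    (fun z hz ↦ H.exists_mul_eq_of_two hd hz) (fun z hz ↦ H.exists_mul_eq_of_two hy hz)
  have h1 := DirectSum.decompose_of_mem_same 𝒜 hy
  rw [h, DirectSum.decompose_add, DirectSum.add_apply, Submodule.coe_add,
    DirectSum.coe_decompose_mul_of_right_mem 𝒜 2 hd, if_pos le_rfl, H.decompose_mul_self] at h1
  obtain ⟨a, ha⟩ := H.exists_eq_algebraMap _ (SetLike.coe_mem (DirectSum.decompose 𝒜 f 0))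
  rw [Nat.sub_self, ha, ← Algebra.smul_def, ← h] at h1
  exact ⟨a, _, SetLike.coe_mem _, h1.symm⟩

theorem exists_eq_smul_of_isGorenstein (H : IsFiberLike 𝒜 t) (hG : IsGorenstein F) {d y : F}
    (hd : d ∈ 𝒜 2) (hdt : ∀ x ∈ 𝒜 1, d ≠ t * x) (hy : y ∈ 𝒜 1)
    (hyt : ∀ x ∈ 𝒜 1, ∃ x' ∈ 𝒜 1, y * x = t * x') : ∃ a : k, y = a • t := by
  obtain ⟨f, x, h⟩ := H.exists_mul_eq_of_isGorenstein hG hd hdt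
    (fun z hz ↦ H.exists_mul_eq_of_two hd hz) (fun z hz ↦ H.exists_mul_eq_of_one hy hyt hz)
  have h1 := DirectSum.decompose_of_mem_same 𝒜 hy
  rw [h, DirectSum.decompose_add, DirectSum.add_apply, Submodule.coe_add,
    DirectSum.coe_decompose_mul_of_right_mem 𝒜 1 hd, if_neg (by omega), zero_add,
    H.decompose_mul_self, ← h] at h1
  obtain ⟨a, ha⟩ := H.exists_eq_algebraMap _ (SetLike.coe_mem (DirectSum.decompose 𝒜 x 0))
  exact ⟨a, by rw [← h1, ha, Algebra.smul_def, mul_comm]⟩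

end IsFiberLike

end FiberLikeGorenstein

section FiberLikeGorensteinCriterion

open Polynomial

universe u

variable {k F : Type u} [Field k] [CommRing F] [Algebra k F] {𝒜 : ℕ → Submodule k F}
  [GradedAlgebra 𝒜] {t : F}

namespace IsFiberLike

theorem isGorenstein_of_frame (H : IsFiberLike 𝒜 t) {p : ℕ} (B : FiberFrame 𝒜 t p 1 0)
    (hsoc : ∀ x ∈ 𝒜 1, (∀ y ∈ 𝒜 1, ∃ z ∈ 𝒜 1, x * y = t * z) → ∃ a : k, x = a • t) :
    IsGorenstein F := by
  let _ : Algebra k[X] F := (aeval t).toRingHom.toAlgebra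
  have halg (g : k[X]) : algebraMap k[X] F g = aeval t g := rfl
  have : IsScalarTower k k[X] F := IsScalarTower.of_algebraMap_eq fun a ↦ by
    rw [halg]; simp
  have hτ : algebraMap k[X] F ((AlgEquiv.refl : k[X] ≃ₐ[k] k[X]) X) = t := by
    rw [halg]; simp
  have hC (a : k) (x : F) : C a • x = a • x := by
    rw [Algebra.smul_def, halg, aeval_C, ← Algebra.smul_def]
  have hX (x : F) : (X : k[X]) • x = t * x := by
    rw [Algebra.smul_def, halg, aeval_X]
  let e := B.equiv H hτ
  have hrep (x : F) : ∃ (r : k[X]) (s : Fin p → k[X]) (v : k[X]),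
      x = r • 1 + ∑ i, s i • B.c i + v • B.d 0 := by
    obtain ⟨⟨r, s, v, z⟩, rfl⟩ := (B.hom_bijective H hτ).2 x
    refine ⟨r, s, v 0, ?_⟩
    have h := B.hom_apply hτ r s v (fun l ↦ l.elim0)
    rw [Subsingleton.elim (fun l : Fin 0 ↦ (Ideal.Quotient.mk _ (l.elim0 : k[X]))) z] at h
    simpa [add_assoc] using h
  let θ : F →ₗ[k[X]] k[X] := LinearMap.proj 0 ∘ₗ LinearMap.fst _ _ _ ∘ₗ LinearMap.snd _ _ _ ∘ₗ
    LinearMap.snd _ _ _ ∘ₗ e.toLinearMap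
  have hθ (r : k[X]) (s : Fin p → k[X]) (v : k[X]) :
      θ (r • 1 + ∑ i, s i • B.c i + v • B.d 0) = v := by
    have h := B.hom_apply hτ r s (fun _ ↦ v) (fun l ↦ l.elim0)
    have h2 : r • 1 + ∑ i, s i • B.c i + v • B.d 0 = B.hom hτ (r, s, fun _ ↦ v, fun l ↦
        Ideal.Quotient.mk _ (l.elim0 : k[X])) := by
      rw [h]; simp [add_assoc]
    rw [h2]
    change (B.equiv H hτ _).2.2.1 0 = v
    rw [B.equiv_hom]
  have hθ1 : θ 1 = 0 := by simpa using hθ 1 0 0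
  have hθc (i) : θ (B.c i) = 0 := by
    have := hθ 0 (Pi.single i 1) 0
    simpa [Pi.single_apply, ite_smul] using this
  have hθd : θ (B.d 0) = 1 := by simpa using hθ 0 0 1
  have htwo (x : F) (hx : x ∈ 𝒜 2) : ∃ (a : k) (z : F), z ∈ 𝒜 1 ∧ x = a • B.d 0 + t * z ∧
      θ x = C a := by
    obtain ⟨a, u, v, rfl⟩ := B.span_two x hx
    refine ⟨v 0, a • t + ∑ i, u i • B.c i, add_mem (Submodule.smul_mem _ _ H.mem)
      (sum_mem fun i _ ↦ Submodule.smul_mem _ _ (B.c_mem i)), ?_, ?_⟩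
    · simp only [Fin.sum_univ_one, mul_add, Finset.mul_sum, mul_smul_comm]
      ring
    · rw [← hθ (C a * X * X) (fun i ↦ C (u i) * X) (C (v 0))]
      congr 1
      simp only [Fin.sum_univ_one, mul_smul, hC, hX, mul_one]
  choose g zg hg hcc hθcc using fun i j ↦ htwo (B.c i * B.c j)
    (SetLike.mul_mem_graded (B.c_mem i) (B.c_mem j))
  let G : Matrix (Fin p) (Fin p) k := Matrix.of g
  have hdet : G.det ≠ 0 := by
    intro h0
    obtain ⟨v, hv0, hv⟩ := Matrix.exists_vecMul_eq_zero_iff.mpr h0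
    obtain ⟨a, ha⟩ := hsoc (∑ i, v i • B.c i)
      (sum_mem fun i _ ↦ Submodule.smul_mem _ _ (B.c_mem i)) (by
        have hj (j : Fin p) : ∃ z ∈ 𝒜 1, (∑ i, v i • B.c i) * B.c j = t * z := by
          refine ⟨∑ i, v i • zg i j, sum_mem fun i _ ↦ Submodule.smul_mem _ _ (hg i j), ?_⟩
          simp only [Finset.sum_mul, smul_mul_assoc, hcc, smul_add, Finset.sum_add_distrib,
            smul_smul, ← Finset.sum_smul, Finset.mul_sum, mul_smul_comm]
          have : ∑ i, v i * g i j = 0 := congrFun hv j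
          rw [this, zero_smul, zero_add]
        choose zc hzc hzc' using hj
        intro y hy
        obtain ⟨α, u, y', rfl⟩ := B.span_one y hy
        refine ⟨α • (∑ i, v i • B.c i) + ∑ j, u j • zc j,
          add_mem (Submodule.smul_mem _ _ (sum_mem fun i _ ↦ Submodule.smul_mem _ _ (B.c_mem i)))
          (sum_mem fun i _ ↦ Submodule.smul_mem _ _ (hzc i)), ?_⟩
        rw [Fin.sum_univ_zero, add_zero, mul_add, mul_add, Finset.mul_sum (f := fun j ↦ u j • B.c j),
          Finset.mul_sum (f := fun j ↦ u j • zc j)]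
        simp only [mul_smul_comm, hzc', mul_comm t (∑ i, v i • B.c i)])
    refine hv0 ((B.indep_one (-a) v 0 ?_).2.1)
    rw [ha]
    simp
  let GS : Matrix (Fin p) (Fin p) k[X] := G.map C
  have hGS : IsUnit GS.det := by
    have : GS.det = C G.det := (RingHom.map_det C G).symm
    rw [this]
    exact (isUnit_iff_ne_zero.mpr hdet).map C
  have hGS' (s : Fin p → k[X]) (j : Fin p) :
      ∑ i, s i * θ (B.c i * B.c j) = (Matrix.vecMul s GS) j := by
    simp only [hθcc]; rfl
  have hval (r : k[X]) (s : Fin p → k[X]) (v : k[X]) (y : F) :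
      θ ((r • 1 + ∑ i, s i • B.c i + v • B.d 0) * y) =
        r * θ y + ∑ i, s i * θ (B.c i * y) + v * θ (B.d 0 * y) := by
    simp only [add_mul, Finset.sum_mul, smul_mul_assoc, one_mul, map_add, map_sum, map_smul,
      smul_eq_mul]
  have hbij : Function.Bijective fun x : F ↦ θ ∘ₗ LinearMap.mulLeft k[X] x := by
    constructor
    · intro x x' hxx
      have hsub : ∀ y, θ ((x - x') * y) = 0 := fun y ↦ by
        rw [sub_mul, map_sub, sub_eq_zero]
        exact LinearMap.congr_fun hxx y
      rw [← sub_eq_zero]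
      generalize x - x' = w at hsub
      obtain ⟨r, s, v, rfl⟩ := hrep w
      have hv : v = 0 := by simpa [hval, hθ1, hθc, hθd] using hsub 1
      subst hv
      have hs : s = 0 := by
        have h1 : Matrix.vecMul s GS = 0 := by
          funext j
          rw [← hGS']
          have h := hsub (B.c j)
          rw [hval] at h
          simpa [hθc] using h
        have h2 := congrArg (fun w ↦ Matrix.vecMul w GS⁻¹) h1
        simpa [Matrix.vecMul_vecMul, Matrix.mul_nonsing_inv _ hGS] using h2
      subst hs
      have hr : r = 0 := by
        have h := hsub (B.d 0)
        rw [hval] at h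
        simpa [hθd] using h
      subst hr
      simp
    · intro ψ
      let v := ψ 1
      let b : Fin p → k[X] := fun j ↦ ψ (B.c j) - v * θ (B.d 0 * B.c j)
      let s := Matrix.vecMul b GS⁻¹
      have hs : Matrix.vecMul s GS = b := by
        simp [s, Matrix.vecMul_vecMul, Matrix.nonsing_inv_mul _ hGS]
      let r := ψ (B.d 0) - ∑ i, s i * θ (B.c i * B.d 0) - v * θ (B.d 0 * B.d 0)
      refine ⟨r • 1 + ∑ i, s i • B.c i + v • B.d 0, LinearMap.ext fun y ↦ ?_⟩
      obtain ⟨r', s', v', rfl⟩ := hrep y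
      have h1 : (θ ∘ₗ LinearMap.mulLeft k[X] (r • 1 + ∑ i, s i • B.c i + v • B.d 0)) 1 = ψ 1 := by
        change θ (_ * 1) = _
        rw [hval]
        simp [hθ1, hθc, hθd, v]
      have h2 (j) : (θ ∘ₗ LinearMap.mulLeft k[X] (r • 1 + ∑ i, s i • B.c i + v • B.d 0)) (B.c j) =
          ψ (B.c j) := by
        change θ (_ * B.c j) = _
        rw [hval, hGS', hs, hθc]
        simp [b]
      have h3 : (θ ∘ₗ LinearMap.mulLeft k[X] (r • 1 + ∑ i, s i • B.c i + v • B.d 0)) (B.d 0) =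
          ψ (B.d 0) := by
        change θ (_ * B.d 0) = _
        rw [hval, hθd]
        simp only [r]
        ring
      simp only [map_add, map_sum, map_smul] at h1 h2 h3 ⊢
      simp only [h1, h2, h3]
  have : Module.Free k[X] F := by
    have : Module.Free k[X] (Fin 0 → k[X] ⧸ Ideal.span
        {(AlgEquiv.refl : k[X] ≃ₐ[k] k[X]) X}) := Module.Free.of_subsingleton _ _
    exact Module.Free.of_equiv e.symm
  have := hasInjectiveDimensionLE_one_of_bijective_trace θ hbij
  have := H.isNoetherianRing
  exact isGorenstein_of_hasInjectiveDimensionLE 1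

theorem isGorenstein (H : IsFiberLike 𝒜 t) (hK : torsionOne 𝒜 t = ⊥)
    (hrank : Module.finrank k (𝒜 2) = Module.finrank k (𝒜 1) + 1)
    (hsoc : ∀ x ∈ 𝒜 1, (∀ y ∈ 𝒜 1, ∃ z ∈ 𝒜 1, x * y = t * z) → ∃ a : k, x = a • t) :
    IsGorenstein F := by
  obtain ⟨p, q, h1, h2, ⟨B⟩⟩ := H.exists_frame
  have h0 : Module.finrank k (torsionOne 𝒜 t) = 0 := by rw [hK, finrank_bot]
  rw [h0] at B h1
  obtain rfl : q = 1 := by omega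
  exact H.isGorenstein_of_frame B hsoc

end IsFiberLike

end FiberLikeGorensteinCriterion

section FiberConeGrading

open Polynomial

universe u

variable {A : Type u} [CommRing A] (I : Ideal A)

/-- The homogeneous element `c tⁿ` of the Rees algebra. -/
noncomputable def reesMonomial (n : ℕ) : ↥(I ^ n) →ₗ[A] reesAlgebra I :=
  LinearMap.codRestrict (Subalgebra.toSubmodule (reesAlgebra I))
    ((monomial n : A →ₗ[A] A[X]) ∘ₗ (I ^ n).subtype)
    fun c ↦ reesAlgebra.monomial_mem.mpr c.2

theorem coe_reesMonomial (n : ℕ) (c : ↥(I ^ n)) : (reesMonomial I n c : A[X]) = monomial n (c : A) :=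
  rfl

theorem reesMonomial_mul (n m : ℕ) (c : ↥(I ^ n)) (d : ↥(I ^ m)) :
    reesMonomial I n c * reesMonomial I m d =
      reesMonomial I (n + m) ⟨c * d, by rw [pow_add]; exact Ideal.mul_mem_mul c.2 d.2⟩ :=
  Subtype.ext (monomial_mul_monomial n m (c : A) (d : A))

theorem sum_reesMonomial (f : reesAlgebra I) :
    ∑ n ∈ (f : A[X]).support, reesMonomial I n ⟨(f : A[X]).coeff n, f.2 n⟩ = f := by
  apply Subtype.ext
  rw [AddSubmonoidClass.coe_finsetSum]
  exact ((f : A[X]).as_sum_support).symm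

variable [IsLocalRing A]

theorem reesMonomial_mem_map {n : ℕ} (c : ↥(I ^ n)) (hc : (c : A) ∈ maximalIdeal A * I ^ n) :
    reesMonomial I n c ∈ (maximalIdeal A).map (algebraMap A (reesAlgebra I)) := by
  obtain ⟨c, hcI⟩ := c
  dsimp only at hc
  induction hc using Submodule.mul_induction_on' with
  | mem_mul_mem x hx y hy =>
    have : reesMonomial I n ⟨x * y, hcI⟩ =
        algebraMap A (reesAlgebra I) x * reesMonomial I n ⟨y, hy⟩ := by
      rw [← Algebra.smul_def, ← map_smul]; rfl
    rw [this]
    exact Ideal.mul_mem_right _ _ (Ideal.mem_map_of_mem _ hx)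
  | add x hx y hy ihx ihy =>
    have h := add_mem (ihx (Ideal.mul_le_right hx)) (ihy (Ideal.mul_le_right hy))
    rw [← map_add] at h
    exact h

theorem mem_map_maximalIdeal_reesAlgebra {f : reesAlgebra I} :
    f ∈ (maximalIdeal A).map (algebraMap A (reesAlgebra I)) ↔
      ∀ n, (f : A[X]).coeff n ∈ maximalIdeal A * I ^ n := by
  constructor
  · intro hf
    refine Submodule.span_induction
      (p := fun (f : reesAlgebra I) _ ↦ ∀ n, (f : A[X]).coeff n ∈ maximalIdeal A * I ^ n) ?_ ?_ ?_ ?_ hf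
    · rintro _ ⟨a, ha, rfl⟩ n
      change (C a).coeff n ∈ _
      rw [coeff_C]
      split_ifs with h
      · subst h; simpa using ha
      · exact zero_mem _
    · intro n; simp
    · intro x y _ _ hx hy n
      rw [Subalgebra.coe_add, coeff_add]
      exact add_mem (hx n) (hy n)
    · intro g x _ hx n
      rw [smul_eq_mul, Subalgebra.coe_mul, coeff_mul]
      refine sum_mem fun ij hij ↦ ?_
      rw [← Finset.HasAntidiagonal.mem_antidiagonal.mp hij, pow_add, mul_left_comm]
      exact Ideal.mul_mem_mul (g.2 _) (hx _)
  · intro h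
    rw [← sum_reesMonomial I f]
    exact sum_mem fun n _ ↦ reesMonomial_mem_map I _ (h n)

/-- The homogeneous element of degree `n` of the fiber cone given by an element of `Iⁿ`. -/
noncomputable def fiberMonomial (n : ℕ) : ↥(I ^ n) →ₗ[A] FiberCone I :=
  (fiberMk I).toLinearMap ∘ₗ reesMonomial I n

theorem fiberMonomial_eq_zero_iff {n : ℕ} {c : ↥(I ^ n)} :
    fiberMonomial I n c = 0 ↔ (c : A) ∈ maximalIdeal A * I ^ n := by
  change Ideal.Quotient.mk _ (reesMonomial I n c) = 0 ↔ _
  rw [Ideal.Quotient.eq_zero_iff_mem]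
  refine ⟨fun h ↦ ?_, reesMonomial_mem_map I c⟩
  have := (mem_map_maximalIdeal_reesAlgebra I).mp h n
  rwa [coe_reesMonomial, coeff_monomial, if_pos rfl] at this

theorem fiberMonomial_mul (n m : ℕ) (c : ↥(I ^ n)) (d : ↥(I ^ m)) :
    fiberMonomial I n c * fiberMonomial I m d =
      fiberMonomial I (n + m) ⟨c * d, by rw [pow_add]; exact Ideal.mul_mem_mul c.2 d.2⟩ := by
  change fiberMk I _ * fiberMk I _ = fiberMk I _
  rw [← map_mul, reesMonomial_mul]

theorem fiberMonomial_zero (c : ↥(I ^ 0)) :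
    fiberMonomial I 0 c = algebraMap A (FiberCone I) c := by
  have : reesMonomial I 0 c = algebraMap A (reesAlgebra I) c := Subtype.ext rfl
  change fiberMk I (reesMonomial I 0 c) = _
  rw [this, AlgHom.commutes]

theorem fiberMonomial_congr {n m : ℕ} (h : n = m) {c : A} (hc : c ∈ I ^ n) (hd : c ∈ I ^ m) :
    fiberMonomial I n ⟨c, hc⟩ = fiberMonomial I m ⟨c, hd⟩ := by
  subst h; rfl

theorem mem_fiberPiece {n : ℕ} {x : FiberCone I} :
    x ∈ fiberPiece I n ↔ ∃ c : ↥(I ^ n), fiberMonomial I n c = x := by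
  constructor
  · rintro ⟨f, ⟨a, ha⟩, rfl⟩
    have hf : (f : A[X]) = monomial n a := ha.symm
    have hmem : a ∈ I ^ n := reesAlgebra.monomial_mem.mp (hf ▸ f.2)
    exact ⟨⟨a, hmem⟩, congrArg (fiberMk I) (Subtype.ext hf.symm)⟩
  · rintro ⟨c, rfl⟩
    exact ⟨reesMonomial I n c, ⟨c, rfl⟩, rfl⟩

theorem fiberMk_surjective : Function.Surjective (fiberMk I) := Ideal.Quotient.mk_surjective

noncomputable instance FiberCone.algebraResidueField : Algebra (ResidueField A) (FiberCone I) :=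
  (Ideal.Quotient.lift (maximalIdeal A) (algebraMap A (FiberCone I)) fun a ha ↦ by
    change fiberMk I (algebraMap A (reesAlgebra I) a) = 0
    exact Ideal.Quotient.eq_zero_iff_mem.mpr (Ideal.mem_map_of_mem _ ha)).toAlgebra

instance : IsScalarTower A (ResidueField A) (FiberCone I) :=
  IsScalarTower.of_algebraMap_eq fun _ ↦ rfl

theorem residue_smul (a : A) (x : FiberCone I) : residue A a • x = a • x :=
  algebraMap_smul (ResidueField A) a x

/-- The components of the fiber cone, as vector spaces over the residue field. -/
noncomputable def fiberGrading (n : ℕ) : Submodule (ResidueField A) (FiberCone I) where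
  __ := (fiberPiece I n).toAddSubmonoid
  smul_mem' a x hx := by
    obtain ⟨a, rfl⟩ := residue_surjective a
    rw [residue_smul]
    exact (fiberPiece I n).smul_mem a hx

theorem mem_fiberGrading {n : ℕ} {x : FiberCone I} :
    x ∈ fiberGrading I n ↔ ∃ c : ↥(I ^ n), fiberMonomial I n c = x := mem_fiberPiece I

theorem fiberMonomial_mem (n : ℕ) (c : ↥(I ^ n)) : fiberMonomial I n c ∈ fiberGrading I n :=
  (mem_fiberGrading I).mpr ⟨c, rfl⟩

instance : SetLike.GradedMonoid (fiberGrading I) where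
  one_mem := (mem_fiberGrading I).mpr ⟨⟨1, by simp⟩, by rw [fiberMonomial_zero, map_one]⟩
  mul_mem i j x y hx hy := by
    obtain ⟨c, rfl⟩ := (mem_fiberGrading I).mp hx
    obtain ⟨d, rfl⟩ := (mem_fiberGrading I).mp hy
    rw [fiberMonomial_mul]
    exact fiberMonomial_mem I _ _

theorem sum_fiberMonomial_eq_zero {s : Finset ℕ} {c : ∀ n, ↥(I ^ n)}
    (h : ∑ n ∈ s, fiberMonomial I n (c n) = 0) {n : ℕ} (hn : n ∈ s) :
    fiberMonomial I n (c n) = 0 := by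
  have h1 : fiberMk I (∑ n ∈ s, reesMonomial I n (c n)) = 0 := by rw [map_sum]; exact h
  have h2 := (mem_map_maximalIdeal_reesAlgebra I).mp (Ideal.Quotient.eq_zero_iff_mem.mp h1) n
  rw [AddSubmonoidClass.coe_finsetSum, finsetSum_coeff, Finset.sum_eq_single n] at h2
  · rw [coe_reesMonomial, coeff_monomial, if_pos rfl] at h2
    exact (fiberMonomial_eq_zero_iff I).mpr h2
  · intro m _ hm
    rw [coe_reesMonomial, coeff_monomial, if_neg hm]
  · exact fun h ↦ absurd hn h

theorem isInternal_fiberGrading : DirectSum.IsInternal (fiberGrading I) := by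
  classical
  constructor
  · rw [injective_iff_map_eq_zero]
    intro x hx
    choose c hc using fun n ↦ (mem_fiberGrading I).mp (x n).2
    rw [DirectSum.coeAddMonoidHom_eq_dfinsuppSum, DFinsupp.sum] at hx
    simp only [← hc] at hx
    ext n
    by_cases hn : n ∈ x.support
    · rw [← hc, sum_fiberMonomial_eq_zero I hx hn]; rfl
    · rw [DFinsupp.notMem_support_iff.mp hn]; rfl
  · intro x
    obtain ⟨f, rfl⟩ := fiberMk_surjective I x
    refine ⟨∑ n ∈ (f : A[X]).support, DirectSum.of (fun n ↦ fiberGrading I n) n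
      ⟨_, fiberMonomial_mem I n ⟨(f : A[X]).coeff n, f.2 n⟩⟩, ?_⟩
    conv_rhs => rw [← sum_reesMonomial I f]
    rw [map_sum, map_sum]
    exact Finset.sum_congr rfl fun n _ ↦ DirectSum.coeAddMonoidHom_of _ _ _

noncomputable instance : GradedAlgebra (fiberGrading I) :=
  { (isInternal_fiberGrading I).chooseDecomposition with }

variable {I}

theorem range_fiberMonomial (n : ℕ) :
    LinearMap.range (fiberMonomial I n) = (fiberGrading I n).restrictScalars A := by
  ext x
  exact (mem_fiberGrading I).symm

theorem ker_fiberMonomial (n : ℕ) :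
    LinearMap.ker (fiberMonomial I n) = maximalIdeal A • (⊤ : Submodule A ↥(I ^ n)) := by
  ext c
  rw [LinearMap.mem_ker, fiberMonomial_eq_zero_iff, ← smul_eq_mul, Submodule.mem_smul_top_iff]

theorem finite_fiberGrading [IsNoetherianRing A] (n : ℕ) :
    Module.Finite (ResidueField A) (fiberGrading I n) := by
  have : Module.Finite A ((fiberGrading I n).restrictScalars A) := by
    rw [← range_fiberMonomial]; infer_instance
  have : Module.Finite A (fiberGrading I n) := this
  exact Module.Finite.of_restrictScalars_finite A _ _

theorem finrank_fiberGrading [IsNoetherianRing A] (n : ℕ) :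
    Module.finrank (ResidueField A) (fiberGrading I n) = (I ^ n).spanFinrank := by
  rw [spanFinrank_eq_finrank_quotient _ (IsNoetherian.noetherian (I ^ n))]
  let _ : Module (ResidueField A) (↥(I ^ n) ⧸ maximalIdeal A • (⊤ : Submodule A ↥(I ^ n))) :=
    inferInstanceAs (Module (A ⧸ maximalIdeal A) _)
  have : IsScalarTower A (ResidueField A)
      (↥(I ^ n) ⧸ maximalIdeal A • (⊤ : Submodule A ↥(I ^ n))) :=
    inferInstanceAs (IsScalarTower A (A ⧸ maximalIdeal A) _)
  let e : (↥(I ^ n) ⧸ maximalIdeal A • (⊤ : Submodule A ↥(I ^ n))) ≃ₗ[A] fiberGrading I n :=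
    (Submodule.quotEquivOfEq _ _ (ker_fiberMonomial n).symm).trans
      ((fiberMonomial I n).quotKerEquivRange.trans (LinearEquiv.ofEq _ _ (range_fiberMonomial n)))
  exact ((e.extendScalarsOfSurjective (S := ResidueField A) residue_surjective).finrank_eq).symm

/-- Lengths of subquotients that are vector spaces over the residue field. -/
theorem lengthQuot_eq_finrank {N L : Ideal A} {V : Type*} [AddCommGroup V] [Module A V]
    [Module (ResidueField A) V] [IsScalarTower A (ResidueField A) V]
    [Module.Finite (ResidueField A) V] (φ : N →ₗ[A] V) (hφ : Function.Surjective φ)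
    (hker : ∀ x : N, φ x = 0 ↔ (x : A) ∈ L) :
    lengthQuot N L = Module.finrank (ResidueField A) V := by
  have : L.submoduleOf N = LinearMap.ker φ := by
    ext x
    exact (hker x).symm
  rw [lengthQuot, this, (φ.quotKerEquivOfSurjective hφ).length_eq,
    Module.length_eq_of_surjective (R := ResidueField A) residue_surjective,
    Module.length_eq_finrank]

end FiberConeGrading

section PrincipalReductions

variable {A : Type*} [CommRing A] {I J K : Ideal A} {a b : A}

theorem Ideal.le_of_span_singleton_mul_le (ha : a ∈ nonZeroDivisors A)
    (h : Ideal.span {a} * J ≤ Ideal.span {a} * K) : J ≤ K := by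
  intro x hx
  obtain ⟨z, hz, hzx⟩ := Ideal.mem_span_singleton_mul.mp
    (h (Ideal.mem_span_singleton_mul.mpr ⟨x, hx, rfl⟩))
  rw [mul_cancel_left_mem_nonZeroDivisors ha] at hzx
  rwa [← hzx]

theorem Ideal.eq_of_span_singleton_mul_eq (ha : a ∈ nonZeroDivisors A)
    (h : Ideal.span {a} * J = Ideal.span {a} * K) : J = K :=
  le_antisymm (Ideal.le_of_span_singleton_mul_le ha h.le)
    (Ideal.le_of_span_singleton_mul_le ha h.ge)

theorem pow_succ_eq_mul_pow_of_le {n m : ℕ} (h : I ^ (n + 1) = J * I ^ n) (hnm : n ≤ m) :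
    I ^ (m + 1) = J * I ^ m := by
  obtain ⟨l, rfl⟩ := Nat.exists_eq_add_of_le hnm
  rw [show n + l + 1 = (n + 1) + l by omega, pow_add, h, pow_add, mul_assoc]

theorem pow_add_eq_pow_mul_pow {n : ℕ} (h : I ^ (n + 1) = J * I ^ n) (l : ℕ) :
    I ^ (n + l) = J ^ l * I ^ n := by
  induction l with
  | zero => simp
  | succ l ih =>
    rw [← add_assoc, pow_succ_eq_mul_pow_of_le h (Nat.le_add_right n l), ih, pow_succ', mul_assoc]

theorem mem_nonZeroDivisors_of_isReduction (hreg : ∃ x ∈ I, x ∈ nonZeroDivisors A)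
    (h : IsReduction (Ideal.span {a}) I) : a ∈ nonZeroDivisors A := by
  obtain ⟨x, hxI, hx⟩ := hreg
  obtain ⟨-, n, hn⟩ := h
  have h1 : x ^ (n + 1) ∈ Ideal.span {a} * I ^ n := hn ▸ Ideal.pow_mem_pow hxI _
  obtain ⟨z, -, hz⟩ := Ideal.mem_span_singleton_mul.mp h1
  have h2 : a * z ∈ nonZeroDivisors A := hz ▸ pow_mem hx _
  exact (mul_mem_nonZeroDivisors.mp h2).1

/-- The reduction number does not depend on the principal reduction. -/
theorem pow_succ_eq_mul_pow_of_isReduction {r : ℕ} (h : I ^ (r + 1) = Ideal.span {a} * I ^ r)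
    (ha : a ∈ nonZeroDivisors A) (hb : IsReduction (Ideal.span {b}) I) :
    I ^ (r + 1) = Ideal.span {b} * I ^ r := by
  obtain ⟨-, s, hs⟩ := hb
  have hs' := pow_succ_eq_mul_pow_of_le hs (Nat.le_add_left s r)
  have h1 := pow_add_eq_pow_mul_pow h s
  have h2 := pow_add_eq_pow_mul_pow (pow_succ_eq_mul_pow_of_le h (Nat.le_succ r)) s
  rw [show r.succ + s = r + s + 1 by omega, hs', h1, Ideal.span_singleton_pow, mul_left_comm] at h2
  exact (Ideal.eq_of_span_singleton_mul_eq (pow_mem ha s) h2).symm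

variable [IsLocalRing A] [IsNoetherianRing A]

theorem Ideal.le_of_le_sup_maximalIdeal_mul (h : J ≤ K ⊔ maximalIdeal A * J) : J ≤ K :=
  Submodule.le_of_le_smul_of_le_jacobson_bot (IsNoetherian.noetherian J)
    (maximalIdeal_le_jacobson _) h

theorem not_pow_le_maximalIdeal_mul_pow (hreg : ∃ x ∈ I, x ∈ nonZeroDivisors A) (n : ℕ) :
    ¬ I ^ n ≤ maximalIdeal A * I ^ n := by
  intro h
  have h1 : I ^ n ≤ ⊥ := Ideal.le_of_le_sup_maximalIdeal_mul (h.trans le_sup_right)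
  obtain ⟨x, hxI, hx⟩ := hreg
  have h2 : x ^ n = 0 := h1 (Ideal.pow_mem_pow hxI n)
  exact zero_notMem_nonZeroDivisors (h2 ▸ pow_mem hx n)

theorem pow_notMem_maximalIdeal_mul_pow (hreg : ∃ x ∈ I, x ∈ nonZeroDivisors A)
    (ha : IsReduction (Ideal.span {a}) I) (n : ℕ) : a ^ n ∉ maximalIdeal A * I ^ n := by
  intro h
  obtain ⟨-, s, hs⟩ := ha
  refine not_pow_le_maximalIdeal_mul_pow hreg (s + n) ?_
  have h1 := pow_add_eq_pow_mul_pow hs n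
  rw [Ideal.span_singleton_pow] at h1
  calc I ^ (s + n) = Ideal.span {a ^ n} * I ^ s := h1
    _ ≤ (maximalIdeal A * I ^ n) * I ^ s :=
      Ideal.mul_mono_left ((Ideal.span_singleton_le_iff_mem _).mpr h)
    _ = maximalIdeal A * I ^ (s + n) := by rw [mul_assoc, ← pow_add, add_comm]

theorem isMinimalReduction_span_singleton (hreg : ∃ x ∈ I, x ∈ nonZeroDivisors A)
    (ha : IsReduction (Ideal.span {a}) I) : IsMinimalReduction (Ideal.span {a}) I := by
  refine ⟨ha, fun K ⟨_, n, hn⟩ hKa ↦ le_antisymm hKa ?_⟩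
  have hnzd := mem_nonZeroDivisors_of_isReduction hreg ha
  obtain ⟨-, s, hs⟩ := ha
  let L : Ideal A := Submodule.comap (LinearMap.mulLeft A a) K
  have hL : K = Ideal.span {a} * L := by
    ext x
    rw [Ideal.mem_span_singleton_mul]
    constructor
    · intro hx
      obtain ⟨z, rfl⟩ := Ideal.mem_span_singleton'.mp (hKa hx)
      exact ⟨z, by rw [mul_comm] at hx; exact hx, mul_comm _ _⟩
    · rintro ⟨z, hz, rfl⟩
      exact hz
  by_cases h : L = ⊤
  · rw [hL, h, Ideal.mul_top]
  exfalso
  refine not_pow_le_maximalIdeal_mul_pow hreg (n + s) ?_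
  have h1 := pow_succ_eq_mul_pow_of_le hn (Nat.le_add_right n s)
  rw [pow_succ_eq_mul_pow_of_le hs (Nat.le_add_left s n), hL, mul_assoc] at h1
  calc I ^ (n + s) = L * I ^ (n + s) := Ideal.eq_of_span_singleton_mul_eq hnzd h1
    _ ≤ _ := Ideal.mul_mono_left (le_maximalIdeal h)

end PrincipalReductions

section ReductionExistence

universe u

variable {A : Type u} [CommRing A] {I J : Ideal A}

theorem pow_mem_pow_of_mem_pow_one {x : A} (hx : x ∈ I ^ 1) (m : ℕ) : x ^ m ∈ I ^ m :=
  Ideal.pow_mem_pow (by simpa using hx) m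

variable [IsLocalRing A]

instance [IsNoetherianRing A] : IsNoetherianRing (FiberCone I) :=
  isNoetherianRing_of_surjective _ _ (fiberMk I).toRingHom (fiberMk_surjective I)

theorem fiberGrading_zero_exists_eq {x : FiberCone I} (hx : x ∈ fiberGrading I 0) :
    ∃ c : ResidueField A, x = algebraMap (ResidueField A) (FiberCone I) c := by
  obtain ⟨c, rfl⟩ := (mem_fiberGrading I).mp hx
  exact ⟨residue A c, fiberMonomial_zero I c⟩

theorem le_irrelevantIdeal_of_isHomogeneous {P : Ideal (FiberCone I)}
    (hP : P.IsHomogeneous (fiberGrading I)) (hne : P ≠ ⊤) : P ≤ irrelevantIdeal (fiberGrading I) := by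
  intro x hx
  have h := hP 0 hx
  obtain ⟨c, hc⟩ := fiberGrading_zero_exists_eq
    (SetLike.coe_mem (DirectSum.decompose (fiberGrading I) x 0))
  change ((DirectSum.decompose (fiberGrading I) x 0 : fiberGrading I 0) : FiberCone I) = 0
  by_cases h0 : c = 0
  · rw [hc, h0, map_zero]
  · rw [hc] at h
    exact absurd (Ideal.eq_top_of_isUnit_mem _ h ((isUnit_iff_ne_zero.mpr h0).map _)) hne

theorem irrelevantIdeal_ne_top [Nontrivial (FiberCone I)] :
    irrelevantIdeal (fiberGrading I) ≠ ⊤ := by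
  rw [Ideal.ne_top_iff_one]
  intro h
  have h1 : ((DirectSum.decompose (fiberGrading I) (1 : FiberCone I) 0 : fiberGrading I 0) :
    FiberCone I) = 0 := h
  rw [DirectSum.decompose_of_mem_same _ SetLike.GradedOne.one_mem] at h1
  exact one_ne_zero h1

theorem fiberMonomial_mem_of_forall_one {P : Ideal (FiberCone I)}
    (h : ∀ x : ↥(I ^ 1), fiberMonomial I 1 x ∈ P) (n : ℕ) (c : ↥(I ^ (n + 1))) :
    fiberMonomial I (n + 1) c ∈ P ^ (n + 1) := by
  induction n with
  | zero => exact (pow_one P).ge (h c)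
  | succ n ih =>
    obtain ⟨c, hc⟩ := c
    have hc' := hc
    rw [pow_succ] at hc'
    induction hc' using Submodule.mul_induction_on' with
    | mem_mul_mem x hx y hy =>
      have hy' : y ∈ I ^ 1 := by rwa [pow_one]
      have := Ideal.mul_mem_mul (ih ⟨x, hx⟩) (h ⟨y, hy'⟩)
      rwa [fiberMonomial_mul, ← pow_succ] at this
    | add x hx y hy ihx ihy =>
      rw [← pow_succ] at hx hy
      have := add_mem (ihx hx) (ihy hy)
      rwa [← map_add] at this

theorem fiberMonomial_one_pow (x : ↥(I ^ 1)) (m : ℕ) :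
    fiberMonomial I 1 x ^ m = fiberMonomial I m ⟨(x : A) ^ m, pow_mem_pow_of_mem_pow_one x.2 m⟩ := by
  induction m with
  | zero => rw [pow_zero, fiberMonomial_zero]; simp
  | succ m ih =>
    rw [pow_succ, ih, fiberMonomial_mul]
    exact congrArg (fiberMonomial I (m + 1)) (Subtype.ext (pow_succ _ _).symm)

theorem irrelevantIdeal_le_of_forall_one {P : Ideal (FiberCone I)}
    (h : ∀ x : ↥(I ^ 1), fiberMonomial I 1 x ∈ P) : irrelevantIdeal (fiberGrading I) ≤ P := by
  refine (HomogeneousIdeal.toIdeal_irrelevant_le _).mpr ?_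
  intro n hn x hx
  obtain ⟨c, rfl⟩ := (mem_fiberGrading I).mp hx
  obtain ⟨n, rfl⟩ := Nat.exists_eq_succ_of_ne_zero hn.ne'
  exact Ideal.pow_le_self (Nat.succ_ne_zero n) (fiberMonomial_mem_of_forall_one h n c)

/-- A prime ideal that contains the initial forms of a reduction contains all elements of positive
degree. -/
theorem irrelevantIdeal_le_of_isReduction {P : Ideal (FiberCone I)} [hP : P.IsPrime]
    (hJ : IsReduction J I)
    (h : ∀ x (hx : x ∈ J), fiberMonomial I 1 ⟨x, by rw [pow_one]; exact hJ.1 hx⟩ ∈ P) :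
    irrelevantIdeal (fiberGrading I) ≤ P := by
  obtain ⟨hJI, n, hn⟩ := hJ
  have key : ∀ (c : A) (hc : c ∈ I ^ (n + 1)), fiberMonomial I (n + 1) ⟨c, hc⟩ ∈ P := by
    intro c hc
    have hc' := hc
    rw [hn] at hc'
    induction hc' using Submodule.mul_induction_on' with
    | mem_mul_mem x hx y hy =>
      have := Ideal.mul_mem_right (fiberMonomial I n ⟨y, hy⟩) _ (h x hx)
      rw [fiberMonomial_mul] at this
      rwa [fiberMonomial_congr I (add_comm n 1) _ _]
    | add x hx y hy ihx ihy =>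
      rw [← hn] at hx hy
      have := add_mem (ihx hx) (ihy hy)
      rwa [← map_add] at this
  refine irrelevantIdeal_le_of_forall_one fun x ↦ ?_
  refine hP.mem_of_pow_mem (n + 1) ?_
  rw [fiberMonomial_one_pow]
  exact key _ _

theorem decompose_fiberMonomial_one_mul (a : ↥(I ^ 1)) (x : FiberCone I) (n : ℕ) :
    (DirectSum.decompose (fiberGrading I) (fiberMonomial I 1 a * x) (n + 1) : FiberCone I) =
      fiberMonomial I 1 a * DirectSum.decompose (fiberGrading I) x n := by
  rw [DirectSum.coe_decompose_mul_of_left_mem (fiberGrading I) (n + 1) (fiberMonomial_mem I 1 a),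
    if_pos (by omega), Nat.add_sub_cancel]

theorem exists_fiberMonomial_notMem [Infinite (ResidueField A)] (hJ : IsReduction J I)
    (s : Finset (Ideal (FiberCone I)))
    (hs : ∀ P ∈ s, P.IsPrime ∧ ¬ irrelevantIdeal (fiberGrading I) ≤ P) :
    ∃ (a : A) (ha : a ∈ J), ∀ P ∈ s,
      fiberMonomial I 1 ⟨a, by rw [pow_one]; exact hJ.1 ha⟩ ∉ P := by
  classical
  let k := ResidueField A
  let E : Submodule k (FiberCone I) :=
    { carrier := {y | ∃ (x : A) (hx : x ∈ J),
        fiberMonomial I 1 ⟨x, by rw [pow_one]; exact hJ.1 hx⟩ = y}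
      zero_mem' := ⟨0, zero_mem _, map_zero _⟩
      add_mem' := by
        rintro _ _ ⟨x, hx, rfl⟩ ⟨y, hy, rfl⟩
        exact ⟨x + y, add_mem hx hy, map_add (fiberMonomial I 1)
          ⟨x, by rw [pow_one]; exact hJ.1 hx⟩ ⟨y, by rw [pow_one]; exact hJ.1 hy⟩⟩
      smul_mem' := by
        rintro a _ ⟨x, hx, rfl⟩
        obtain ⟨a, rfl⟩ := residue_surjective a
        refine ⟨a * x, J.mul_mem_left a hx, ?_⟩
        rw [residue_smul, ← map_smul]
        rfl }
  let S : Finset (Subspace k E) := s.image fun P ↦ (P.restrictScalars k).comap E.subtype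
  have htop : ⊤ ∉ S := by
    intro h
    obtain ⟨P, hP, hPt⟩ := Finset.mem_image.mp h
    have := (hs P hP).1
    refine (hs P hP).2 (irrelevantIdeal_le_of_isReduction hJ fun x hx ↦ ?_)
    have h1 : (⟨_, x, hx, rfl⟩ : E) ∈ (P.restrictScalars k).comap E.subtype := by
      rw [hPt]; exact Submodule.mem_top
    exact h1
  have h := Subspace.biUnion_ne_univ_of_top_notMem htop
  obtain ⟨⟨_, x, hx, rfl⟩, hy⟩ := (Set.ne_univ_iff_exists_notMem _).mp h
  refine ⟨x, hx, fun P hP hxP ↦ hy ?_⟩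
  rw [Set.mem_iUnion₂]
  exact ⟨_, Finset.mem_image_of_mem _ hP, hxP⟩

theorem irrelevantIdeal_le_radical_span (hdim : ringKrullDim (FiberCone I) = 1) {t : FiberCone I}
    (ht : t ∈ fiberGrading I 1)
    (h : ∀ P ∈ minimalPrimes (FiberCone I), ¬ irrelevantIdeal (fiberGrading I) ≤ P → t ∉ P) :
    irrelevantIdeal (fiberGrading I) ≤ (Ideal.span {t}).radical := by
  have hle : Ring.KrullDimLE 1 (FiberCone I) := Ring.krullDimLE_iff.mpr (by simp [hdim])
  have : Nontrivial (FiberCone I) := by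
    by_contra h0
    rw [not_nontrivial_iff_subsingleton] at h0
    rw [ringKrullDim_eq_bot_of_subsingleton] at hdim
    exact absurd hdim (by simp)
  rw [Ideal.radical_eq_sInf]
  refine le_sInf ?_
  rintro Q ⟨hQt, hQ⟩
  have hQ' : (Q.homogeneousCore (fiberGrading I)).toIdeal.IsPrime := hQ.homogeneousCore
  have htQ : t ∈ (Q.homogeneousCore (fiberGrading I)).toIdeal :=
    Ideal.mem_homogeneousCore_of_homogeneous_of_mem ⟨1, ht⟩ (hQt (Ideal.mem_span_singleton_self t))
  refine le_trans ?_ (Ideal.toIdeal_homogeneousCore_le (fiberGrading I) Q)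
  obtain ⟨P, hP, hPQ⟩ := Ideal.exists_minimalPrimes_le
    (bot_le (a := (Q.homogeneousCore (fiberGrading I)).toIdeal))
  by_cases hPi : irrelevantIdeal (fiberGrading I) ≤ P
  · exact hPi.trans hPQ
  · rcases Ring.krullDimLE_one_iff.mp hle _ hQ' with hmin | hmax
    · exact absurd (hmin.2 hP.1 hPQ htQ) (h P hP hPi)
    · exact (hmax.eq_of_le irrelevantIdeal_ne_top (le_irrelevantIdeal_of_isHomogeneous
        (Q.homogeneousCore (fiberGrading I)).isHomogeneous hQ'.ne_top)).ge

variable [IsNoetherianRing A]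

theorem isReduction_span_singleton_of_le_radical {a : A} (ha : a ∈ I)
    (h : irrelevantIdeal (fiberGrading I) ≤
      (Ideal.span {fiberMonomial I 1 ⟨a, by rwa [pow_one]⟩}).radical) :
    IsReduction (Ideal.span {a}) I := by
  refine ⟨(Ideal.span_singleton_le_iff_mem _).mpr ha, ?_⟩
  obtain ⟨N, hN⟩ := Ideal.exists_pow_le_of_le_radical_of_fg h (IsNoetherian.noetherian _)
  refine ⟨N, le_antisymm (Ideal.le_of_le_sup_maximalIdeal_mul ?_) ?_⟩
  · intro c hc
    have h1 : fiberMonomial I (N + 1) ⟨c, hc⟩ ∈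
        Ideal.span {fiberMonomial I 1 ⟨a, by rwa [pow_one]⟩} := by
      refine hN (Ideal.pow_le_pow_right N.le_succ (fiberMonomial_mem_of_forall_one (fun x ↦ ?_) N _))
      exact HomogeneousIdeal.mem_irrelevant_of_mem _ one_pos (fiberMonomial_mem I 1 x)
    obtain ⟨y, hy⟩ := Ideal.mem_span_singleton.mp h1
    have h2 := DirectSum.decompose_of_mem_same (fiberGrading I)
      (fiberMonomial_mem I (N + 1) ⟨c, hc⟩)
    rw [hy, decompose_fiberMonomial_one_mul] at h2
    obtain ⟨⟨e, he⟩, he'⟩ := (mem_fiberGrading I).mp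
      (SetLike.coe_mem (DirectSum.decompose (fiberGrading I) y N))
    have hae : a * e ∈ I ^ (N + 1) := by rw [pow_succ']; exact Ideal.mul_mem_mul ha he
    rw [← hy, ← he', fiberMonomial_mul, fiberMonomial_congr I (add_comm 1 N) _ hae, ← sub_eq_zero,
      ← map_sub, fiberMonomial_eq_zero_iff] at h2
    have h3 : c = a * e + -(a * e - c) := by ring
    rw [h3]
    exact Submodule.add_mem_sup (Ideal.mem_span_singleton_mul.mpr ⟨e, he, rfl⟩) (neg_mem h2)
  · rw [pow_succ']
    exact Ideal.mul_mono_left ((Ideal.span_singleton_le_iff_mem _).mpr ha)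

/-- Over an infinite residue field, every reduction of an ideal of analytic spread one contains a
principal reduction. -/
theorem exists_isReduction_span_singleton [Infinite (ResidueField A)]
    (hdim : ringKrullDim (FiberCone I) = 1) (hJ : IsReduction J I) :
    ∃ a ∈ J, IsReduction (Ideal.span {a}) I := by
  classical
  have hfin := minimalPrimes.finite_of_isNoetherianRing (FiberCone I)
  obtain ⟨a, ha, h⟩ := exists_fiberMonomial_notMem hJ
    (hfin.toFinset.filter fun P ↦ ¬ irrelevantIdeal (fiberGrading I) ≤ P) (by
      intro P hP
      rw [Finset.mem_filter, Set.Finite.mem_toFinset] at hP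
      exact ⟨hP.1.1.1, hP.2⟩)
  refine ⟨a, ha, isReduction_span_singleton_of_le_radical (hJ.1 ha)
    (irrelevantIdeal_le_radical_span hdim (fiberMonomial_mem I 1 _) fun P hP hPi ↦ h P ?_)⟩
  rw [Finset.mem_filter, Set.Finite.mem_toFinset]
  exact ⟨hP, hPi⟩

theorem exists_isReduction_and_forall [Infinite (ResidueField A)]
    (hreg : ∃ x ∈ I, x ∈ nonZeroDivisors A) (hdim : ringKrullDim (FiberCone I) = 1)
    (hred : reductionNumber I = 2) :
    (∃ a : A, IsReduction (Ideal.span {a}) I) ∧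
      ∀ a : A, IsReduction (Ideal.span {a}) I →
        I ^ 3 = Ideal.span {a} * I ^ 2 ∧ I ^ 2 ≠ Ideal.span {a} * I := by
  have hmem : 2 ∈ {r : ℕ | ∃ J : Ideal A, IsMinimalReduction J I ∧ reductionNumberWith J I = r} := by
    have hne : {r : ℕ | ∃ J : Ideal A, IsMinimalReduction J I ∧
        reductionNumberWith J I = r}.Nonempty := by
      by_contra h
      rw [Set.not_nonempty_iff_eq_empty] at h
      rw [reductionNumber, h, Nat.sInf_empty] at hred
      exact absurd hred (by omega)
    have := Nat.sInf_mem hne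
    rwa [show sInf {r : ℕ | ∃ J : Ideal A, IsMinimalReduction J I ∧
      reductionNumberWith J I = r} = 2 from hred] at this
  obtain ⟨J, hJ, hJ2⟩ := hmem
  obtain ⟨b, hbJ, hb⟩ := exists_isReduction_span_singleton hdim hJ.1
  obtain rfl : Ideal.span {b} = J := hJ.2 _ hb ((Ideal.span_singleton_le_iff_mem _).mpr hbJ)
  have h3 : I ^ (2 + 1) = Ideal.span {b} * I ^ 2 := by
    have := Nat.sInf_mem (s := {r : ℕ | I ^ (r + 1) = Ideal.span {b} * I ^ r}) hb.2
    rwa [show sInf {r : ℕ | I ^ (r + 1) = Ideal.span {b} * I ^ r} = 2 from hJ2] at this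
  have hbn := mem_nonZeroDivisors_of_isReduction hreg hb
  refine ⟨⟨b, hb⟩, fun a ha ↦ ⟨pow_succ_eq_mul_pow_of_isReduction h3 hbn ha, fun h ↦ ?_⟩⟩
  have h1 : I ^ (1 + 1) = Ideal.span {b} * I ^ 1 :=
    pow_succ_eq_mul_pow_of_isReduction (by rw [pow_one]; exact h)
      (mem_nonZeroDivisors_of_isReduction hreg ha) hb
  have h2 : sInf {r : ℕ | I ^ (r + 1) = Ideal.span {b} * I ^ r} ≤ 1 := Nat.sInf_le h1
  rw [show sInf {r : ℕ | I ^ (r + 1) = Ideal.span {b} * I ^ r} = 2 from hJ2] at h2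
  omega

end ReductionExistence

section FiberConePrincipal

theorem IsFiberLike.finrank_coker_mulOne {k F : Type*} [Field k] [CommRing F] [Algebra k F]
    {𝒜 : ℕ → Submodule k F} [GradedAlgebra 𝒜] {t : F} (H : IsFiberLike 𝒜 t) :
    Module.finrank k (𝒜 2 ⧸ LinearMap.range H.mulOne) + Module.finrank k (𝒜 1) =
      Module.finrank k (𝒜 2) + Module.finrank k (torsionOne 𝒜 t) := by
  have := H.finite_one
  have := H.finite_two
  have h1 := (LinearMap.range H.mulOne).finrank_quotient_add_finrank
  have h2 := H.mulOne.finrank_range_add_finrank_ker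
  rw [H.finrank_ker_mulOne] at h2
  omega

universe u

variable {A : Type u} [CommRing A] [IsLocalRing A] {I : Ideal A} {a : A}

/-- The class in degree one of the fiber cone of an element of `I`. -/
noncomputable def initialForm (ha : a ∈ I) : FiberCone I :=
  fiberMonomial I 1 ⟨a, by rwa [pow_one]⟩

theorem initialForm_mul (ha : a ∈ I) (n : ℕ) (x : ↥(I ^ n)) :
    initialForm ha * fiberMonomial I n x =
      fiberMonomial I (n + 1) ⟨a * x, by rw [pow_succ']; exact Ideal.mul_mem_mul ha x.2⟩ := by
  rw [initialForm, fiberMonomial_mul]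
  exact fiberMonomial_congr I (add_comm 1 n) _ _

theorem initialForm_pow (ha : a ∈ I) (n : ℕ) :
    initialForm ha ^ n = fiberMonomial I n ⟨a ^ n, Ideal.pow_mem_pow ha n⟩ :=
  fiberMonomial_one_pow _ n

theorem initialForm_mem (ha : a ∈ I) : initialForm ha ∈ fiberGrading I 1 :=
  fiberMonomial_mem I 1 _

theorem fiberMonomial_one_eq_zero_iff {x : ↥(I ^ 1)} :
    fiberMonomial I 1 x = 0 ↔ (x : A) ∈ maximalIdeal A * I := by
  rw [fiberMonomial_eq_zero_iff]
  simp only [pow_one]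

theorem fiberMonomial_mem_torsionOne (ha : a ∈ I) {x : ↥(I ^ 1)} :
    fiberMonomial I 1 x ∈ torsionOne (fiberGrading I) (initialForm ha) ↔
      a * x ∈ maximalIdeal A * I ^ 2 := by
  rw [mem_torsionOne, initialForm_mul, fiberMonomial_eq_zero_iff]
  exact and_iff_right (fiberMonomial_mem I 1 x)

theorem exists_fiberMonomial_eq_initialForm_mul_iff (ha : a ∈ I) {x : ↥(I ^ 2)} :
    (∃ z ∈ fiberGrading I 1, fiberMonomial I 2 x = initialForm ha * z) ↔
      (x : A) ∈ Ideal.span {a} * I ⊔ maximalIdeal A * I ^ 2 := by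
  constructor
  · rintro ⟨z, hz, h⟩
    obtain ⟨c, rfl⟩ := (mem_fiberGrading I).mp hz
    rw [initialForm_mul, ← sub_eq_zero, ← map_sub, fiberMonomial_eq_zero_iff] at h
    have h1 : (x : A) = a * c + (x - a * c) := by ring
    rw [h1]
    exact Submodule.add_mem_sup
      (Ideal.mem_span_singleton_mul.mpr ⟨c, by simpa using c.2, rfl⟩) h
  · intro h
    obtain ⟨y, hy, w, hw, hyw⟩ := Submodule.mem_sup.mp h
    obtain ⟨c, hc, rfl⟩ := Ideal.mem_span_singleton_mul.mp hy
    have hc1 : c ∈ I ^ 1 := by rwa [pow_one]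
    refine ⟨_, fiberMonomial_mem I 1 ⟨c, hc1⟩, ?_⟩
    rw [initialForm_mul, ← sub_eq_zero, ← map_sub, fiberMonomial_eq_zero_iff]
    change (x : A) - a * c ∈ _
    rwa [← hyw, add_sub_cancel_left]

theorem exists_fiberMonomial_eq_smul_initialForm_iff (ha : a ∈ I) {x : ↥(I ^ 1)} :
    (∃ c : ResidueField A, fiberMonomial I 1 x = c • initialForm ha) ↔
      (x : A) ∈ Ideal.span {a} ⊔ maximalIdeal A * I := by
  constructor
  · rintro ⟨c, h⟩
    obtain ⟨c, rfl⟩ := residue_surjective c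
    rw [residue_smul, initialForm, ← map_smul, ← sub_eq_zero, ← map_sub, fiberMonomial_one_eq_zero_iff] at h
    have h1 : (x : A) = c * a + (x - c * a) := by ring
    rw [h1]
    exact Submodule.add_mem_sup (Ideal.mul_mem_left _ _ (Ideal.mem_span_singleton_self a)) h
  · intro h
    obtain ⟨y, hy, w, hw, hyw⟩ := Submodule.mem_sup.mp h
    obtain ⟨c, rfl⟩ := Ideal.mem_span_singleton'.mp hy
    refine ⟨residue A c, ?_⟩
    rw [residue_smul, initialForm, ← map_smul, ← sub_eq_zero, ← map_sub, fiberMonomial_one_eq_zero_iff]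
    change (x : A) - c * a ∈ _
    rwa [← hyw, add_sub_cancel_left]

theorem inf_colon_eq_iff (ha : a ∈ I) :
    I ⊓ (Ideal.span {a} * I ⊔ maximalIdeal A * I ^ 2).colon (I : Set A) =
        Ideal.span {a} ⊔ maximalIdeal A * I ↔
      ∀ x ∈ fiberGrading I 1,
        (∀ y ∈ fiberGrading I 1, ∃ z ∈ fiberGrading I 1, x * y = initialForm ha * z) →
        ∃ c : ResidueField A, x = c • initialForm ha := by
  have key (x : ↥(I ^ 1)) : (∀ y ∈ fiberGrading I 1, ∃ z ∈ fiberGrading I 1,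
      fiberMonomial I 1 x * y = initialForm ha * z) ↔
      (x : A) ∈ (Ideal.span {a} * I ⊔ maximalIdeal A * I ^ 2).colon (I : Set A) := by
    rw [Submodule.mem_colon]
    constructor
    · intro h y hy
      have h1 := h _ (fiberMonomial_mem I 1 ⟨y, by rwa [pow_one]⟩)
      rw [fiberMonomial_mul] at h1
      exact (exists_fiberMonomial_eq_initialForm_mul_iff ha).mp h1
    · intro h y hy
      obtain ⟨y, rfl⟩ := (mem_fiberGrading I).mp hy
      rw [fiberMonomial_mul]
      exact (exists_fiberMonomial_eq_initialForm_mul_iff ha).mpr (h y (by simpa using y.2))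
  constructor
  · intro h x hx hxy
    obtain ⟨x, rfl⟩ := (mem_fiberGrading I).mp hx
    rw [key] at hxy
    rw [exists_fiberMonomial_eq_smul_initialForm_iff, ← h]
    exact ⟨by simpa using x.2, hxy⟩
  · intro h
    refine le_antisymm ?_ (sup_le ?_ ?_)
    · rintro x ⟨hxI, hx⟩
      have hx1 : x ∈ I ^ 1 := by rwa [pow_one]
      exact (exists_fiberMonomial_eq_smul_initialForm_iff ha (x := ⟨x, hx1⟩)).mp
        (h _ (fiberMonomial_mem I 1 _) ((key ⟨x, hx1⟩).mpr hx))
    · rw [Ideal.span_singleton_le_iff_mem]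
      refine ⟨ha, Submodule.mem_colon.mpr fun y hy ↦ Submodule.mem_sup_left ?_⟩
      exact Ideal.mul_mem_mul (Ideal.mem_span_singleton_self a) hy
    · intro x hx
      refine ⟨Ideal.mul_le_right hx, Submodule.mem_colon.mpr fun y hy ↦ Submodule.mem_sup_right ?_⟩
      rw [pow_two, ← mul_assoc]
      exact Ideal.mul_mem_mul hx hy

theorem span_singleton_mul_inf_eq_iff (ha : a ∈ I) (hnzd : a ∈ nonZeroDivisors A) :
    Ideal.span {a} * I ⊓ maximalIdeal A * I ^ 2 = Ideal.span {a} * (maximalIdeal A * I) ↔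
      torsionOne (fiberGrading I) (initialForm ha) = ⊥ := by
  constructor
  · intro h
    rw [eq_bot_iff]
    intro x hx
    obtain ⟨⟨c, hc⟩, rfl⟩ := (mem_fiberGrading I).mp hx.1
    rw [fiberMonomial_mem_torsionOne] at hx
    have h1 : a * c ∈ Ideal.span {a} * I ⊓ maximalIdeal A * I ^ 2 :=
      ⟨Ideal.mem_span_singleton_mul.mpr ⟨c, by simpa using hc, rfl⟩, hx⟩
    rw [h] at h1
    obtain ⟨z, hz, hz'⟩ := Ideal.mem_span_singleton_mul.mp h1
    rw [mul_cancel_left_mem_nonZeroDivisors hnzd] at hz'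
    rw [Submodule.mem_bot, fiberMonomial_one_eq_zero_iff]
    exact hz' ▸ hz
  · intro h
    refine le_antisymm ?_ (le_inf (Ideal.mul_mono_right Ideal.mul_le_right) ?_)
    · rintro _ ⟨hx, hx'⟩
      obtain ⟨c, hc, rfl⟩ := Ideal.mem_span_singleton_mul.mp hx
      have hc1 : c ∈ I ^ 1 := by rwa [pow_one]
      have h1 := (fiberMonomial_mem_torsionOne ha (x := ⟨c, hc1⟩)).mpr hx'
      rw [h, Submodule.mem_bot, fiberMonomial_one_eq_zero_iff] at h1
      exact Ideal.mem_span_singleton_mul.mpr ⟨c, h1, rfl⟩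
    · rw [mul_left_comm, pow_two]
      exact Ideal.mul_mono_right (Ideal.mul_mono_left ((Ideal.span_singleton_le_iff_mem _).mpr ha))

theorem lengthQuot_pow_two (ha : a ∈ I) (H : IsFiberLike (fiberGrading I) (initialForm ha)) :
    lengthQuot (I ^ 2) (maximalIdeal A * I ^ 2 ⊔ Ideal.span {a} * I) =
      Module.finrank (ResidueField A) (fiberGrading I 2 ⧸ LinearMap.range H.mulOne) := by
  have := H.finite_two
  let φ : ↥(I ^ 2) →ₗ[A] fiberGrading I 2 :=
    LinearMap.codRestrict ((fiberGrading I 2).restrictScalars A) (fiberMonomial I 2)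
      (fiberMonomial_mem I 2)
  have hφ : Function.Surjective φ := by
    rintro ⟨x, hx⟩
    obtain ⟨c, rfl⟩ := (mem_fiberGrading I).mp hx
    exact ⟨c, rfl⟩
  let π : fiberGrading I 2 →ₗ[A] fiberGrading I 2 ⧸ LinearMap.range H.mulOne :=
    (LinearMap.range H.mulOne).mkQ.restrictScalars A
  refine lengthQuot_eq_finrank (π ∘ₗ φ)
    ((Submodule.mkQ_surjective _).comp hφ) fun x ↦ ?_
  rw [sup_comm, ← exists_fiberMonomial_eq_initialForm_mul_iff ha]
  change Submodule.Quotient.mk (φ x) = (0 : _ ⧸ LinearMap.range H.mulOne) ↔ _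
  rw [Submodule.Quotient.mk_eq_zero]
  constructor
  · rintro ⟨z, hz⟩
    exact ⟨z, z.2, (congrArg Subtype.val hz).symm⟩
  · rintro ⟨z, hz, h⟩
    exact ⟨⟨z, hz⟩, Subtype.ext h.symm⟩

variable [IsNoetherianRing A]

theorem isFiberLike_fiberGrading (ha : a ∈ I) (hreg : ∃ x ∈ I, x ∈ nonZeroDivisors A)
    (h3 : I ^ 3 = Ideal.span {a} * I ^ 2) : IsFiberLike (fiberGrading I) (initialForm ha) := by
  have hred : IsReduction (Ideal.span {a}) I := ⟨(Ideal.span_singleton_le_iff_mem _).mpr ha, 2, h3⟩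
  have hnzd := mem_nonZeroDivisors_of_isReduction hreg hred
  refine ⟨initialForm_mem ha, fun x ↦ fiberGrading_zero_exists_eq, fun n h ↦ ?_, fun n hn x hx ↦ ?_,
    fun n hn x hx h ↦ ?_, finite_fiberGrading 1, finite_fiberGrading 2⟩
  · rw [initialForm_pow, fiberMonomial_eq_zero_iff] at h
    exact pow_notMem_maximalIdeal_mul_pow hreg hred n h
  · obtain ⟨⟨c, hc⟩, rfl⟩ := (mem_fiberGrading I).mp hx
    have hc' := hc
    rw [pow_succ_eq_mul_pow_of_le h3 hn] at hc'
    obtain ⟨z, hz, rfl⟩ := Ideal.mem_span_singleton_mul.mp hc'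
    exact ⟨_, fiberMonomial_mem I n ⟨z, hz⟩, (initialForm_mul ha n ⟨z, hz⟩).symm⟩
  · obtain ⟨⟨c, hc⟩, rfl⟩ := (mem_fiberGrading I).mp hx
    rw [initialForm_mul, fiberMonomial_eq_zero_iff] at h
    change a * c ∈ _ at h
    rw [pow_succ_eq_mul_pow_of_le h3 hn, mul_left_comm] at h
    rw [fiberMonomial_eq_zero_iff]
    obtain ⟨z, hz, hz'⟩ := Ideal.mem_span_singleton_mul.mp h
    rw [mul_cancel_left_mem_nonZeroDivisors hnzd] at hz'
    exact hz' ▸ hz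

theorem lengthQuot_span_singleton_mul_inf (ha : a ∈ I) (hnzd : a ∈ nonZeroDivisors A) :
    lengthQuot (Ideal.span {a} * I ⊓ maximalIdeal A * I ^ 2)
      (Ideal.span {a} * (maximalIdeal A * I)) =
      Module.finrank (ResidueField A) (torsionOne (fiberGrading I) (initialForm ha)) := by
  let N : Submodule A ↥(I ^ 1) :=
    Submodule.comap (LinearMap.mulLeft A a ∘ₗ (I ^ 1).subtype) (maximalIdeal A * I ^ 2)
  let φ : N →ₗ[A] torsionOne (fiberGrading I) (initialForm ha) :=
    LinearMap.codRestrict ((torsionOne (fiberGrading I) (initialForm ha)).restrictScalars A)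
      (fiberMonomial I 1 ∘ₗ N.subtype) fun x ↦ (fiberMonomial_mem_torsionOne ha).mpr x.2
  have hφ : Function.Surjective φ := by
    rintro ⟨x, hx⟩
    obtain ⟨c, rfl⟩ := (mem_fiberGrading I).mp hx.1
    exact ⟨⟨c, (fiberMonomial_mem_torsionOne ha).mp hx⟩, rfl⟩
  let ψ : N →ₗ[A] ↥(Ideal.span {a} * I ⊓ maximalIdeal A * I ^ 2) :=
    LinearMap.codRestrict _ (LinearMap.mulLeft A a ∘ₗ (I ^ 1).subtype ∘ₗ N.subtype) fun x ↦
      ⟨Ideal.mem_span_singleton_mul.mpr ⟨x, by simpa using x.1.2, rfl⟩, x.2⟩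
  have hψ : Function.Bijective ψ := by
    constructor
    · intro x y h
      have h1 : a * (x : A) = a * (y : A) := congrArg Subtype.val h
      rw [mul_cancel_left_mem_nonZeroDivisors hnzd] at h1
      exact Subtype.ext (Subtype.ext h1)
    · rintro ⟨x, hx, hx'⟩
      obtain ⟨c, hc, rfl⟩ := Ideal.mem_span_singleton_mul.mp hx
      exact ⟨⟨⟨c, by rwa [pow_one]⟩, hx'⟩, rfl⟩
  let e := LinearEquiv.ofBijective ψ hψ
  have := finite_fiberGrading (I := I) 1
  have : Module.Finite (ResidueField A) (torsionOne (fiberGrading I) (initialForm ha)) :=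
    Submodule.finiteDimensional_of_le (inf_le_left : _ ≤ fiberGrading I 1)
  refine lengthQuot_eq_finrank (φ ∘ₗ e.symm.toLinearMap) (hφ.comp e.symm.surjective) fun y ↦ ?_
  obtain ⟨x, rfl⟩ := e.surjective y
  have h1 : (φ ∘ₗ e.symm.toLinearMap) (e x) = φ x := congrArg φ (e.symm_apply_apply x)
  have h2 : φ x = 0 ↔ fiberMonomial I 1 (x : ↥(I ^ 1)) = 0 := Subtype.ext_iff
  have h3 : ((e x : ↥(Ideal.span {a} * I ⊓ maximalIdeal A * I ^ 2)) : A) = a * (x : A) := rfl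
  rw [h1, h2, h3, fiberMonomial_one_eq_zero_iff, Ideal.mem_span_singleton_mul]
  constructor
  · exact fun h ↦ ⟨_, h, rfl⟩
  · rintro ⟨z, hz, hz'⟩
    rw [mul_cancel_left_mem_nonZeroDivisors hnzd] at hz'
    exact hz' ▸ hz

end FiberConePrincipal

section FiberConeDecomposition

open Polynomial

universe u

variable {A : Type u} [CommRing A] [IsLocalRing A] {I J : Ideal A} {a : A}

theorem mem_fiberPiece_span_singleton {n : ℕ} {x : FiberCone (Ideal.span {a})} :
    x ∈ fiberPiece (Ideal.span {a}) n ↔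
      ∃ c : ResidueField A, x = c • initialForm (Ideal.mem_span_singleton_self a) ^ n := by
  rw [mem_fiberPiece]
  constructor
  · rintro ⟨⟨c, hc⟩, rfl⟩
    have hc' := hc
    rw [Ideal.span_singleton_pow] at hc'
    obtain ⟨r, rfl⟩ := Ideal.mem_span_singleton'.mp hc'
    exact ⟨residue A r, by rw [residue_smul, initialForm_pow, ← map_smul]; rfl⟩
  · rintro ⟨c, rfl⟩
    obtain ⟨r, rfl⟩ := residue_surjective c
    exact ⟨r • ⟨a ^ n, Ideal.pow_mem_pow (Ideal.mem_span_singleton_self a) n⟩, by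
      rw [residue_smul, initialForm_pow, map_smul]⟩

theorem initialIdeal_span_singleton (a : A) :
    initialIdeal (Ideal.span {a}) = Ideal.span {initialForm (Ideal.mem_span_singleton_self a)} := by
  refine le_antisymm (Ideal.span_le.mpr ?_) ?_
  · intro x hx
    obtain ⟨c, rfl⟩ := mem_fiberPiece_span_singleton.mp hx
    rw [pow_one, SetLike.mem_coe, Algebra.smul_def]
    exact Ideal.mul_mem_left _ _ (Ideal.mem_span_singleton_self _)
  · rw [Ideal.span_singleton_le_iff_mem]
    exact Ideal.subset_span (mem_fiberPiece_span_singleton.mpr ⟨1, by rw [one_smul, pow_one]⟩)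

theorem mem_shiftPiece_span_singleton {d n : ℕ} {x : FiberCone (Ideal.span {a})} :
    x ∈ shiftPiece (fiberPiece (Ideal.span {a})) d n ↔
      ∃ c : ResidueField A, x = c • initialForm (Ideal.mem_span_singleton_self a) ^ (n - d) ∧
        (n < d → c = 0) := by
  unfold shiftPiece
  split_ifs with h
  · rw [mem_fiberPiece_span_singleton]
    exact exists_congr fun c ↦ (and_iff_left fun h' ↦ absurd h' (by omega)).symm
  · rw [Submodule.mem_bot]
    constructor
    · rintro rfl
      exact ⟨0, by rw [zero_smul], fun _ ↦ rfl⟩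
    · rintro ⟨c, rfl, hc⟩
      rw [hc (by omega), zero_smul]

theorem mem_residuePiece_span_singleton {n : ℕ}
    {x : FiberCone (Ideal.span {a}) ⧸ initialIdeal (Ideal.span {a})} :
    x ∈ residuePiece (Ideal.span {a}) n ↔
      ∃ c : ResidueField A, x = Ideal.Quotient.mk _
        (c • initialForm (Ideal.mem_span_singleton_self a) ^ n) := by
  constructor
  · rintro ⟨y, hy, rfl⟩
    obtain ⟨c, rfl⟩ := mem_fiberPiece_span_singleton.mp hy
    exact ⟨c, rfl⟩
  · rintro ⟨c, rfl⟩
    exact ⟨_, mem_fiberPiece_span_singleton.mpr ⟨c, rfl⟩, rfl⟩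

theorem mem_shiftPiece_residuePiece {d n : ℕ}
    {x : FiberCone (Ideal.span {a}) ⧸ initialIdeal (Ideal.span {a})} :
    x ∈ shiftPiece (residuePiece (Ideal.span {a})) d n ↔
      ∃ c : ResidueField A, x = Ideal.Quotient.mk _
        (c • initialForm (Ideal.mem_span_singleton_self a) ^ (n - d)) ∧ (n < d → c = 0) := by
  unfold shiftPiece
  split_ifs with h
  · rw [mem_residuePiece_span_singleton]
    exact exists_congr fun c ↦ (and_iff_left fun h' ↦ absurd h' (by omega)).symm
  · rw [Submodule.mem_bot]
    constructor
    · rintro rfl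
      exact ⟨0, by rw [zero_smul, map_zero], fun _ ↦ rfl⟩
    · rintro ⟨c, rfl, hc⟩
      rw [hc (by omega), zero_smul, map_zero]

variable [IsNoetherianRing A]

theorem aeval_initialForm_bijective (ha : a ∈ nonZeroDivisors A) :
    Function.Bijective (aeval (R := ResidueField A)
      (initialForm (Ideal.mem_span_singleton_self a))) := by
  constructor
  · rw [injective_iff_map_eq_zero]
    intro f hf
    choose r hr using fun n ↦ residue_surjective (f.coeff n)
    have hmon (n : ℕ) : fiberMonomial (Ideal.span {a}) n
        (r n • ⟨a ^ n, Ideal.pow_mem_pow (Ideal.mem_span_singleton_self a) n⟩) =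
        f.coeff n • initialForm (Ideal.mem_span_singleton_self a) ^ n := by
      rw [← hr, residue_smul, initialForm_pow, map_smul]
    rw [aeval_eq_sum_range] at hf
    simp only [← hmon] at hf
    ext n
    rw [coeff_zero]
    by_cases hn : n ∈ Finset.range (f.natDegree + 1)
    · have h := sum_fiberMonomial_eq_zero _ hf hn
      rw [hmon] at h
      refine (smul_eq_zero.mp h).resolve_right fun h0 ↦ ?_
      rw [initialForm_pow, fiberMonomial_eq_zero_iff] at h0
      exact pow_notMem_maximalIdeal_mul_pow ⟨a, Ideal.mem_span_singleton_self a, ha⟩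
        ⟨le_rfl, 0, by rw [pow_succ']⟩ n h0
    · exact coeff_eq_zero_of_natDegree_lt (by simpa using hn)
  · intro x
    obtain ⟨f, rfl⟩ := fiberMk_surjective _ x
    rw [← sum_reesMonomial _ f, map_sum]
    refine sum_mem (S := (aeval (R := ResidueField A)
      (initialForm (Ideal.mem_span_singleton_self a))).range) fun n _ ↦ ?_
    obtain ⟨c, hc⟩ := mem_fiberPiece_span_singleton.mp
      ((mem_fiberPiece _).mpr ⟨⟨(f : A[X]).coeff n, f.2 n⟩, rfl⟩)
    refine ⟨monomial n c, (aeval_monomial _ : _ = _).trans ?_⟩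
    rw [← Algebra.smul_def]
    exact hc.symm

theorem IsFiberLike.hasFiberDecomposition (h : Ideal.span {a} ≤ I) (hnzd : a ∈ nonZeroDivisors A)
    (H : IsFiberLike (fiberGrading I) (initialForm (h (Ideal.mem_span_singleton_self a))))
    {p q s : ℕ} (B : FiberFrame (fiberGrading I)
      (initialForm (h (Ideal.mem_span_singleton_self a))) p q s) :
    HasFiberDecomposition h p q s := by
  let k := ResidueField A
  let S := FiberCone (Ideal.span {a})
  let τ : S := initialForm (Ideal.mem_span_singleton_self a)
  let ρ : k[X] ≃ₐ[k] S := AlgEquiv.ofBijective (aeval τ) (aeval_initialForm_bijective hnzd)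
  have hρ : ρ X = τ := aeval_X τ
  let _ : Algebra S (FiberCone I) := (fiberMap h).toRingHom.toAlgebra
  have hA : IsScalarTower A S (FiberCone I) :=
    IsScalarTower.of_algebraMap_eq fun r ↦ ((fiberMap h).commutes r).symm
  have hk : IsScalarTower k S (FiberCone I) := by
    refine IsScalarTower.of_algebraMap_eq fun r ↦ ?_
    obtain ⟨r, rfl⟩ := residue_surjective r
    exact ((fiberMap h).commutes r).symm
  have hτ : algebraMap S (FiberCone I) (ρ X) =
      initialForm (h (Ideal.mem_span_singleton_self a)) := by
    rw [hρ]; rfl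
  have hQ : Ideal.span {ρ X} = initialIdeal (Ideal.span {a}) := by
    rw [hρ]; exact (initialIdeal_span_singleton a).symm
  let κ : (S ⧸ Ideal.span {ρ X}) ≃ₗ[S] (S ⧸ initialIdeal (Ideal.span {a})) :=
    Submodule.quotEquivOfEq _ _ hQ
  have hres : ∀ (n : ℕ) (x : S ⧸ Ideal.span {ρ X}),
      κ x ∈ shiftPiece (residuePiece (Ideal.span {a})) 1 n ↔
      ∃ c : k, x = Ideal.Quotient.mk _ (c • ρ X ^ (n - 1)) ∧ (n < 1 → c = 0) := by
    intro n x
    rw [mem_shiftPiece_residuePiece,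
      show initialForm (Ideal.mem_span_singleton_self a) = ρ X from hρ.symm]
    exact exists_congr fun c ↦ and_congr_left fun _ ↦
      ⟨fun hx ↦ κ.injective hx, fun hx ↦ congrArg κ hx⟩
  have hshift : ∀ (d n : ℕ) (x : S), x ∈ shiftPiece (fiberPiece (Ideal.span {a})) d n ↔
      ∃ c : k, x = c • ρ X ^ (n - d) ∧ (n < d → c = 0) := by
    rw [hρ]; exact fun d n x ↦ mem_shiftPiece_span_singleton
  have hpiece : ∀ (n : ℕ) (x : S), x ∈ fiberPiece (Ideal.span {a}) n ↔ ∃ c : k, x = c • ρ X ^ n := by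
    rw [hρ]; exact fun n x ↦ mem_fiberPiece_span_singleton
  let e := (B.equiv H hτ).trans (LinearEquiv.prodCongr (LinearEquiv.refl S S)
    (LinearEquiv.prodCongr (LinearEquiv.refl S (Fin p → S))
      (LinearEquiv.prodCongr (LinearEquiv.refl S (Fin q → S)) (LinearEquiv.piCongrRight fun _ ↦ κ))))
  refine ⟨e.restrictScalars A, fun c x ↦ map_smul e c x, fun n ↦ ?_⟩
  ext y
  obtain ⟨x, rfl⟩ := e.surjective y
  have h1 := B.mem_iff_isHomogeneous H hτ (n := n) (x := x)
  have h2 : (e x).1 = (B.equiv H hτ x).1 ∧ (e x).2.1 = (B.equiv H hτ x).2.1 ∧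
      (e x).2.2.1 = (B.equiv H hτ x).2.2.1 ∧
      ∀ i, (e x).2.2.2 i = κ ((B.equiv H hτ x).2.2.2 i) := ⟨rfl, rfl, rfl, fun _ ↦ rfl⟩
  simp only [Submodule.mem_prod, Submodule.mem_pi, Set.mem_univ, forall_true_left, hpiece, hshift,
    h2, hres]
  refine Iff.trans ?_ h1
  constructor
  · rintro ⟨x', hx', hxx⟩
    rwa [← e.injective hxx]
  · exact fun hx ↦ ⟨x, hx, rfl⟩

end FiberConeDecomposition

section GorensteinCokernel

universe u

theorem IsFiberLike.finrank_coker_eq_one_of_isGorenstein {k F : Type u} [Field k] [CommRing F]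
    [Algebra k F] {𝒜 : ℕ → Submodule k F} [GradedAlgebra 𝒜] {t : F} (H : IsFiberLike 𝒜 t)
    (hG : IsGorenstein F) {d : F} (hd : d ∈ 𝒜 2) (hdt : ∀ x ∈ 𝒜 1, d ≠ t * x) :
    Module.finrank k (𝒜 2 ⧸ LinearMap.range H.mulOne) = 1 := by
  refine finrank_eq_one (Submodule.Quotient.mk ⟨d, hd⟩) ?_ fun w ↦ ?_
  · rw [Ne, Submodule.Quotient.mk_eq_zero]
    rintro ⟨z, hz⟩
    exact hdt z z.2 (congrArg Subtype.val hz).symm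
  · obtain ⟨⟨y, hy⟩, rfl⟩ := Submodule.Quotient.mk_surjective _ w
    obtain ⟨c, x, hx, hxy⟩ := H.exists_eq_smul_add_of_isGorenstein hG hd hdt hy
    refine ⟨c, ?_⟩
    rw [← Submodule.Quotient.mk_smul, Submodule.Quotient.eq]
    refine ⟨-⟨x, hx⟩, Subtype.ext ?_⟩
    rw [H.coe_mulOne]
    change t * -x = c • d - y
    rw [hxy]
    ring

theorem exists_notMem_initialForm_mul {A : Type u} [CommRing A] [IsLocalRing A]
    [IsNoetherianRing A] {I : Ideal A} {a : A} (ha : a ∈ I) (h : I ^ 2 ≠ Ideal.span {a} * I) :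
    ∃ d ∈ fiberGrading I 2, ∀ x ∈ fiberGrading I 1, d ≠ initialForm ha * x := by
  by_contra! hd
  refine h (le_antisymm (Ideal.le_of_le_sup_maximalIdeal_mul fun x hx ↦ ?_) ?_)
  · exact (exists_fiberMonomial_eq_initialForm_mul_iff ha (x := ⟨x, hx⟩)).mp
      (hd _ (fiberMonomial_mem I 2 _))
  · rw [pow_two]
    exact Ideal.mul_mono_left ((Ideal.span_singleton_le_iff_mem _).mpr ha)

end GorensteinCokernel

theorem proposition4p2 {A : Type*} [CommRing A] [IsLocalRing A] [IsNoetherianRing A]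
    [Infinite (ResidueField A)] (I : Ideal A)
    -- `I` is a regular ideal
    (hreg : ∃ x ∈ I, x ∈ nonZeroDivisors A)
    -- of analytic spread one
    (hspread : ringKrullDim (FiberCone I) = 1)
    -- and reduction number two
    (hred : reductionNumber I = 2) :
    -- (1) the decomposition of `F(I)` over `F(J)`, for every minimal reduction `J = (a)`
    (∀ (a : A) (ha : IsMinimalReduction (Ideal.span {a}) I), ∃ α : ℕ,
      (α : ℕ∞) = lengthQuot (Ideal.span {a} * I ⊓ maximalIdeal A * I ^ 2)
        (Ideal.span {a} * (maximalIdeal A * I)) ∧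
      -- the two exponents are not negative
      1 + α ≤ I.spanFinrank ∧ I.spanFinrank ≤ (I ^ 2).spanFinrank + α ∧
      HasFiberDecomposition ha.1.1 (I.spanFinrank - 1 - α)
        ((I ^ 2).spanFinrank + α - I.spanFinrank) α) ∧
    -- (2)
    IsBuchsbaum (FiberCone I) ∧
    -- (3)
    [ IsCohenMacaulay (FiberCone I),
      ∀ a : A, IsMinimalReduction (Ideal.span {a}) I →
        Ideal.span {a} * I ⊓ maximalIdeal A * I ^ 2 = Ideal.span {a} * (maximalIdeal A * I),
      ∃ a : A, IsMinimalReduction (Ideal.span {a}) I ∧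
        Ideal.span {a} * I ⊓ maximalIdeal A * I ^ 2 = Ideal.span {a} * (maximalIdeal A * I),
      ∀ a : A, IsMinimalReduction (Ideal.span {a}) I →
        ((I ^ 2).spanFinrank : ℕ∞) = I.spanFinrank +
          lengthQuot (I ^ 2) (maximalIdeal A * I ^ 2 ⊔ Ideal.span {a} * I),
      ∃ a : A, IsMinimalReduction (Ideal.span {a}) I ∧
        ((I ^ 2).spanFinrank : ℕ∞) = I.spanFinrank +
          lengthQuot (I ^ 2) (maximalIdeal A * I ^ 2 ⊔ Ideal.span {a} * I) ].TFAE ∧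
    -- (4)
    [ IsGorenstein (FiberCone I),
      ∀ a : A, IsMinimalReduction (Ideal.span {a}) I →
        (I ^ 2).spanFinrank = I.spanFinrank + 1 ∧
        lengthQuot (I ^ 2) (maximalIdeal A * I ^ 2 ⊔ Ideal.span {a} * I) = 1 ∧
        I ⊓ (Ideal.span {a} * I ⊔ maximalIdeal A * I ^ 2).colon (I : Set A) =
          Ideal.span {a} ⊔ maximalIdeal A * I,
      ∃ a : A, IsMinimalReduction (Ideal.span {a}) I ∧
        (I ^ 2).spanFinrank = I.spanFinrank + 1 ∧
        lengthQuot (I ^ 2) (maximalIdeal A * I ^ 2 ⊔ Ideal.span {a} * I) = 1 ∧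
        I ⊓ (Ideal.span {a} * I ⊔ maximalIdeal A * I ^ 2).colon (I : Set A) =
          Ideal.span {a} ⊔ maximalIdeal A * I ].TFAE := by
  obtain ⟨⟨a₀, ha₀⟩, hall⟩ := exists_isReduction_and_forall hreg hspread hred
  have hmin₀ := isMinimalReduction_span_singleton hreg ha₀
  have hmem {a : A} (ha : IsMinimalReduction (Ideal.span {a}) I) : a ∈ I :=
    ha.1.1 (Ideal.mem_span_singleton_self a)
  have hnzd {a : A} (ha : IsMinimalReduction (Ideal.span {a}) I) : a ∈ nonZeroDivisors A :=
    mem_nonZeroDivisors_of_isReduction hreg ha.1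
  have H {a : A} (ha : IsMinimalReduction (Ideal.span {a}) I) :
      IsFiberLike (fiberGrading I) (initialForm (hmem ha)) :=
    isFiberLike_fiberGrading (hmem ha) hreg (hall a ha.1).1
  have hμ1 : Module.finrank (ResidueField A) (fiberGrading I 1) = I.spanFinrank := by
    rw [finrank_fiberGrading, pow_one]
  have hμ2 : Module.finrank (ResidueField A) (fiberGrading I 2) = (I ^ 2).spanFinrank :=
    finrank_fiberGrading 2
  have hcoker {a : A} (ha : IsMinimalReduction (Ideal.span {a}) I) :
      ∃ l : ℕ, lengthQuot (I ^ 2) (maximalIdeal A * I ^ 2 ⊔ Ideal.span {a} * I) = l ∧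
        l + I.spanFinrank = (I ^ 2).spanFinrank + Module.finrank (ResidueField A)
          (torsionOne (fiberGrading I) (initialForm (hmem ha))) :=
    ⟨_, lengthQuot_pow_two (hmem ha) (H ha), by rw [← hμ1, ← hμ2, (H ha).finrank_coker_mulOne]⟩
  have htors {a : A} (ha : IsMinimalReduction (Ideal.span {a}) I) :
      torsionOne (fiberGrading I) (initialForm (hmem ha)) = ⊥ ↔ Module.finrank (ResidueField A)
        (torsionOne (fiberGrading I) (initialForm (hmem ha))) = 0 := by
    have := (H ha).finite_one
    have : Module.Finite (ResidueField A)
        (torsionOne (fiberGrading I) (initialForm (hmem ha))) :=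
      Submodule.finiteDimensional_of_le (inf_le_left : _ ≤ fiberGrading I 1)
    exact Submodule.finrank_eq_zero.symm
  have hCM {a : A} (ha : IsMinimalReduction (Ideal.span {a}) I) : IsCohenMacaulay (FiberCone I) ↔
      torsionOne (fiberGrading I) (initialForm (hmem ha)) = ⊥ :=
    ⟨(H ha).torsionOne_eq_bot_of_isCohenMacaulay, (H ha).isCohenMacaulay hspread.le⟩
  have hinter {a : A} (ha : IsMinimalReduction (Ideal.span {a}) I) :
      Ideal.span {a} * I ⊓ maximalIdeal A * I ^ 2 = Ideal.span {a} * (maximalIdeal A * I) ↔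
        torsionOne (fiberGrading I) (initialForm (hmem ha)) = ⊥ :=
    span_singleton_mul_inf_eq_iff (hmem ha) (hnzd ha)
  have hlength {a : A} (ha : IsMinimalReduction (Ideal.span {a}) I) :
      ((I ^ 2).spanFinrank : ℕ∞) = I.spanFinrank +
          lengthQuot (I ^ 2) (maximalIdeal A * I ^ 2 ⊔ Ideal.span {a} * I) ↔
        torsionOne (fiberGrading I) (initialForm (hmem ha)) = ⊥ := by
    obtain ⟨l, hl, hl'⟩ := hcoker ha
    rw [hl, htors ha]
    norm_cast
    omega
  refine ⟨fun a ha ↦ ?_, (H hmin₀).isBuchsbaum hspread.le, ?_, ?_⟩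
  · obtain ⟨p, q, hp, hq, ⟨B⟩⟩ := (H ha).exists_frame
    rw [hμ1] at hp
    rw [hμ2] at hq
    refine ⟨_, (lengthQuot_span_singleton_mul_inf (hmem ha) (hnzd ha)).symm, by omega, by omega, ?_⟩
    have hB := (H ha).hasFiberDecomposition ha.1.1 (hnzd ha) B
    convert hB using 1 <;> omega
  · tfae_have 1 → 2 := fun h a ha ↦ (hinter ha).mpr ((hCM ha).mp h)
    tfae_have 2 → 3 := fun h ↦ ⟨a₀, hmin₀, h a₀ hmin₀⟩
    tfae_have 3 → 1 := fun ⟨a, ha, h⟩ ↦ (hCM ha).mpr ((hinter ha).mp h)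
    tfae_have 1 → 4 := fun h a ha ↦ (hlength ha).mpr ((hCM ha).mp h)
    tfae_have 4 → 5 := fun h ↦ ⟨a₀, hmin₀, h a₀ hmin₀⟩
    tfae_have 5 → 1 := fun ⟨a, ha, h⟩ ↦ (hCM ha).mpr ((hlength ha).mp h)
    tfae_finish
  · tfae_have 1 → 2 := by
      intro hG a ha
      obtain ⟨d, hd, hdt⟩ := exists_notMem_initialForm_mul (hmem ha) (hall a ha.1).2
      have hK := (htors ha).mp ((H ha).torsionOne_eq_bot_of_isGorenstein hG)
      have h1 := (H ha).finrank_coker_eq_one_of_isGorenstein hG hd hdt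
      have h2 := (H ha).finrank_coker_mulOne
      refine ⟨by omega, ?_, ?_⟩
      · rw [lengthQuot_pow_two (hmem ha) (H ha), h1, Nat.cast_one]
      · rw [inf_colon_eq_iff (hmem ha)]
        exact fun x hx hxy ↦ (H ha).exists_eq_smul_of_isGorenstein hG hd hdt hx hxy
    tfae_have 2 → 3 := fun h ↦ ⟨a₀, hmin₀, h a₀ hmin₀⟩
    tfae_have 3 → 1 := by
      rintro ⟨a, ha, h1, h2, h3⟩
      obtain ⟨l, hl, hl'⟩ := hcoker ha
      obtain rfl : l = 1 := by rw [hl] at h2; exact_mod_cast h2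
      exact (H ha).isGorenstein ((htors ha).mpr (by omega)) (by omega)
        ((inf_colon_eq_iff (hmem ha)).mp h3)
    tfae_finish
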